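/- Let $K$ be a field of characteristic $0$ and let functions of the times $t=(t_1=x,t_2,t_3,\dots)$ be formal power series over $K$ in $t-a$, where the base point $a$ has finitely many non-zero coordinates; $\partial_n=\partial/\partial t_n$ for $n\ge1$, $\partial_n=0$ for $n\le 0$, $D$ is the symbol of $\partial=\partial_1$, and $(\cdot)_\pm$ denote the parts of order $\ge 0$, resp. $<0$, of a pseudo-differential operator. Put $[\partial]=(\partial_1,\tfrac12\partial_2,\tfrac13\partial_3,\dots)$ and $e^{\sum_l t_lz^l}=\sum_n p_n(t)z^n$. Let $r\ge 1$ and let $\tau$, $\tau(a)\ne 0$, be a tau-function of a $\mathsf{cKP}_{r,1}$ hierarchy: the dressing operator $W=\sum_{n\ge0}\frac{p_n(-[\partial])\tau}{\tau}D^{-n}$ and $L=WD^rW^{-1}$, $L^{n/r}=WD^nW^{-1}$ satisfy $\partial_nW=-(L^{n/r})_-W$ for all $n\ge 1$, and $L=L_++\Phi D^{-1}\Psi$, where $\Phi$ is an eigenfunction ($\partial_n\Phi=(L^{n/r})_+(\Phi)$) and $\Psi$ an adjoint eigenfunction ($\partial_n\Psi=-(L^*)^{n/r}_+(\Psi)$).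 A squared eigenfunction potential (SEP) $S(f,g)$ of an eigenfunction $f$ and an adjoint eigenfunction $g$ is a function with $\partial_nS(f,g)=\mathrm{Res}\,(D^{-1}g(L^{n/r})_+fD^{-1})$ for all $n\ge 1$; it is determined up to an additive constant. Put $L(f)=L_+(f)+\Phi S(f,\Psi)$, $L^*(g)=L^*_+(g)-\Psi S(\Phi,g)$, and define $L^i(f)$, $(L^*)^j(g)$ by iteration. Consider any family of eigenfunctions $f$ containing $\Phi$ and of adjoint eigenfunctions $g$ containing $\Psi$, and choose the constants of all the potentials $S(L^i(f),(L^*)^j(g))$ (one constant for each quadruple $f,i,g,j$) so that at the base point $t=a$ $$S(L^{i+1}(f),(L^*)^j(g))-S(L^i(f),(L^*)^{j+1}(g))=\partial_rS(L^i(f),(L^*)^j(g))+S(\Phi,(L^*)^j(g))\,S(L^i(f),\Psi).$$ (1) For all $f$, $g$ in the families and all $n\ge1$, $$\partial_{nr}S(f,g)=S(L^n(f),g)-S(f,(L^*)^n(g))-\sum_{i=0}^{n-1}S(L^{n-1-i}(\Phi),g)\,S(f,(L^*)^i(\Psi)).$$ (2) Suppose moreover that the constants are chosen so that $\partial_{rn}\tau=\tau\sum_{i=0}^{n-1}S(L^{n-1-i}(\Phi),(L^*)^i(\Psi))$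 at the base point $t=a$, for all $n\ge1$. Let $M=W\bigl(\sum_{l\ge1}\tfrac lr t_lD^{l-r}\bigr)W^{-1}$ and, for an integer $k\ge0$ with $r(k-1)\ge-1$ (that is, $k\ge 1$, or $k=0$ and $r=1$), consider the corrected non-isospectral flow $$\partial^*_kW=-(ML^k)_-W+X^{(1)}_{k-1}W,\qquad X^{(1)}_{k-1}=\sum_{j=0}^{k-2}\Bigl(j-\tfrac{k-2}2\Bigr)L^{k-2-j}(\Phi)\,D^{-1}(L^*)^j(\Psi).$$ This flow is induced by the flow of $\tau$ $$\partial^*_k\tau=\Bigl[\frac1r\sum_{l\ge1}l\,t_l\,\partial_{l+r(k-1)}-\frac{r(k-1)+1}{2r}\,\partial_{r(k-1)}+\frac1{2r}\sum_{l=1}^{r(k-1)-1}\partial_l\,\partial_{r(k-1)-l}+\frac12\sum_{l=1}^{k-2}\partial_{rl}\,\partial_{r(k-1-l)}\Bigr]\tau ,$$ and $\partial_k^*\tau$ is determined by the flow of $W$ up to adding a constant multiple of $\tau$. That is, for a function $\delta$, the variation $\sum_{n\ge0}\Bigl(\frac{p_n(-[\partial])\delta}{\tau}-\frac{\delta\,p_n(-[\partial])\tau}{\tau^2}\Bigr)D^{-n}$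 of $W$ that the variation $\delta$ of $\tau$ causes equals $\partial_k^*W$ if and only if $\delta$ equals the right-hand side above plus $c\,\tau$ for some $c\in K$. -/

import Mathlib

noncomputable section

namespace KP

/-- Functions of the multi-time `t = (t₁ = x, t₂, t₃, …)`, given by their formal Taylor expansion
at some base point: formal power series in the increments of the infinitely many times. -/
abbrev Fn (K : Type*) := MvPowerSeries ℕ+ K

variable {K : Type*} [Field K]

/-- The function `t_l`, expanded at the base point `a`. -/
def time (a : ℕ+ →₀ K) (l : ℕ+) : Fn K := MvPowerSeries.C (a l) + MvPowerSeries.X l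

/-- `∂/∂t_n` for `n ≥ 1`, and zero for `n ≤ 0` (there are no such times). -/
def dt (n : ℤ) (f : Fn K) : Fn K :=
  if h : 0 < n then MvPowerSeries.pderiv K (⟨n.toNat, by omega⟩ : ℕ+) f else 0

/-- `∂ = ∂/∂x = ∂/∂t₁`. -/
def dx (f : Fn K) : Fn K := MvPowerSeries.pderiv K (1 : ℕ+) f

/-- Coefficientwise sum `∑_{l ≥ 1} c_l` of a family of series in which every monomial
occurs in only finitely many members. -/
def formalSum (c : ℕ+ → Fn K) : Fn K := fun m => ∑ᶠ l, MvPowerSeries.coeff m (c l)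

/-- A family `t_l c_l` is summable in the sense required by `formalSum`. -/
theorem time_mul_summable (a : ℕ+ →₀ K) (c : ℕ+ → Fn K) (m : ℕ+ →₀ ℕ) :
    (Function.support fun l => MvPowerSeries.coeff m (time a l * c l)).Finite := by
  classical
  refine (a.support ∪ m.support).finite_toSet.subset fun l hl => ?_
  by_contra h
  have h1 : a l = 0 := by
    by_contra h1; exact h (by simp [h1])
  have h2 : m l = 0 := by
    by_contra h2; exact h (by simp [h2])
  apply hl
  have hX : (MvPowerSeries.X l : Fn K) ∣ time a l * c l := ⟨c l, by simp [time, h1]⟩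
  exact (MvPowerSeries.X_dvd_iff.mp hX) m h2

/-- `p_n(-[∂]) f`, where `[∂] = (∂₁, ∂₂/2, ∂₃/3, …)` and `∑ p_n(t) z^n = exp (∑_l t_l z^l)` are
the Schur polynomials, computed by their recursion `n p_n(t) = ∑_{l=1}^n l t_l p_{n-l}(t)`.
Thus `f(t - [λ⁻¹]) = ∑ λ^{-n} p_n(-[∂]) f(t)`. -/
def schurShift : ℕ → Fn K → Fn K
  | 0, f => f
  | n + 1, f => -((n + 1 : K)⁻¹ • ∑ l : Fin (n + 1), dt ((l : ℤ) + 1) (schurShift (n - l) f))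
  termination_by n => n
  decreasing_by omega

/-! ### Pseudo-differential operators -/

/-- Pseudo-differential operators `∑_j a_j D^j`, of order bounded above, given by their
coefficients `j ↦ a_j`. -/
def PDO (K : Type*) [Field K] : Submodule K (ℤ → Fn K) where
  carrier := {A | ∃ N : ℤ, ∀ n, N < n → A n = 0}
  add_mem' := by
    rintro A B ⟨M, hM⟩ ⟨N, hN⟩
    refine ⟨max M N, fun n hn => ?_⟩
    simp [hM n (lt_of_le_of_lt (le_max_left _ _) hn), hN n (lt_of_le_of_lt (le_max_right _ _) hn)]
  zero_mem' := ⟨0, fun _ _ => rfl⟩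
  smul_mem' := by
    rintro c A ⟨M, hM⟩
    exact ⟨M, fun n hn => by simp [hM n hn]⟩

/-- `f D^j`; in particular `mono f 0` is multiplication by `f`, and `mono 1 j` is `D^j`. -/
def mono (f : Fn K) (j : ℤ) : PDO K :=
  ⟨fun n => if n = j then f else 0, j, fun n hn => if_neg (by omega)⟩

instance : One (PDO K) := ⟨mono 1 0⟩

/-- The product, determined by the generalized Leibniz rule
`D^i b = ∑_{l ≥ 0} (i choose l) (∂^l b) D^{i-l}`, `i ∈ ℤ`. The sum has finite support. -/
instance : Mul (PDO K) where
  mul A B := ⟨fun n => ∑ᶠ p : ℤ × ℕ,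
      (Ring.choose p.1 p.2 : ℤ) • (A.1 p.1 * dx^[p.2] (B.1 (n - p.1 + p.2))), by
    obtain ⟨A, M, hM⟩ := A
    obtain ⟨B, N, hN⟩ := B
    refine ⟨M + N, fun n hn => finsum_eq_zero_of_forall_eq_zero fun p => ?_⟩
    by_cases h : M < p.1
    · simp [hM _ h]
    · have h0 : B (n - p.1 + p.2) = 0 := hN _ (by omega)
      have h1 : ∀ l : ℕ, dx^[l] (0 : Fn K) = 0 := fun l => by
        induction l with
        | zero => rfl
        | succ l ih => rw [Function.iterate_succ_apply', ih]; simp [dx]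
      simp [h0, h1]⟩

/-- The part of negative order of a formal operator `∑_{j ∈ ℤ} c_j D^j`, which here may be infinite
in both directions. -/
def negPart (c : ℤ → Fn K) : PDO K :=
  ⟨fun n => if n < 0 then c n else 0, 0, fun n hn => if_neg (by omega)⟩

/-- The purely differential part `A₊`. -/
def posPart (A : PDO K) : PDO K :=
  ⟨fun n => if 0 ≤ n then A.1 n else 0, by
    obtain ⟨A, M, hM⟩ := A
    exact ⟨M, fun n hn => by simp [hM n hn]⟩⟩

/-- The residue: the coefficient of `D⁻¹`. -/
def res (A : PDO K) : Fn K := A.1 (-1)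

/-- The action `A₊(f)` of the differential part of `A` on a function. -/
def act (A : PDO K) (f : Fn K) : Fn K := ∑ᶠ j : ℕ, A.1 j * dx^[j] f

/-- The action `(A*)₊(g) = (A₊)*(g) = ∑_{j ≥ 0} (-∂)^j (a_j g)` of the formal adjoint. -/
def adjAct (A : PDO K) (g : Fn K) : Fn K := ∑ᶠ j : ℕ, (-1 : K) ^ j • dx^[j] (A.1 j * g)

/-! ### The KP hierarchy -/

/-- The dressing operator `W = ∑_{n ≥ 0} (p_n(-[∂]) τ / τ) D^{-n}` of a tau-function. -/
def dressing (τ : Fn K) : PDO K :=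
  ⟨fun n => if n ≤ 0 then schurShift (-n).toNat τ * τ⁻¹ else 0, 0, fun n hn => if_neg (by omega)⟩

/-- The variation of `dressing τ` caused by the variation `δ` of `τ`:
`δW = ∑_n [p_n(-[∂]) δ / τ - (p_n(-[∂]) τ) δ / τ²] D^{-n}`. -/
def dressingVariation (τ δ : Fn K) : PDO K :=
  ⟨fun n => if n ≤ 0 then
      schurShift (-n).toNat δ * τ⁻¹ - schurShift (-n).toNat τ * δ * (τ⁻¹) ^ 2 else 0,
    0, fun n hn => if_neg (by omega)⟩

/-- `L^{n/r} = W Dⁿ W⁻¹`, where `L = W D^r W⁻¹` and `V` is the inverse of `W`. In particular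
`L = laxPow W V r` and `L^k = laxPow W V (r k)`. -/
def laxPow (W V : PDO K) (n : ℕ) : PDO K := W * mono 1 n * V

/-- Eigenfunctions: `∂f/∂t_n = (L^{n/r})₊(f)` for all `n ≥ 1`. -/
def IsEigenfunction (W V : PDO K) (f : Fn K) : Prop :=
  ∀ n : ℕ+, dt n f = act (laxPow W V n) f

/-- Adjoint eigenfunctions: `∂g/∂t_n = -(L*)^{n/r}₊(g)` for all `n ≥ 1`. -/
def IsAdjointEigenfunction (W V : PDO K) (g : Fn K) : Prop :=
  ∀ n : ℕ+, dt n g = -adjAct (laxPow W V n) g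

/-- `s` is a squared eigenfunction potential of `f` and `g`:
`∂s/∂t_n = Res (D⁻¹ g (L^{n/r})₊ f D⁻¹)` for all `n ≥ 1`. -/
def IsSEP (W V : PDO K) (f g s : Fn K) : Prop :=
  ∀ n : ℕ+, dt n s =
    res (mono 1 (-1) * mono g 0 * posPart (laxPow W V n) * mono f 0 * mono 1 (-1))

/-- `τ` is the tau-function of a `cKP_{r,1}` hierarchy with Lax operator
`L = W D^r W⁻¹ = L₊ + Φ D⁻¹ Ψ`, `W = dressing τ`, `V = W⁻¹`. -/
structure IsCKP (r : ℕ+) (τ : Fn K) (V : PDO K) (Φ Ψ : Fn K) : Prop where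
  tau_ne_zero : MvPowerSeries.constantCoeff τ ≠ 0
  mul_inv : dressing τ * V = 1
  inv_mul : V * dressing τ = 1
  /-- The Wilson-Sato equations `∂W/∂t_n = -(L^{n/r})₋ W`. -/
  sato : ∀ (n : ℕ+) (j : ℤ), dt n ((dressing τ).1 j) =
    (-(negPart (laxPow (dressing τ) V n).1 * dressing τ)).1 j
  constrained : negPart (laxPow (dressing τ) V r).1 = mono Φ 0 * mono 1 (-1) * mono Ψ 0
  eigen : IsEigenfunction (dressing τ) V Φ
  adjoint_eigen : IsAdjointEigenfunction (dressing τ) V Ψ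

/-- For a `cKP_{r,1}` Lax operator `L = L₊ + Φ D⁻¹ Ψ`: the functions `f a i = L^i(f_a)` and
`g b j = (L*)^j(g_b)` generated by a family of eigenfunctions `f_a = f a 0` and a family of adjoint
eigenfunctions `g_b = g b 0`, which contain `Φ = f a₀ 0` and `Ψ = g b₀ 0`, together with potentials
`S a i b j = S(L^i(f_a), (L*)^j(g_b))`. Here
`L(h) = L₊(h) + Φ S(h, Ψ)` and `L*(h) = (L*)₊(h) - S(Φ, h) Ψ`. -/
structure IsSEPSystem {ι κ : Type*} (r : ℕ+) (W V : PDO K) (Φ Ψ : Fn K) (a₀ : ι) (b₀ : κ)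
    (f : ι → ℕ → Fn K) (g : κ → ℕ → Fn K) (S : ι → ℕ → κ → ℕ → Fn K) : Prop where
  eigen : ∀ a, IsEigenfunction W V (f a 0)
  adjoint_eigen : ∀ b, IsAdjointEigenfunction W V (g b 0)
  base : f a₀ 0 = Φ
  adjoint_base : g b₀ 0 = Ψ
  step : ∀ a i, f a (i + 1) = act (laxPow W V r) (f a i) + Φ * S a i b₀ 0
  adjoint_step : ∀ b j, g b (j + 1) = adjAct (laxPow W V r) (g b j) - S a₀ 0 b j * Ψ
  isSEP : ∀ a i b j, IsSEP W V (f a i) (g b j) (S a i b j)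
  /-- A potential is determined only up to an additive constant. The constants of the various
  potentials are fitted to each other: at the base point,
  `S(L(h), h') - S(h, L*(h')) = ∂S(h, h')/∂t_r + S(Φ, h') S(h, Ψ)`. -/
  compatible : ∀ a i b j,
    MvPowerSeries.constantCoeff (S a (i + 1) b j - S a i b (j + 1)) =
      MvPowerSeries.constantCoeff (dt r (S a i b j) + S a₀ 0 b j * S a i b₀ 0)

/-! ### The Virasoro flows -/

/-- The coefficients of `M L^k`, where
`M = W (∑_{l ≥ 1} (l/r) t_l D^{l-r}) W⁻¹` is the Orlov-Schulman operator. -/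
def orlovSchulman (a : ℕ+ →₀ K) (r : ℕ+) (W V : PDO K) (k : ℕ) : ℤ → Fn K := fun j =>
  formalSum fun l : ℕ+ => ((l : ℕ) / (r : ℕ) : K) •
    (W * mono (time a l) ((l : ℤ) - (r : ℤ)) * V * laxPow W V (r * k)).1 j

/-- The ghost operator
`X_{k-1} = ∑_{j=0}^{k-2} (j - (k-2)/2) L^{k-2-j}(Φ) D⁻¹ (L*)^j(Ψ)` (zero for `k ≤ 1`),
where `φ i = L^i(Φ)` and `ψ j = (L*)^j(Ψ)`. -/
def ghost (φ ψ : ℕ → Fn K) (k : ℕ) : PDO K :=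
  ∑ j ∈ Finset.range (k - 1),
    ((j : K) - ((k : K) - 2) / 2) • (mono (φ (k - 2 - j)) 0 * mono 1 (-1) * mono (ψ j) 0)

/-- The corrected non-isospectral flow `∂*_k W = -(M L^k)₋ W + X_{k-1} W`. -/
def virasoroFlow (a : ℕ+ →₀ K) (r : ℕ+) (W V : PDO K) (φ ψ : ℕ → Fn K) (k : ℕ) : PDO K :=
  -(negPart (orlovSchulman a r W V k)) * W + ghost φ ψ k * W

/-- The second-order operator
`(1/r) ∑_{l≥1} l t_l ∂_{l+r(k-1)} - ((r(k-1)+1)/(2r)) ∂_{r(k-1)}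
  + (1/(2r)) ∑_{l=1}^{r(k-1)-1} ∂_l ∂_{r(k-1)-l} + (1/2) ∑_{l=1}^{k-2} ∂_{rl} ∂_{r(k-1-l)}`. -/
def virasoroOp (a : ℕ+ →₀ K) (r : ℕ+) (k : ℕ) (τ : Fn K) : Fn K :=
  let s : ℤ := (r : ℤ) * ((k : ℤ) - 1)
  ((r : ℕ) : K)⁻¹ • formalSum (fun l : ℕ+ => ((l : ℕ) : K) • (time a l * dt ((l : ℤ) + s) τ))
    - (((s : K) + 1) / (2 * ((r : ℕ) : K))) • dt s τ
    + (2 * ((r : ℕ) : K))⁻¹ • ∑ l ∈ Finset.Icc 1 (s - 1), dt l (dt (s - l) τ)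
    + (2 : K)⁻¹ • ∑ l ∈ Finset.Icc (1 : ℤ) ((k : ℤ) - 2),
        dt ((r : ℤ) * l) (dt ((r : ℤ) * ((k : ℤ) - 1 - l)) τ)

end KP

end

noncomputable section

namespace KP

variable {K : Type*} [Field K]

/-! ### Derivations of functions -/

/-! All flows are encoded in the shift f(t - [z]), kept as a power series in z. It is the unique
solution of `nabla G = 0` with constant term f (`eq_shift_iff`), where `nabla` is the derivation
z∂_z + Σ z^l ∂_l. Infinitely many evolution equations thus become one identity of series, and a
function equal to its own shift is constant (`eq_C_of_shift_eq`). The symbol of W is w = τ(t -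
[z])/τ. Eigenfunctions are the f with f(t - [z]) = f(1 + zω₁) - z f_x (`isEigenfunction_iff`),
adjoint ones satisfy a dual equation, and potentials satisfy S(t - [z]) = S - z f g(t - [z])
(`shift_sep`).

For (1), these formulas show that L(f) and L*(g) are again (adjoint) eigenfunctions, and that the
two sides of the relation fitting the potentials differ by a shift-invariant function; so the
relation passes from the base point to all times (`compatible'`). It is the case n = 1. Induction on
n, carrying along the negative part of D⁻¹ g L^n, gives the general case (`npart_and_dt`).

For (2), a variation δ of τ changes W by an operator whose symbol times τ is `variation τ δ`, that
is δ(t - [z]) - wδ, and this vanishes exactly for δ = cτ. It remains to write each part of the flow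
as a variation. Put s = r(k-1). All times except x commute with W, so M L^k is 1/r times Σ l t_l
L^{(l+s)/r} + [W, x] D^{1+s} W⁻¹. By the Sato equations the sum gives Σ l t_l ∂_{l+s}, except that
the shift moves t_l by -z^l/l, which leaves the error `nablaTail`. The commutator has symbol -z∂_z w
up to a power of z; `nabla` annihilates τ(t - [z]), which trades z∂_z for time derivatives and
yields the terms in ∂_s and ∂_l ∂_{s-l} together with the opposite error (`sym_npart_timeComm`,
`sym_orlovSchulman`).

For the ghost term, (L^n)₋ = Σ L^{n-1-i}(Φ) D⁻¹ (L*)^i(Ψ) shows that ∂_{rn} log τ and the sum of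
potentials have the same shift increment; the normalization makes them equal (`dt_tau`). Then (1)
reduces the additional second derivatives of τ to a linear combination of functions Sτ
(`sum_dt_dt_tau`), and the variation of Sτ is -z f g(t - [z]) wτ, which is -τ times the symbol of f
D⁻¹ g W (`sym_ghost`). -/

theorem dx_coe : (dx : Fn K → Fn K) = ⇑(MvPowerSeries.pderiv K (1 : ℕ+)) := rfl

theorem dt_pos (n : ℕ+) (f : Fn K) : dt n f = MvPowerSeries.pderiv K n f := by
  have h : 0 < ((n : ℕ) : ℤ) := by exact_mod_cast n.pos
  exact dif_pos h

theorem exists_pnat_of_pos {n : ℤ} (hn : 0 < n) : ∃ m : ℕ+, n = m :=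
  ⟨⟨n.toNat, by omega⟩, by rw [PNat.mk_coe]; omega⟩

theorem dt_one (f : Fn K) : dt 1 f = dx f := by
  simpa [dx] using dt_pos (1 : ℕ+) f

theorem dt_nonpos {n : ℤ} (hn : n ≤ 0) (f : Fn K) : dt n f = 0 := dif_neg (by omega)

@[simp] theorem dt_zero_index (f : Fn K) : dt 0 f = 0 := dt_nonpos le_rfl f

/-- `∂/∂t_n` as a derivation. -/
def dtD (n : ℤ) : Derivation K (Fn K) (Fn K) :=
  if h : 0 < n then MvPowerSeries.pderiv K (⟨n.toNat, by omega⟩ : ℕ+) else 0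

theorem dtD_apply (n : ℤ) (f : Fn K) : dtD n f = dt n f := by
  rcases le_or_gt n 0 with hn | hn
  · rw [dt_nonpos hn, dtD, dif_neg (by omega)]; rfl
  · obtain ⟨m, rfl⟩ := exists_pnat_of_pos hn
    rw [dt_pos, dtD, dif_pos hn]
    rfl

theorem dt_add (n : ℤ) (f g : Fn K) : dt n (f + g) = dt n f + dt n g := by
  simp [← dtD_apply]

@[simp] theorem dt_zero (n : ℤ) : dt n (0 : Fn K) = 0 := by
  simp [← dtD_apply]

theorem dt_neg (n : ℤ) (f : Fn K) : dt n (-f) = -dt n f := by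
  simp [← dtD_apply]

theorem dt_sub (n : ℤ) (f g : Fn K) : dt n (f - g) = dt n f - dt n g := by
  simp [← dtD_apply]

theorem dt_smul (n : ℤ) (c : K) (f : Fn K) : dt n (c • f) = c • dt n f := by
  simp [← dtD_apply]

theorem dt_mul (n : ℤ) (f g : Fn K) : dt n (f * g) = dt n f * g + f * dt n g := by
  simp only [← dtD_apply, Derivation.leibniz, smul_eq_mul]; ring

theorem dt_sum {ι : Type*} (n : ℤ) (s : Finset ι) (f : ι → Fn K) :
    dt n (∑ i ∈ s, f i) = ∑ i ∈ s, dt n (f i) := by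
  simp [← dtD_apply]

@[simp] theorem dt_one_fn (n : ℤ) : dt n (1 : Fn K) = 0 := by
  simp [← dtD_apply]

theorem dt_zsmul (n : ℤ) (c : ℤ) (f : Fn K) : dt n (c • f) = c • dt n f := by
  simp only [← dtD_apply, map_zsmul]

theorem pderiv_comm (i j : ℕ+) (f : Fn K) :
    MvPowerSeries.pderiv K i (MvPowerSeries.pderiv K j f) =
      MvPowerSeries.pderiv K j (MvPowerSeries.pderiv K i f) := by
  by_cases h : i = j
  · rw [h]
  ext m
  simp only [MvPowerSeries.coeff_pderiv, add_right_comm m, Finsupp.add_apply]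
  rw [Finsupp.single_eq_of_ne (Ne.symm h), Finsupp.single_eq_of_ne h]
  simp only [add_zero]
  ring

theorem dt_comm (m n : ℤ) (f : Fn K) : dt m (dt n f) = dt n (dt m f) := by
  rcases le_or_gt m 0 with hm | hm
  · simp [dt_nonpos hm]
  rcases le_or_gt n 0 with hn | hn
  · simp [dt_nonpos hn]
  obtain ⟨m, rfl⟩ := exists_pnat_of_pos hm
  obtain ⟨n, rfl⟩ := exists_pnat_of_pos hn
  simp only [dt_pos, pderiv_comm m n]

theorem dx_add (f g : Fn K) : dx (f + g) = dx f + dx g := map_add _ _ _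

@[simp] theorem dx_zero : dx (0 : Fn K) = 0 := map_zero _

theorem dx_neg (f : Fn K) : dx (-f) = -dx f := map_neg (MvPowerSeries.pderiv K (1 : ℕ+)) f

theorem dx_sub (f g : Fn K) : dx (f - g) = dx f - dx g :=
  map_sub (MvPowerSeries.pderiv K (1 : ℕ+)) f g

theorem dx_mul (f g : Fn K) : dx (f * g) = dx f * g + f * dx g := by
  simp only [← dt_one, dt_mul]

theorem dx_sum {ι : Type*} (s : Finset ι) (f : ι → Fn K) :
    dx (∑ i ∈ s, f i) = ∑ i ∈ s, dx (f i) := map_sum _ _ _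

theorem dt_dx (n : ℤ) (f : Fn K) : dt n (dx f) = dx (dt n f) := by
  simp only [← dt_one, dt_comm n]

/-- A function whose derivatives with respect to all times vanish is constant. -/
theorem eq_C_of_dt_eq_zero [CharZero K] {f : Fn K} (h : ∀ n : ℕ+, dt n f = 0) :
    f = MvPowerSeries.C (MvPowerSeries.constantCoeff f) := by
  refine MvPowerSeries.pderiv.ext (fun i => ?_) (by simp)
  rw [← dt_pos, h]
  simp

/-- The iterates of `∂` as additive maps. -/
def dxIter (l : ℕ) : Fn K →+ Fn K where
  toFun := dx^[l]
  map_zero' := Function.iterate_fixed dx_zero l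
  map_add' f g := by
    induction l with
    | zero => rfl
    | succ l ih => simp only [Function.iterate_succ_apply', ih, dx_add]

theorem dxIter_apply (l : ℕ) (f : Fn K) : dxIter l f = dx^[l] f := rfl

@[simp] theorem dx_iterate_zero (l : ℕ) : dx^[l] (0 : Fn K) = 0 := map_zero (dxIter l)

theorem dx_iterate_add (l : ℕ) (f g : Fn K) : dx^[l] (f + g) = dx^[l] f + dx^[l] g :=
  map_add (dxIter l) f g

theorem dx_iterate_zsmul (l : ℕ) (c : ℤ) (f : Fn K) : dx^[l] (c • f) = c • dx^[l] f :=
  map_zsmul (dxIter l) c f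

theorem dx_iterate_one {l : ℕ} (hl : l ≠ 0) : dx^[l] (1 : Fn K) = 0 := by
  obtain ⟨l, rfl⟩ := Nat.exists_eq_succ_of_ne_zero hl
  rw [Function.iterate_succ_apply, show dx (1 : Fn K) = 0 by rw [← dt_one]; simp, dx_iterate_zero]

theorem dt_dx_iterate (n : ℤ) (l : ℕ) (f : Fn K) : dt n (dx^[l] f) = dx^[l] (dt n f) := by
  induction l with
  | zero => rfl
  | succ l ih => simp only [Function.iterate_succ_apply', dt_dx, ih]

theorem dx_iterate_mul (k : ℕ) (f g : Fn K) :
    dx^[k] (f * g) = ∑ ij ∈ Finset.HasAntidiagonal.antidiagonal k, (k.choose ij.1 : Fn K) *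
      (dx^[ij.1] f * dx^[ij.2] g) := by
  induction k with
  | zero => simp
  | succ k ih =>
    rw [Function.iterate_succ_apply', ih, dx_sum,
      Finset.sum_antidiagonal_choose_succ_mul (fun i j => dx^[i] f * dx^[j] g),
      ← Finset.sum_add_distrib]
    refine Finset.sum_congr rfl fun ij hij => ?_
    have hc : dx ((k.choose ij.1 : ℕ) : Fn K) = 0 := by
      rw [dx_coe]; exact Derivation.map_natCast _ _
    have hk : k.choose ij.2 = k.choose ij.1 := by
      rw [← Finset.HasAntidiagonal.mem_antidiagonal.mp hij, Nat.choose_symm_add]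
    rw [dx_mul, hc, dx_mul, hk, Function.iterate_succ_apply', Function.iterate_succ_apply']
    ring

/-! ### The ring of pseudo-differential operators -/

/-- `A` has order at most `N`. -/
def OrdLE (A : PDO K) (N : ℤ) : Prop := ∀ n, N < n → A.1 n = 0

theorem OrdLE.le {A : PDO K} {M N : ℤ} (h : OrdLE A M) (hMN : M ≤ N) : OrdLE A N :=
  fun n hn => h n (by omega)

theorem exists_ordLE (A : PDO K) : ∃ N, OrdLE A N := A.2

@[ext] theorem PDO.ext {A B : PDO K} (h : ∀ n, A.1 n = B.1 n) : A = B := Subtype.ext (funext h)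

@[simp] theorem coe_add' (A B : PDO K) (n : ℤ) : (A + B).1 n = A.1 n + B.1 n := rfl
@[simp] theorem coe_sub' (A B : PDO K) (n : ℤ) : (A - B).1 n = A.1 n - B.1 n := rfl
@[simp] theorem coe_neg' (A : PDO K) (n : ℤ) : (-A).1 n = -A.1 n := rfl
@[simp] theorem coe_zero' (n : ℤ) : (0 : PDO K).1 n = 0 := rfl
@[simp] theorem coe_smul' (c : K) (A : PDO K) (n : ℤ) : (c • A).1 n = c • A.1 n := rfl
theorem coe_mono (f : Fn K) (j n : ℤ) : (mono f j).1 n = if n = j then f else 0 := rfl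
theorem coe_one' (n : ℤ) : (1 : PDO K).1 n = if n = 0 then 1 else 0 := rfl

@[simp] theorem coe_sum' {ι : Type*} (s : Finset ι) (A : ι → PDO K) (n : ℤ) :
    (∑ i ∈ s, A i).1 n = ∑ i ∈ s, (A i).1 n := by
  classical
  induction s using Finset.induction_on with
  | empty => rfl
  | insert a s ha ih => rw [Finset.sum_insert ha, Finset.sum_insert ha, coe_add', ih]

theorem OrdLE.add {A B : PDO K} {N : ℤ} (hA : OrdLE A N) (hB : OrdLE B N) : OrdLE (A + B) N :=
  fun n hn => by simp [hA n hn, hB n hn]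

theorem OrdLE.neg {A : PDO K} {N : ℤ} (hA : OrdLE A N) : OrdLE (-A) N :=
  fun n hn => by simp [hA n hn]

theorem OrdLE.sub {A B : PDO K} {N : ℤ} (hA : OrdLE A N) (hB : OrdLE B N) : OrdLE (A - B) N :=
  fun n hn => by simp [hA n hn, hB n hn]

theorem OrdLE.sum {ι : Type*} {s : Finset ι} {A : ι → PDO K} {N : ℤ}
    (h : ∀ i ∈ s, OrdLE (A i) N) : OrdLE (∑ i ∈ s, A i) N :=
  fun n hn => by rw [coe_sum']; exact Finset.sum_eq_zero fun i hi => h i hi n hn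

theorem ordLE_mono (f : Fn K) (j : ℤ) : OrdLE (mono f j) j := fun n hn => if_neg (by omega)

theorem mul_coe (A B : PDO K) (n : ℤ) : (A * B).1 n = ∑ᶠ p : ℤ × ℕ,
    (Ring.choose p.1 p.2 : ℤ) • (A.1 p.1 * dx^[p.2] (B.1 (n - p.1 + p.2))) := rfl

theorem OrdLE.mul {A B : PDO K} {M N : ℤ} (hA : OrdLE A M) (hB : OrdLE B N) :
    OrdLE (A * B) (M + N) := fun n hn => by
  rw [mul_coe]
  refine finsum_eq_zero_of_forall_eq_zero fun p => ?_
  by_cases h : M < p.1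
  · simp [hA _ h]
  · simp [hB (n - p.1 + p.2) (by omega)]

/-- The window depends only on the order bounds, so one finite set serves a whole family of factors;
`formalSum_mul_coe` relies on this. -/
theorem mul_support {A B : PDO K} {M N : ℤ} (hA : OrdLE A M) (hB : OrdLE B N) (n : ℤ) :
    (Function.support fun p : ℤ × ℕ =>
      (Ring.choose p.1 p.2 : ℤ) • (A.1 p.1 * dx^[p.2] (B.1 (n - p.1 + p.2)))) ⊆
      ↑(Finset.Icc (n - N) M ×ˢ Finset.range (M + N - n + 1).toNat) := by
  intro p hp
  have h1 : ¬ M < p.1 := fun h => hp (by simp [hA _ h])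
  have h2 : ¬ N < n - p.1 + p.2 := fun h => hp (by simp [hB _ h])
  simp only [Finset.coe_product, Set.mem_prod, Finset.coe_Icc, Set.mem_Icc, Finset.coe_range,
    Set.mem_Iio]
  omega

theorem mul_finite (A B : PDO K) (n : ℤ) :
    Function.HasFiniteSupport fun p : ℤ × ℕ =>
      (Ring.choose p.1 p.2 : ℤ) • (A.1 p.1 * dx^[p.2] (B.1 (n - p.1 + p.2))) := by
  obtain ⟨M, hA⟩ := exists_ordLE A
  obtain ⟨N, hB⟩ := exists_ordLE B
  exact (Finset.finite_toSet _).subset (mul_support hA hB n)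

theorem pdo_add_mul (A B C : PDO K) : (A + B) * C = A * C + B * C := by
  ext n
  rw [coe_add', mul_coe, mul_coe, mul_coe, ← finsum_add_distrib (mul_finite A C n)
    (mul_finite B C n)]
  simp only [coe_add', add_mul, smul_add]

theorem pdo_mul_add (A B C : PDO K) : A * (B + C) = A * B + A * C := by
  ext n
  rw [coe_add', mul_coe, mul_coe, mul_coe, ← finsum_add_distrib (mul_finite A B n)
    (mul_finite A C n)]
  simp only [coe_add', dx_iterate_add, mul_add, smul_add]

/-- Both associativity computations end in inner sums over i + j = m; this flattens them to sums
over free i and j. -/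
theorem finsum_antidiagonal {α M : Type*} [AddCommMonoid M] (g : α × ℕ × ℕ → M)
    (hg : Function.HasFiniteSupport g) :
    ∑ᶠ x : α × ℕ, ∑ ij ∈ Finset.HasAntidiagonal.antidiagonal x.2, g (x.1, ij) = ∑ᶠ y, g y := by
  classical
  set s : Finset (α × ℕ × ℕ) := Set.Finite.toFinset hg with hs
  have hmem : ∀ y, g y ≠ 0 → y ∈ s := fun y hy => (Set.Finite.mem_toFinset hg).mpr hy
  let φ : α × ℕ × ℕ → α × ℕ := fun y => (y.1, y.2.1 + y.2.2)
  rw [finsum_eq_sum_of_support_subset g (s := s) (fun y hy => hmem y hy),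
    finsum_eq_sum_of_support_subset _ (s := s.image φ),
    ← Finset.sum_fiberwise_of_maps_to (fun y hy => Finset.mem_image_of_mem φ hy)]
  · refine Finset.sum_congr rfl fun x _ => ?_
    symm
    refine Finset.sum_of_injOn (fun y => y.2) ?_ ?_ ?_ ?_
    · rintro ⟨a, i⟩ h1 ⟨b, j⟩ h2 h
      simp only [Finset.coe_filter, Set.mem_ofPred_eq, φ] at h1 h2 h
      have := h1.2.trans h2.2.symm
      simp only [Prod.mk.injEq] at this
      rw [this.1, h]
    · rintro ⟨a, i⟩ h1
      simp only [Finset.coe_filter, Set.mem_ofPred_eq, φ] at h1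
      simp [← h1.2]
    · intro ij hij h
      by_contra h0
      refine h ⟨(x.1, ij), ?_, rfl⟩
      simp only [Finset.coe_filter, Set.mem_ofPred_eq, φ]
      exact ⟨hmem _ h0, by rw [Finset.HasAntidiagonal.mem_antidiagonal.mp hij]⟩
    · rintro ⟨a, i⟩ h1
      simp only [Finset.mem_filter, φ] at h1
      simp [← h1.2]
  · intro x hx
    obtain ⟨ij, hij, h0⟩ := Finset.exists_ne_zero_of_sum_ne_zero hx
    exact Finset.mem_coe.mpr (Finset.mem_image.mpr ⟨_, hmem _ h0,
      by simp [φ, Finset.HasAntidiagonal.mem_antidiagonal.mp hij]⟩)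

section

open Finset.HasAntidiagonal

theorem zsmul_finsum_fn {ι : Type*} (c : ℤ) (f : ι → Fn K) :
    c • ∑ᶠ i, f i = ∑ᶠ i, c • f i := by
  simp only [zsmul_eq_mul, mul_finsum]

/-! ### Associativity of the product -/

section Assoc

variable (A B C : PDO K) (n : ℤ)

/-- The terms of the `n`-th coefficient of a triple product `A * B * C`. -/
def tripleTerm (y : (ℤ × ℤ) × ℕ × ℕ × ℕ) : Fn K :=
  (Ring.choose y.1.1 y.2.1 * (Ring.choose (y.1.1 - y.2.1) y.2.2.1 * Ring.choose y.1.2 y.2.2.2) : ℤ) •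
    (A.1 y.1.1 * (dx^[y.2.1] (B.1 y.1.2) *
      dx^[y.2.2.1 + y.2.2.2] (C.1 (n - y.1.1 - y.1.2 + y.2.1 + y.2.2.1 + y.2.2.2))))

theorem index_finite (M N P n : ℤ) : Set.Finite {y : (ℤ × ℤ) × ℕ × ℕ × ℕ |
    y.1.1 ≤ M ∧ y.1.2 ≤ N ∧ n - y.1.1 - y.1.2 + y.2.1 + y.2.2.1 + y.2.2.2 ≤ P} := by
  let R := (M + N + P - n).toNat
  refine Set.Finite.subset (((Set.finite_Icc (n - N - P) M).prod (Set.finite_Icc (n - M - P) N)).prod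
    ((Set.finite_Iic R).prod ((Set.finite_Iic R).prod (Set.finite_Iic R)))) fun y hy => ?_
  simp only [Set.mem_ofPred_eq, Set.mem_prod, Set.mem_Icc, Set.mem_Iic, R] at hy ⊢
  omega

theorem tripleTerm_finite : Function.HasFiniteSupport (tripleTerm A B C n) := by
  obtain ⟨M, hA⟩ := exists_ordLE A
  obtain ⟨N, hB⟩ := exists_ordLE B
  obtain ⟨P, hC⟩ := exists_ordLE C
  refine (index_finite M N P n).subset fun y hy => ⟨?_, ?_, ?_⟩ <;> by_contra h <;>
    refine hy ?_
  · simp [tripleTerm, hA _ (not_le.mp h)]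
  · simp [tripleTerm, hB _ (not_le.mp h)]
  · simp [tripleTerm, hC _ (not_le.mp h)]

/-- The order of summation in `(A * B) * C`. -/
def assocLeftEquiv : ((ℤ × ℤ) × ℕ) × ℕ ≃ (ℤ × ℕ) × (ℤ × ℕ) where
  toFun x := ((x.1.1.1 + x.1.1.2 - x.1.2, x.2), (x.1.1.1, x.1.2))
  invFun x := (((x.2.1, x.1.1 - x.2.1 + x.2.2), x.2.2), x.1.2)
  left_inv := by rintro ⟨⟨⟨p, q⟩, i⟩, m⟩; simp only [Prod.mk.injEq, and_true, true_and]; ring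
  right_inv := by rintro ⟨⟨s, m⟩, p, l⟩; simp only [Prod.mk.injEq, and_true]; ring

/-- The order of summation in `A * (B * C)`. -/
def assocRightEquiv : ((ℤ × ℤ) × ℕ) × ℕ ≃ (ℤ × ℕ) × (ℤ × ℕ) where
  toFun x := ((x.1.1.1, x.2), (x.1.1.2, x.1.2))
  invFun x := (((x.1.1, x.2.1), x.2.2), x.1.2)
  left_inv _ := rfl
  right_inv _ := rfl

/-- Here binom(p - l + q, m) appears; Chu–Vandermonde splits it into the products binom(p - l, i)
binom(q, j) with i + j = m. -/
theorem mul_mul_coe_left : ((A * B) * C).1 n = ∑ᶠ y, tripleTerm A B C n y := by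
  obtain ⟨M, hA⟩ := exists_ordLE A
  obtain ⟨N, hB⟩ := exists_ordLE B
  obtain ⟨P, hC⟩ := exists_ordLE C
  let F : (ℤ × ℕ) × (ℤ × ℕ) → Fn K := fun x =>
    (Ring.choose x.1.1 x.1.2 : ℤ) • (((Ring.choose x.2.1 x.2.2 : ℤ) •
      (A.1 x.2.1 * dx^[x.2.2] (B.1 (x.1.1 - x.2.1 + x.2.2)))) * dx^[x.1.2] (C.1 (n - x.1.1 + x.1.2)))
  have hF : Function.HasFiniteSupport F := by
    refine (((index_finite M N P n).image fun y => assocLeftEquiv ((y.1, y.2.1), y.2.2.1 + y.2.2.2))).subset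
      fun x hx => ?_
    refine ⟨((x.2.1, x.1.1 - x.2.1 + x.2.2), x.2.2, x.1.2, 0), ⟨?_, ?_, ?_⟩, ?_⟩
    · by_contra h
      exact hx (by simp [F, hA _ (not_le.mp h)])
    · by_contra h
      exact hx (by simp [F, hB _ (not_le.mp h)])
    · by_contra h
      refine hx ?_
      have := hC (n - x.1.1 + x.1.2) (by simp only [Nat.cast_zero] at h; omega)
      simp [F, this]
    · simp only [assocLeftEquiv, Equiv.coe_fn_mk, add_zero]
      exact Prod.ext (Prod.ext (by dsimp only; ring) rfl) rfl
  have h1 : ((A * B) * C).1 n = ∑ᶠ x, F x := by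
    rw [finsum_curry F hF, mul_coe]
    refine finsum_congr fun x => ?_
    rw [mul_coe, finsum_mul, zsmul_finsum_fn]
  rw [h1, ← finsum_comp_equiv assocLeftEquiv]
  let g : ((ℤ × ℤ) × ℕ) × ℕ × ℕ → Fn K := fun y => tripleTerm A B C n (y.1.1, y.1.2, y.2)
  let e : ((ℤ × ℤ) × ℕ) × ℕ × ℕ ≃ (ℤ × ℤ) × ℕ × ℕ × ℕ := Equiv.prodAssoc _ _ _
  have hg : Function.HasFiniteSupport g :=
    (tripleTerm_finite A B C n).preimage (e.injective.injOn)
  rw [← finsum_comp_equiv e, show (fun i => tripleTerm A B C n (e i)) = g from rfl,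
    ← finsum_antidiagonal g hg]
  refine finsum_congr fun x => ?_
  obtain ⟨⟨⟨p, q⟩, l⟩, m⟩ := x
  simp only [F, g, assocLeftEquiv, Equiv.coe_fn_mk, tripleTerm]
  rw [show p + q - (l : ℤ) = (p - l) + q by ring, Ring.add_choose_eq _ (Commute.all _ _),
    Finset.sum_smul]
  refine Finset.sum_congr rfl fun ij hij => ?_
  have hm : (m : ℤ) = ij.1 + ij.2 := by exact_mod_cast (mem_antidiagonal.mp hij).symm
  rw [show p - (l : ℤ) + q - p + l = q by ring, mem_antidiagonal.mp hij,
    show n - (p - (l : ℤ) + q) + m = n - p - q + l + ij.1 + ij.2 by rw [hm]; ring]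
  simp only [zsmul_eq_mul]
  push_cast
  ring

/-- Here m derivatives fall on a product. The Leibniz rule distributes them, and binom(p, m)
binom(m, i) = binom(p, i) binom(p - i, m - i) brings the terms to the common form. -/
theorem mul_mul_coe_right : (A * (B * C)).1 n = ∑ᶠ y, tripleTerm A B C n y := by
  obtain ⟨M, hA⟩ := exists_ordLE A
  obtain ⟨N, hB⟩ := exists_ordLE B
  obtain ⟨P, hC⟩ := exists_ordLE C
  let F : (ℤ × ℕ) × (ℤ × ℕ) → Fn K := fun x =>
    (Ring.choose x.1.1 x.1.2 : ℤ) • (A.1 x.1.1 * dx^[x.1.2] ((Ring.choose x.2.1 x.2.2 : ℤ) •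
      (B.1 x.2.1 * dx^[x.2.2] (C.1 (n - x.1.1 + x.1.2 - x.2.1 + x.2.2)))))
  have hF : Function.HasFiniteSupport F := by
    refine (((index_finite M N P n).image fun y => assocRightEquiv ((y.1, y.2.1), y.2.2.1))).subset
      fun x hx => ?_
    refine ⟨((x.1.1, x.2.1), x.2.2, x.1.2, 0), ⟨?_, ?_, ?_⟩, ?_⟩
    · by_contra h
      exact hx (by simp [F, hA _ (not_le.mp h)])
    · by_contra h
      exact hx (by simp [F, hB _ (not_le.mp h)])
    · by_contra h
      refine hx ?_
      have := hC (n - x.1.1 + x.1.2 - x.2.1 + x.2.2) (by simp only [Nat.cast_zero] at h; omega)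
      simp [F, this]
    · simp [assocRightEquiv]
  have h1 : (A * (B * C)).1 n = ∑ᶠ x, F x := by
    rw [finsum_curry F hF, mul_coe]
    refine finsum_congr fun x => ?_
    rw [mul_coe, ← dxIter_apply, AddMonoidHom.map_finsum _ (mul_finite B C _), mul_finsum,
      zsmul_finsum_fn]
    rfl
  rw [h1, ← finsum_comp_equiv assocRightEquiv]
  let e : ((ℤ × ℤ) × ℕ) × ℕ × ℕ ≃ (ℤ × ℤ) × ℕ × ℕ × ℕ :=
    ⟨fun y => (y.1.1, y.2.1, y.2.2, y.1.2), fun y => ((y.1, y.2.2.2), y.2.1, y.2.2.1),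
      fun _ => rfl, fun _ => rfl⟩
  let g : ((ℤ × ℤ) × ℕ) × ℕ × ℕ → Fn K := fun y => tripleTerm A B C n (e y)
  have hg : Function.HasFiniteSupport g :=
    (tripleTerm_finite A B C n).preimage (e.injective.injOn)
  rw [← finsum_comp_equiv e, show (fun i => tripleTerm A B C n (e i)) = g from rfl,
    ← finsum_antidiagonal g hg]
  refine finsum_congr fun x => ?_
  obtain ⟨⟨⟨p, q⟩, l⟩, m⟩ := x
  simp only [F, g, e, assocRightEquiv, Equiv.coe_fn_mk, tripleTerm]
  rw [dx_iterate_zsmul, dx_iterate_mul, Finset.smul_sum, Finset.mul_sum, Finset.smul_sum]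
  refine Finset.sum_congr rfl fun ij hij => ?_
  have hij' := mem_antidiagonal.mp hij
  have hm : (m : ℤ) = ij.1 + ij.2 := by exact_mod_cast hij'.symm
  rw [← Function.iterate_add_apply,
    show n - p + (m : ℤ) - q + l = n - p - q + ij.1 + ij.2 + l by rw [hm]; ring]
  have hc := Ring.choose_smul_choose p (n := m) (k := ij.1) (by omega)
  rw [show m - ij.1 = ij.2 by omega, nsmul_eq_mul] at hc
  have hc' : ((Ring.choose p m : ℤ) : Fn K) * (m.choose ij.1 : Fn K) =
      ((Ring.choose p ij.1 : ℤ) : Fn K) * ((Ring.choose (p - ij.1) ij.2 : ℤ) : Fn K) := by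
    rw [mul_comm]; exact_mod_cast congrArg (Int.cast : ℤ → Fn K) hc
  simp only [zsmul_eq_mul]
  push_cast
  linear_combination ((Ring.choose q l : ℤ) : Fn K) * A.1 p * dx^[ij.1] (B.1 q) *
    dx^[ij.2 + l] (C.1 (n - p - q + ij.1 + ij.2 + l)) * hc'

theorem pdo_mul_assoc : (A * B) * C = A * (B * C) :=
  PDO.ext fun n => (mul_mul_coe_left A B C n).trans (mul_mul_coe_right A B C n).symm

end Assoc

theorem mono_zero_mul_coe (f : Fn K) (A : PDO K) (n : ℤ) : (mono f 0 * A).1 n = f * A.1 n := by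
  rw [mul_coe, finsum_eq_single _ (0, 0)]
  · simp [coe_mono]
  · rintro ⟨p, l⟩ h
    by_cases hp : p = 0
    · subst hp
      obtain ⟨l, rfl⟩ := Nat.exists_eq_succ_of_ne_zero (n := l) (by rintro rfl; exact h rfl)
      simp [Ring.choose_zero_succ]
    · simp [coe_mono, hp]

theorem mul_mono_one_coe (A : PDO K) (j n : ℤ) : (A * mono 1 j).1 n = A.1 (n - j) := by
  rw [mul_coe, finsum_eq_single _ (n - j, 0)]
  · simp [coe_mono]
  · rintro ⟨p, l⟩ h
    rw [coe_mono]
    split_ifs with hp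
    · have hl : l ≠ 0 := by
        rintro rfl
        exact h (by simp only [Prod.mk.injEq, and_true]; simp at hp; omega)
      simp [dx_iterate_one hl]
    · simp

theorem pdo_one_mul (A : PDO K) : 1 * A = A := by
  ext n
  rw [show (1 : PDO K) = mono 1 0 from rfl, mono_zero_mul_coe, one_mul]

theorem pdo_mul_one (A : PDO K) : A * 1 = A := by
  ext n
  rw [show (1 : PDO K) = mono 1 0 from rfl, mul_mono_one_coe, sub_zero]

instance : Ring (PDO K) :=
  { (inferInstance : AddCommGroup (PDO K)) with
    mul := (· * ·)
    one := 1
    left_distrib := pdo_mul_add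
    right_distrib := pdo_add_mul
    zero_mul := fun A => by simpa using pdo_add_mul 0 0 A
    mul_zero := fun A => by simpa using pdo_mul_add A 0 0
    mul_assoc := pdo_mul_assoc
    one_mul := pdo_one_mul
    mul_one := pdo_mul_one }

theorem mono_one_zero : (mono 1 0 : PDO K) = 1 := rfl

end

/-! ### Calculus of pseudo-differential operators -/

theorem smul_eq_mono_mul (c : K) (A : PDO K) : c • A = mono (MvPowerSeries.C c) 0 * A := by
  ext1 n
  rw [mono_zero_mul_coe, coe_smul', MvPowerSeries.smul_eq_C_mul]

theorem pdo_smul_mul (c : K) (A B : PDO K) : (c • A) * B = c • (A * B) := by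
  simp only [smul_eq_mono_mul, mul_assoc]

theorem mono_mul_mono_one (f : Fn K) (i j : ℤ) : mono f i * mono 1 j = mono f (i + j) := by
  ext1 n
  rw [mul_mono_one_coe, coe_mono, coe_mono]
  exact if_congr (by omega) rfl rfl

theorem mono_zero_mul_mono (f g : Fn K) (j : ℤ) : mono f 0 * mono g j = mono (f * g) j := by
  ext1 n
  rw [mono_zero_mul_coe, coe_mono, coe_mono, mul_ite, mul_zero]

theorem mono_eq (f : Fn K) (j : ℤ) : mono f j = mono f 0 * mono 1 j := by
  rw [mono_mul_mono_one, zero_add]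

theorem mono_add (f g : Fn K) (j : ℤ) : mono (f + g) j = mono f j + mono g j := by
  ext1 n
  simp only [coe_add', coe_mono]
  split_ifs <;> simp

theorem mono_sub (f g : Fn K) (j : ℤ) : mono (f - g) j = mono f j - mono g j := by
  ext1 n
  simp only [coe_sub', coe_mono]
  split_ifs <;> simp

@[simp] theorem mono_zero (j : ℤ) : mono (0 : Fn K) j = 0 := by
  ext1 n
  simp only [coe_mono, ite_self, coe_zero']

theorem mono_sum {ι : Type*} (s : Finset ι) (f : ι → Fn K) (j : ℤ) :
    mono (∑ i ∈ s, f i) j = ∑ i ∈ s, mono (f i) j := by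
  ext1 n
  simp only [coe_sum', coe_mono]
  split_ifs <;> simp

theorem mono_one_mul_neg (j : ℤ) : (mono 1 j * mono 1 (-j) : PDO K) = 1 := by
  rw [mono_mul_mono_one, add_neg_cancel, mono_one_zero]

/-- The operator `D`. -/
abbrev Dop : PDO K := mono 1 1

/-- The operator `D⁻¹`. -/
abbrev Dinv : PDO K := mono 1 (-1)

theorem Dop_mul_Dinv : (Dop * Dinv : PDO K) = 1 := mono_one_mul_neg 1

theorem Dinv_mul_Dop : (Dinv * Dop : PDO K) = 1 := by
  rw [mono_mul_mono_one, neg_add_cancel, mono_one_zero]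

theorem mul_Dinv_mul_Dop (A : PDO K) : A * Dinv * Dop = A := by
  rw [mul_assoc, Dinv_mul_Dop, mul_one]

theorem Dop_mul_coe (A : PDO K) (n : ℤ) : (Dop * A).1 n = dx (A.1 n) + A.1 (n - 1) := by
  rw [mul_coe, finsum_eq_sum_of_support_subset (s := {(1, 0), (1, 1)})]
  · rw [Finset.sum_pair (by simp)]
    simp [coe_mono, add_comm]
  · rintro ⟨p, l⟩ h
    have hp : p = 1 := by
      by_contra hp
      exact h (by simp [coe_mono, hp])
    subst hp
    have hl : l ≤ 1 := by
      by_contra hl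
      refine h ?_
      have : Ring.choose (1 : ℤ) l = 0 := by
        have := Ring.choose_natCast (R := ℤ) 1 l
        rw [Nat.choose_eq_zero_of_lt (by omega)] at this
        simpa using this
      simp [this]
    simp only [Finset.coe_insert, Finset.coe_singleton, Set.mem_insert_iff, Set.mem_singleton_iff,
      Prod.mk.injEq, true_and]
    omega

theorem Dop_mul_mono_zero (f : Fn K) : Dop * mono f 0 = mono f 0 * Dop + mono (dx f) 0 := by
  ext1 n
  rw [Dop_mul_coe, coe_add', mul_mono_one_coe]
  simp only [coe_mono]
  split_ifs <;> simp_all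

/-- Integration by parts for operators: sandwich [D, f] = f_x between two copies of D⁻¹. -/
theorem Dinv_mul_mono_dx_mul_Dinv (f : Fn K) :
    Dinv * mono (dx f) 0 * Dinv = mono f 0 * Dinv - Dinv * mono f 0 := by
  have h : mono (dx f) 0 = Dop * mono f 0 - mono f 0 * Dop := by
    rw [Dop_mul_mono_zero]; abel
  rw [h, mul_sub, sub_mul, ← mul_assoc, ← mul_assoc, Dinv_mul_Dop, one_mul,
    mul_assoc (Dinv * mono f 0), Dop_mul_Dinv, mul_one]

/-- Differentiation of the coefficients of an operator. -/
def dtP (n : ℤ) (A : PDO K) : PDO K :=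
  ⟨fun j => dt n (A.1 j), by
    obtain ⟨N, hN⟩ := exists_ordLE A
    exact ⟨N, fun j hj => by simp [hN j hj]⟩⟩

@[simp] theorem dtP_coe (n : ℤ) (A : PDO K) (j : ℤ) : (dtP n A).1 j = dt n (A.1 j) := rfl

theorem OrdLE.dtP {A : PDO K} {N : ℤ} (h : OrdLE A N) (n : ℤ) : OrdLE (dtP n A) N :=
  fun j hj => by simp [h j hj]

theorem dtP_neg (n : ℤ) (A : PDO K) : dtP n (-A) = -dtP n A :=
  PDO.ext fun j => by simp [dt_neg]

theorem dtP_mono (n : ℤ) (f : Fn K) (j : ℤ) : dtP n (mono f j) = mono (dt n f) j := by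
  ext1 i
  simp only [dtP_coe, coe_mono]
  split_ifs <;> simp

@[simp] theorem dtP_mono_one (n : ℤ) (j : ℤ) : dtP n (mono (1 : Fn K) j) = 0 := by
  simp [dtP_mono]

@[simp] theorem dtP_one (n : ℤ) : dtP n (1 : PDO K) = 0 := dtP_mono_one n 0

@[simp] theorem dtP_zero_index (A : PDO K) : dtP 0 A = 0 := PDO.ext fun j => by simp

theorem dtP_mul (n : ℤ) (A B : PDO K) : dtP n (A * B) = dtP n A * B + A * dtP n B := by
  ext1 j
  rw [dtP_coe, coe_add', mul_coe, mul_coe, mul_coe,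
    ← finsum_add_distrib (mul_finite (dtP n A) B j) (mul_finite A (dtP n B) j)]
  refine (AddMonoidHom.map_finsum (AddMonoidHom.mk' (dt n) (dt_add n)) (mul_finite A B j)).trans
    (finsum_congr fun p => ?_)
  rw [AddMonoidHom.mk'_apply, dt_zsmul, dt_mul, dt_dx_iterate, smul_add]
  rfl

/-! ### Differential and negative parts -/

/-- The operators without negative powers of `D`. -/
def IsDiff (A : PDO K) : Prop := ∀ n < 0, A.1 n = 0

/-- The part of negative order. -/
abbrev npart (A : PDO K) : PDO K := negPart A.1

theorem posPart_coe (A : PDO K) (n : ℤ) : (posPart A).1 n = if 0 ≤ n then A.1 n else 0 := rfl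

theorem negPart_coe (c : ℤ → Fn K) (n : ℤ) : (negPart c).1 n = if n < 0 then c n else 0 := rfl

theorem posPart_add_npart (A : PDO K) : posPart A + npart A = A := by
  ext1 n
  rw [coe_add', posPart_coe, negPart_coe]
  split_ifs <;> first | omega | simp

theorem isDiff_posPart (A : PDO K) : IsDiff (posPart A) := fun n hn => if_neg (by omega)

theorem ordLE_negPart (c : ℤ → Fn K) : OrdLE (negPart c) (-1) := fun n hn => if_neg (by omega)

theorem posPart_add (A B : PDO K) : posPart (A + B) = posPart A + posPart B := by
  ext1 n
  simp only [coe_add', posPart_coe]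
  split_ifs <;> simp

theorem posPart_sum {ι : Type*} (s : Finset ι) (A : ι → PDO K) :
    posPart (∑ i ∈ s, A i) = ∑ i ∈ s, posPart (A i) := by
  ext1 n
  simp only [coe_sum', posPart_coe]
  split_ifs <;> simp

theorem posPart_mono_mul (f : Fn K) (A : PDO K) :
    posPart (mono f 0 * A) = mono f 0 * posPart A := by
  ext1 n
  simp only [mono_zero_mul_coe, posPart_coe, mul_ite, mul_zero]

theorem posPart_of_isDiff {A : PDO K} (h : IsDiff A) : posPart A = A := by
  ext1 n
  rw [posPart_coe]
  split_ifs with hn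
  · rfl
  · rw [h n (by omega)]

theorem posPart_of_ordLE {A : PDO K} (h : OrdLE A (-1)) : posPart A = 0 := by
  ext1 n
  rw [posPart_coe]
  split_ifs with hn
  · exact h n (by omega)
  · rfl

theorem npart_add (A B : PDO K) : npart (A + B) = npart A + npart B := by
  ext1 n
  simp only [coe_add', negPart_coe]
  split_ifs <;> simp

theorem npart_sub (A B : PDO K) : npart (A - B) = npart A - npart B := by
  ext1 n
  simp only [coe_sub', negPart_coe]
  split_ifs <;> simp

theorem npart_sum {ι : Type*} (s : Finset ι) (A : ι → PDO K) :
    npart (∑ i ∈ s, A i) = ∑ i ∈ s, npart (A i) := by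
  ext1 n
  simp only [coe_sum', negPart_coe]
  split_ifs <;> simp

theorem npart_mono_mul (f : Fn K) (A : PDO K) : npart (mono f 0 * A) = mono f 0 * npart A := by
  ext1 n
  simp only [mono_zero_mul_coe, negPart_coe, mul_ite, mul_zero]

theorem npart_of_isDiff {A : PDO K} (h : IsDiff A) : npart A = 0 := by
  ext1 n
  rw [negPart_coe]
  split_ifs with hn
  · exact h n hn
  · rfl

theorem npart_of_ordLE {A : PDO K} (h : OrdLE A (-1)) : npart A = A := by
  ext1 n
  rw [negPart_coe]
  split_ifs with hn
  · rfl
  · rw [h n (by omega)]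

theorem dtP_npart (n : ℤ) (A : PDO K) : dtP n (npart A) = npart (dtP n A) := by
  ext1 j
  simp only [dtP_coe, negPart_coe]
  split_ifs <;> simp

theorem IsDiff.sub {A B : PDO K} (hA : IsDiff A) (hB : IsDiff B) : IsDiff (A - B) :=
  fun n hn => by simp [hA n hn, hB n hn]

theorem isDiff_mono (f : Fn K) {j : ℤ} (hj : 0 ≤ j) : IsDiff (mono f j) :=
  fun n hn => if_neg (by omega)

theorem IsDiff.mul {A B : PDO K} (hA : IsDiff A) (hB : IsDiff B) : IsDiff (A * B) := fun n hn => by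
  rw [mul_coe]
  refine finsum_eq_zero_of_forall_eq_zero fun ⟨p, l⟩ => ?_
  by_cases hp : p < 0
  · simp [hA p hp]
  by_cases hl : n - p + l < 0
  · simp [hB _ hl]
  obtain ⟨m, rfl⟩ := Int.eq_ofNat_of_zero_le (not_lt.mp hp)
  have : Ring.choose (m : ℤ) l = 0 := by
    rw [Ring.choose_natCast, Nat.choose_eq_zero_of_lt (by omega), Nat.cast_zero]
  simp [this]

/-! ### The actions on functions as coefficients of operator products; division by D -/

theorem finsum_eq_finsum_comp {α β M : Type*} [AddCommMonoid M] {e : α → β}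
    (he : Function.Injective e) (f : β → M) (hf : ∀ b, f b ≠ 0 → b ∈ Set.range e) :
    ∑ᶠ b, f b = ∑ᶠ a, f (e a) := by
  rw [← finsum_mem_range he, ← finsum_mem_univ]
  exact finsum_mem_inter_support_eq' _ _ _ fun x hx => by simpa using hf x hx

theorem act_eq (A : PDO K) (f : Fn K) : act A f = (A * mono f 0).1 0 := by
  rw [mul_coe, act, finsum_eq_finsum_comp (e := fun j : ℕ => ((j : ℤ), j))
    fun i j h => (Prod.mk.inj h).2]
  · refine finsum_congr fun j => ?_
    simp [coe_mono, Ring.choose_natCast]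
  · rintro ⟨p, l⟩ h
    refine ⟨l, ?_⟩
    by_contra hp
    refine h ?_
    rw [coe_mono, if_neg (by rintro h; exact hp (by rw [show p = l by omega]))]
    simp

theorem choose_neg_one (l : ℕ) : Ring.choose (-1 : ℤ) l = (-1) ^ l := by
  rw [Ring.choose_neg, show (1 : ℤ) + l - 1 = (l : ℤ) by ring, Ring.choose_natCast]
  simp [Int.negOnePow_def, Units.smul_def]

theorem adjAct_eq (A : PDO K) (g : Fn K) : adjAct A g = res (Dinv * (mono g 0 * A)) := by
  rw [res, mul_coe, adjAct, finsum_eq_finsum_comp (e := fun j : ℕ => ((-1 : ℤ), j))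
    fun i j h => (Prod.mk.inj h).2]
  · refine finsum_congr fun j => ?_
    simp only [coe_mono, if_true, choose_neg_one, mono_zero_mul_coe, one_mul, sub_self, zero_add,
      mul_comm g]
    rcases neg_one_pow_eq_or K j with h | h <;>
      rcases Nat.even_or_odd j with h' | h' <;> simp [h'.neg_one_pow]
  · rintro ⟨p, l⟩ h
    refine ⟨l, ?_⟩
    by_contra hp
    refine h ?_
    rw [coe_mono, if_neg (by rintro rfl; exact hp rfl)]
    simp

theorem OrdLE.mul' {A B : PDO K} {M N R : ℤ} (hA : OrdLE A M) (hB : OrdLE B N) (h : M + N ≤ R) :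
    OrdLE (A * B) R := (hA.mul hB).le h

theorem OrdLE.mono_mul {A : PDO K} {N : ℤ} (hA : OrdLE A N) (f : Fn K) : OrdLE (mono f 0 * A) N :=
  (ordLE_mono f 0).mul' hA (by omega)

theorem OrdLE.mul_mono {A : PDO K} {N : ℤ} (hA : OrdLE A N) (f : Fn K) : OrdLE (A * mono f 0) N :=
  hA.mul' (ordLE_mono f 0) (by omega)

theorem act_add_left (A B : PDO K) (f : Fn K) : act (A + B) f = act A f + act B f := by
  simp only [act_eq, add_mul, coe_add']

theorem act_sub_left (A B : PDO K) (f : Fn K) : act (A - B) f = act A f - act B f := by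
  simp only [act_eq, sub_mul, coe_sub']

theorem act_sum_left {ι : Type*} (s : Finset ι) (A : ι → PDO K) (f : Fn K) :
    act (∑ i ∈ s, A i) f = ∑ i ∈ s, act (A i) f := by
  simp only [act_eq, Finset.sum_mul, coe_sum']

theorem act_add_right (A : PDO K) (f g : Fn K) : act A (f + g) = act A f + act A g := by
  simp only [act_eq, mono_add, mul_add, coe_add']

theorem act_mono_mul (f : Fn K) (A : PDO K) (h : Fn K) : act (mono f 0 * A) h = f * act A h := by
  rw [act_eq, mul_assoc, mono_zero_mul_coe, act_eq]

theorem act_mono (f h : Fn K) : act (mono f 0) h = f * h := by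
  rw [act_eq, mono_zero_mul_mono, coe_mono, if_pos rfl]

theorem act_one (h : Fn K) : act 1 h = h := by
  rw [← mono_one_zero, act_mono, one_mul]

theorem act_Dop (h : Fn K) : act Dop h = dx h := by
  rw [act_eq, Dop_mul_coe]
  simp [coe_mono]

theorem act_of_ordLE {A : PDO K} (hA : OrdLE A (-1)) (f : Fn K) : act A f = 0 := by
  rw [act_eq]
  exact hA.mul_mono f 0 (by omega)

theorem act_posPart (A : PDO K) (f : Fn K) : act (posPart A) f = act A f := by
  conv_rhs => rw [← posPart_add_npart A]
  rw [act_add_left, act_of_ordLE (ordLE_negPart _), add_zero]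

theorem adjAct_posPart (A : PDO K) (g : Fn K) : adjAct (posPart A) g = adjAct A g := by
  refine finsum_congr fun j => ?_
  rw [posPart_coe, if_pos (by omega)]

/-- Right division by D: the remainder of a differential operator is its zeroth coefficient. -/
theorem isDiff_eq_mono_add {A : PDO K} (hA : IsDiff A) :
    IsDiff (A * Dinv - mono (A.1 0) 0 * Dinv) := fun n hn => by
  rw [coe_sub', mul_mono_one_coe, mul_mono_one_coe, coe_mono]
  split_ifs with h
  · rw [h, sub_self]
  · rw [hA _ (by omega), sub_zero]

/-- Write B f = Q D + B(f) with Q differential. Then A Q D has no D⁰ coefficient, so only A · B(f)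
contributes. -/
theorem act_mul {A B : PDO K} (hA : IsDiff A) (hB : IsDiff B) (f : Fn K) :
    act (A * B) f = act A (act B f) := by
  set T := B * mono f 0 with hT
  have hTd : IsDiff T := hB.mul (isDiff_mono f le_rfl)
  set Q := T * Dinv - mono (T.1 0) 0 * Dinv with hQ
  have hQd : IsDiff Q := isDiff_eq_mono_add hTd
  have h : T = Q * Dop + mono (act B f) 0 := by
    rw [hQ, sub_mul, mul_Dinv_mul_Dop, mul_Dinv_mul_Dop, act_eq]; abel
  rw [act_eq, mul_assoc, ← hT, h, mul_add, coe_add', ← act_eq, ← mul_assoc, mul_mono_one_coe,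
    hA.mul hQd _ (by omega), zero_add]

/-- `P Φ D⁻¹ = Q + P(Φ) D⁻¹` with a differential operator `Q`. -/
theorem exists_right_division {P : PDO K} (hP : IsDiff P) (φ : Fn K) :
    ∃ Q : PDO K, IsDiff Q ∧ P * mono φ 0 * Dinv = Q + mono (act P φ) 0 * Dinv ∧
      ∀ s, act Q (dx s) = act P (φ * s) - act P φ * s := by
  have hT : IsDiff (P * mono φ 0) := hP.mul (isDiff_mono φ le_rfl)
  refine ⟨_, isDiff_eq_mono_add hT, ?_, fun s => ?_⟩
  · rw [act_eq]; abel
  · rw [← act_Dop, ← act_mul (isDiff_eq_mono_add hT) (isDiff_mono 1 (by omega)), sub_mul,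
      mul_Dinv_mul_Dop, mul_Dinv_mul_Dop, act_sub_left, act_mono,
      act_mul hP (isDiff_mono φ le_rfl), act_mono, ← act_eq]

theorem ordLE_integral (φ ψ : Fn K) : OrdLE (mono φ 0 * Dinv * mono ψ 0) (-1) :=
  ((ordLE_mono _ _).mono_mul φ).mul_mono ψ

/-- `(P Φ D⁻¹ Ψ)₋ = P(Φ) D⁻¹ Ψ`. -/
theorem npart_mul_integral {P : PDO K} (hP : IsDiff P) (φ ψ : Fn K) :
    npart (P * (mono φ 0 * Dinv * mono ψ 0)) = mono (act P φ) 0 * Dinv * mono ψ 0 := by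
  obtain ⟨Q, hQ, h, -⟩ := exists_right_division hP φ
  rw [← mul_assoc, ← mul_assoc, h, add_mul, npart_add,
    npart_of_isDiff (hQ.mul (isDiff_mono ψ le_rfl)), zero_add,
    npart_of_ordLE (ordLE_integral _ _)]

/-- `(P Φ D⁻¹ Ψ)₊(f) = P(Φ s) - P(Φ) s` if `∂s = Ψ f`. -/
theorem act_mul_integral {P : PDO K} (hP : IsDiff P) (φ ψ : Fn K) {f s : Fn K}
    (hs : dx s = ψ * f) :
    act (P * (mono φ 0 * Dinv * mono ψ 0)) f = act P (φ * s) - act P φ * s := by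
  obtain ⟨Q, hQ, h, hQs⟩ := exists_right_division hP φ
  rw [← mul_assoc, ← mul_assoc, h, add_mul, act_add_left,
    act_of_ordLE (ordLE_integral _ _), add_zero, act_mul hQ (isDiff_mono ψ le_rfl), act_mono,
    ← hs, hQs]

/-- Let X be the negative part. D X is differential, since X differs from D⁻¹ A by a differential
operator, and it has order at most 0; so it is a function. -/
theorem res_Dinv_mul_npart {A : PDO K} (hA : IsDiff A) :
    npart (Dinv * A) = Dinv * mono (res (Dinv * A)) 0 := by
  set X := npart (Dinv * A) with hX
  have h1 : IsDiff (Dop * X) := by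
    have : Dop * X = A - Dop * posPart (Dinv * A) := by
      have h2 : X = Dinv * A - posPart (Dinv * A) := by
        rw [eq_sub_iff_add_eq, add_comm]; exact posPart_add_npart _
      rw [h2, mul_sub, ← mul_assoc, Dop_mul_Dinv, one_mul]
    rw [this]
    exact hA.sub ((isDiff_mono 1 (by omega)).mul (isDiff_posPart _))
  have h2 : Dop * X = mono (res (Dinv * A)) 0 := by
    ext1 n
    rcases lt_trichotomy n 0 with hn | rfl | hn
    · rw [h1 n hn, coe_mono, if_neg (by omega)]
    · rw [Dop_mul_coe, ordLE_negPart _ 0 (by omega), coe_mono, if_pos rfl, dx_zero, zero_add, hX,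
        negPart_coe, if_pos (by omega)]
      rfl
    · rw [coe_mono, if_neg (by omega)]
      exact ((ordLE_mono 1 1).mul' (ordLE_negPart _) (by omega) : OrdLE (Dop * X) 0) n hn
  rw [← h2, ← mul_assoc, Dinv_mul_Dop, one_mul]

/-- `(D⁻¹ g P)₋ = D⁻¹ P*(g)`. -/
theorem npart_Dinv_mul {P : PDO K} (hP : IsDiff P) (g : Fn K) :
    npart (Dinv * mono g 0 * P) = Dinv * mono (adjAct P g) 0 := by
  rw [adjAct_eq, mul_assoc]
  exact res_Dinv_mul_npart ((isDiff_mono g le_rfl).mul hP)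

theorem res_mul_Dinv (A : PDO K) (f : Fn K) : res (A * mono f 0 * Dinv) = act A f := by
  rw [res, mul_mono_one_coe, act_eq, sub_self]

section

/-! ### The shift `f ↦ f(t - [z])` -/

/-- Power series in an auxiliary variable `z = λ⁻¹` whose coefficients are functions. -/
abbrev Ser (K : Type*) [Field K] := PowerSeries (Fn K)

open PowerSeries in
theorem ser_ext {G H : Ser K} (h : ∀ n, coeff n G = coeff n H) : G = H := PowerSeries.ext h

open PowerSeries (coeff mk coeff_mk coeff_mul X)
open Finset.HasAntidiagonal

/-- Coefficientwise differentiation. -/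
def dtS (n : ℤ) (G : Ser K) : Ser K := mk fun k => dt n (coeff k G)

@[simp] theorem coeff_dtS (n : ℤ) (G : Ser K) (k : ℕ) : coeff k (dtS n G) = dt n (coeff k G) :=
  coeff_mk _ _

theorem dtS_add (n : ℤ) (G H : Ser K) : dtS n (G + H) = dtS n G + dtS n H :=
  ser_ext fun k => by simp [dt_add]

theorem dtS_sub (n : ℤ) (G H : Ser K) : dtS n (G - H) = dtS n G - dtS n H :=
  ser_ext fun k => by simp [dt_sub]

theorem dtS_mul (n : ℤ) (G H : Ser K) : dtS n (G * H) = dtS n G * H + G * dtS n H := by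
  refine ser_ext fun k => ?_
  simp only [coeff_dtS, map_add, coeff_mul, dt_sum, dt_mul, Finset.sum_add_distrib]

theorem dtS_C (n : ℤ) (f : Fn K) : dtS n (PowerSeries.C f) = PowerSeries.C (dt n f) :=
  ser_ext fun k => by
    rw [coeff_dtS, PowerSeries.coeff_C, PowerSeries.coeff_C]
    split_ifs <;> simp

theorem dtS_X_pow (n : ℤ) (m : ℕ) : dtS n ((X : Ser K) ^ m) = 0 :=
  ser_ext fun k => by
    rw [coeff_dtS, PowerSeries.coeff_X_pow]
    split_ifs <;> simp

theorem dtS_X (n : ℤ) : dtS n (X : Ser K) = 0 := by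
  simpa using dtS_X_pow (K := K) n 1

@[simp] theorem dtS_one (n : ℤ) : dtS n (1 : Ser K) = 0 := by
  simpa using dtS_X_pow (K := K) n 0

@[simp] theorem dtS_zero_index (G : Ser K) : dtS 0 G = 0 := ser_ext fun k => by simp

/-- The derivation `z ∂_z + ∑_{l ≥ 1} z^l ∂_l`. -/
def nabla (G : Ser K) : Ser K := mk fun n =>
  (n : Fn K) * coeff n G + ∑ l ∈ Finset.range n, dt ((l : ℤ) + 1) (coeff (n - 1 - l) G)

theorem coeff_nabla (G : Ser K) (n : ℕ) : coeff n (nabla G) =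
    (n : Fn K) * coeff n G + ∑ l ∈ Finset.range n, dt ((l : ℤ) + 1) (coeff (n - 1 - l) G) :=
  coeff_mk _ _

theorem nabla_add (G H : Ser K) : nabla (G + H) = nabla G + nabla H :=
  ser_ext fun k => by
    simp only [coeff_nabla, map_add, dt_add, Finset.sum_add_distrib]; ring

theorem nabla_sub (G H : Ser K) : nabla (G - H) = nabla G - nabla H :=
  ser_ext fun k => by
    simp only [coeff_nabla, map_sub, dt_sub, Finset.sum_sub_distrib]; ring

/-- The operator `z ∂_z`. -/
def euler (G : Ser K) : Ser K := mk fun n => (n : Fn K) * coeff n G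

theorem coeff_euler (G : Ser K) (n : ℕ) : coeff n (euler G) = (n : Fn K) * coeff n G :=
  coeff_mk _ _

theorem euler_mul (G H : Ser K) : euler (G * H) = euler G * H + G * euler H := by
  refine ser_ext fun n => ?_
  simp only [coeff_euler, map_add, coeff_mul, Finset.mul_sum, ← Finset.sum_add_distrib]
  refine Finset.sum_congr rfl fun ij hij => ?_
  rw [← mem_antidiagonal.mp hij]
  push_cast
  ring

/-- A truncation of `nabla`. -/
def nablaTrunc (N : ℕ) (G : Ser K) : Ser K :=
  euler G + ∑ l ∈ Finset.range N, X ^ (l + 1) * dtS ((l : ℤ) + 1) G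

theorem nablaTrunc_mul (N : ℕ) (G H : Ser K) :
    nablaTrunc N (G * H) = nablaTrunc N G * H + G * nablaTrunc N H := by
  simp only [nablaTrunc, euler_mul, dtS_mul, mul_add, add_mul, Finset.sum_add_distrib,
    Finset.sum_mul, Finset.mul_sum, mul_assoc, mul_left_comm G]
  abel

theorem coeff_nablaTrunc {N n : ℕ} (h : n ≤ N) (G : Ser K) :
    coeff n (nablaTrunc N G) = coeff n (nabla G) := by
  rw [nablaTrunc, map_add, coeff_euler, coeff_nabla, map_sum, ← Finset.sum_range_add_sum_Ico _ h,
    Finset.sum_eq_zero (s := Finset.Ico n N), add_zero]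
  · congr 1
    refine Finset.sum_congr rfl fun l hl => ?_
    rw [Finset.mem_range] at hl
    rw [PowerSeries.coeff_X_pow_mul', if_pos (by omega), coeff_dtS,
      show n - (l + 1) = n - 1 - l by omega]
  · intro l hl
    rw [Finset.mem_Ico] at hl
    rw [PowerSeries.coeff_X_pow_mul', if_neg (by omega)]

/-- The Leibniz rule is clear for the truncations, which are finite sums, and these have the same
coefficients up to any given order. -/
theorem nabla_mul (G H : Ser K) : nabla (G * H) = nabla G * H + G * nabla H := by
  refine ser_ext fun n => ?_
  rw [← coeff_nablaTrunc le_rfl, nablaTrunc_mul, map_add, map_add]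
  simp only [coeff_mul]
  congr 1 <;> refine Finset.sum_congr rfl fun ij hij => ?_ <;>
    rw [coeff_nablaTrunc (by have := mem_antidiagonal.mp hij; omega)]

theorem nabla_dtS (n : ℤ) (G : Ser K) : nabla (dtS n G) = dtS n (nabla G) := by
  refine ser_ext fun k => ?_
  have h : ∀ (k : ℕ) (f : Fn K), (k : Fn K) * f = (k : ℤ) • f := fun k f => by simp
  simp only [coeff_dtS, coeff_nabla, h, dt_add, dt_zsmul, dt_sum, dt_comm n]

theorem nabla_X : nabla (X : Ser K) = X := by
  refine ser_ext fun k => ?_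
  rw [coeff_nabla, Finset.sum_eq_zero, add_zero, PowerSeries.coeff_X]
  · split_ifs with h <;> simp [h]
  · intro l _
    rw [PowerSeries.coeff_X]
    split_ifs <;> simp

theorem nabla_one : nabla (1 : Ser K) = 0 := by
  have := nabla_mul (1 : Ser K) 1
  simpa using this

theorem nabla_X_pow (m : ℕ) : nabla ((X : Ser K) ^ m) = (m : Ser K) * X ^ m := by
  induction m with
  | zero => simp [nabla_one]
  | succ m ih => rw [pow_succ, nabla_mul, ih, nabla_X]; push_cast; ring

/-- The series `f + ∑_{n ≥ 1} z^n ∂_n f`. -/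
def flow (f : Fn K) : Ser K := mk fun n => if n = 0 then f else dt n f

theorem coeff_flow_zero (f : Fn K) : coeff 0 (flow f) = f := by simp [flow]

theorem coeff_flow_succ (f : Fn K) (n : ℕ) : coeff (n + 1) (flow f) = dt (n + 1) f := by
  simp [flow]

theorem nabla_C (f : Fn K) : nabla (PowerSeries.C f) = flow f - PowerSeries.C f := by
  refine ser_ext fun k => ?_
  rw [coeff_nabla, map_sub]
  rcases k with _ | k
  · simp [coeff_flow_zero]
  · rw [coeff_flow_succ, PowerSeries.coeff_C, if_neg (by omega), Finset.sum_eq_single k]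
    · simp
    · intro l hl hlk
      rw [Finset.mem_range] at hl
      rw [PowerSeries.coeff_C, if_neg (by omega), dt_zero]
    · simp

/-- `f(t - [z])`, a power series in `z`. -/
def shift (f : Fn K) : Ser K := mk fun n => schurShift n f

theorem coeff_shift (n : ℕ) (f : Fn K) : coeff n (shift f) = schurShift n f := coeff_mk _ _

theorem coeff_zero_shift (f : Fn K) : coeff 0 (shift f) = f := by
  rw [coeff_shift, schurShift]

@[simp] theorem constantCoeff_shift (f : Fn K) : PowerSeries.constantCoeff (shift f) = f := by
  rw [← PowerSeries.coeff_zero_eq_constantCoeff_apply, coeff_zero_shift]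

theorem dt_C (n : ℤ) (c : K) : dt n (MvPowerSeries.C c : Fn K) = 0 := by
  rw [← mul_one (MvPowerSeries.C c), ← MvPowerSeries.smul_eq_C_mul, dt_smul, dt_one_fn, smul_zero]

theorem dt_time (a : ℕ+ →₀ K) (n l : ℕ+) :
    dt n (time a l) = if n = l then 1 else 0 := by
  rw [time, dt_add, dt_C, zero_add, dt_pos]
  split_ifs with h
  · rw [h, MvPowerSeries.pderiv_X_self]
  · exact MvPowerSeries.pderiv_X_of_ne (Ne.symm h)

theorem nabla_C_C (c : K) : nabla (PowerSeries.C (MvPowerSeries.C c : Fn K)) = 0 := by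
  rw [nabla_C]
  refine ser_ext fun n => ?_
  rw [map_sub, map_zero]
  rcases n with _ | n
  · simp [coeff_flow_zero]
  · rw [coeff_flow_succ, PowerSeries.coeff_C, if_neg (by omega), sub_zero, dt_C]

theorem sum_range_eq_sum_fin (n : ℕ) (F : ℕ → Fn K) :
    ∑ l ∈ Finset.range n, dt ((l : ℤ) + 1) (F (n - 1 - l)) =
      ∑ l : Fin n, dt ((l : ℤ) + 1) (F (n - 1 - l)) :=
  Finset.sum_range fun l => dt ((l : ℤ) + 1) (F (n - 1 - l))

section CharZero

variable [CharZero K]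

/-- The Schur recursion is the vanishing of the n-th coefficient, after division by n. -/
theorem nabla_shift (f : Fn K) : nabla (shift f) = 0 := by
  refine ser_ext fun n => ?_
  rw [coeff_nabla, map_zero]
  rcases n with _ | n
  · simp
  · rw [sum_range_eq_sum_fin (n + 1) fun k => coeff k (shift f)]
    simp only [coeff_shift]
    rw [schurShift, Nat.add_sub_cancel, mul_neg, MvPowerSeries.smul_eq_C_mul, ← mul_assoc]
    have : ((n + 1 : ℕ) : Fn K) * MvPowerSeries.C ((n + 1 : K)⁻¹) = 1 := by
      rw [← map_natCast (MvPowerSeries.C (σ := ℕ+) (R := K)), ← map_mul]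
      push_cast
      rw [mul_inv_cancel₀ (Nat.cast_add_one_ne_zero n), map_one]
    rw [this, one_mul]
    ring

/-- The n-th coefficient of `nabla G` is n G_n plus derivatives of lower coefficients, so in
characteristic 0 the constant term determines G. -/
theorem eq_zero_of_nabla {G : Ser K} (h : nabla G = 0) (h0 : coeff 0 G = 0) : G = 0 := by
  refine ser_ext fun n => ?_
  rw [map_zero]
  induction n using Nat.strong_induction_on with
  | _ n ih =>
    rcases n with _ | n
    · exact h0
    · have := congrArg (coeff (n + 1)) h
      rw [coeff_nabla, map_zero, Finset.sum_eq_zero, add_zero] at this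
      · have hn : ((n + 1 : ℕ) : Fn K) ≠ 0 := by
          rw [← map_natCast (MvPowerSeries.C (σ := ℕ+) (R := K)), Ne,
            map_eq_zero_iff _ MvPowerSeries.C_injective]
          exact Nat.cast_ne_zero.mpr n.succ_ne_zero
        exact (mul_eq_zero.mp this).resolve_left hn
      · intro l hl
        rw [Finset.mem_range] at hl
        rw [ih _ (by omega), dt_zero]

theorem eq_of_nabla {G H : Ser K} (h : nabla G = nabla H) (h0 : coeff 0 G = coeff 0 H) : G = H :=
  sub_eq_zero.mp (eq_zero_of_nabla (K := K) (by rw [nabla_sub, h, sub_self]) (by rw [map_sub, h0, sub_self]))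

/-- `f(t - [z])` is the solution of `nabla G = 0` with constant term `f`. -/
theorem eq_shift_iff {G : Ser K} {f : Fn K} (h0 : coeff 0 G = f) : G = shift f ↔ nabla G = 0 :=
  ⟨fun h => h.symm ▸ nabla_shift f, fun h =>
    eq_of_nabla (h.trans (nabla_shift f).symm) (h0.trans (coeff_zero_shift f).symm)⟩

theorem shift_add (f g : Fn K) : shift (f + g) = shift f + shift g :=
  ((eq_shift_iff (by simp)).mpr (by simp [nabla_add, nabla_shift])).symm

/-- The kernel of a derivation is closed under products, and constant terms multiply; uniqueness
does the rest. -/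
theorem shift_mul (f g : Fn K) : shift (f * g) = shift f * shift g :=
  ((eq_shift_iff (by simp)).mpr (by simp [nabla_mul, nabla_shift])).symm

theorem shift_dt (n : ℤ) (f : Fn K) : shift (dt n f) = dtS n (shift f) :=
  ((eq_shift_iff (by simp)).mpr
    (by rw [nabla_dtS, nabla_shift]; exact ser_ext fun k => by simp)).symm

theorem shift_C (c : K) :
    shift (MvPowerSeries.C c : Fn K) = PowerSeries.C (MvPowerSeries.C c) := by
  exact ((eq_shift_iff (by simp)).mpr (nabla_C_C c)).symm

theorem shift_one : shift (1 : Fn K) = 1 := by simpa using shift_C (1 : K)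

theorem shift_zero : shift (0 : Fn K) = 0 := by simpa using shift_C (0 : K)

/-- The shift as a ring homomorphism. -/
def shiftHom : Fn K →+* Ser K where
  toFun := shift
  map_one' := shift_one
  map_mul' := shift_mul
  map_zero' := shift_zero
  map_add' := shift_add

theorem shift_neg (f : Fn K) : shift (-f) = -shift f := map_neg shiftHom f

theorem shift_sub (f g : Fn K) : shift (f - g) = shift f - shift g := map_sub shiftHom f g

theorem shift_sum {ι : Type*} (s : Finset ι) (f : ι → Fn K) :
    shift (∑ i ∈ s, f i) = ∑ i ∈ s, shift (f i) := map_sum shiftHom f s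

theorem shift_smul (c : K) (f : Fn K) :
    shift (c • f) = PowerSeries.C (MvPowerSeries.C c) * shift f := by
  rw [MvPowerSeries.smul_eq_C_mul, shift_mul, shift_C]

/-- On a series constant in z, `nabla` returns Σ z^n ∂_n f, so invariance under the shift kills all
time derivatives at once. -/
theorem eq_C_of_shift_eq {f : Fn K} (h : shift f = PowerSeries.C f) :
    f = MvPowerSeries.C (MvPowerSeries.constantCoeff f) := by
  refine eq_C_of_dt_eq_zero fun n => ?_
  have h1 := (eq_shift_iff (by simp)).mp h.symm
  rw [nabla_C] at h1
  have h2 := congrArg (coeff (n : ℕ)) h1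
  obtain ⟨m, hm⟩ := Nat.exists_eq_succ_of_ne_zero n.ne_zero
  rw [hm] at h2
  rw [map_sub, Nat.succ_eq_add_one, coeff_flow_succ, PowerSeries.coeff_C, if_neg (by omega),
    sub_zero, map_zero] at h2
  rw [hm]
  exact_mod_cast h2

/-- `nabla` maps both t_l and z^l / l to z^l, so their difference lies in the kernel. -/
theorem shift_time (a : ℕ+ →₀ K) (l : ℕ+) : shift (time a l) =
    PowerSeries.C (time a l) -
      PowerSeries.C (MvPowerSeries.C (((l : ℕ) : K)⁻¹)) * X ^ (l : ℕ) := by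
  refine ((eq_shift_iff ?_).mpr ?_).symm
  · simp [l.ne_zero]
  · have h1 : flow (time a l) - PowerSeries.C (time a l) = X ^ (l : ℕ) := by
      refine ser_ext fun n => ?_
      rw [map_sub, PowerSeries.coeff_X_pow]
      rcases n with _ | n
      · rw [coeff_flow_zero, if_neg l.ne_zero.symm]
        simp
      · rw [coeff_flow_succ, PowerSeries.coeff_C, if_neg (by omega), sub_zero]
        obtain ⟨m, hm⟩ : ∃ m : ℕ+, (m : ℕ) = n + 1 := ⟨n.succPNat, rfl⟩
        have h := dt_time a m l
        rw [hm, Nat.cast_succ] at h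
        simp only [h, ← PNat.coe_inj, hm]
    have h2 : PowerSeries.C (MvPowerSeries.C (((l : ℕ) : K)⁻¹) : Fn K) * ((l : ℕ) : Ser K) = 1 := by
      rw [← map_natCast (PowerSeries.C (R := Fn K)), ← map_mul,
        ← map_natCast (MvPowerSeries.C (σ := ℕ+) (R := K)), ← map_mul,
        inv_mul_cancel₀ (Nat.cast_ne_zero.mpr l.ne_zero), map_one, map_one]
    rw [nabla_sub, nabla_C, h1, nabla_mul, nabla_C_C, zero_mul, zero_add, nabla_X_pow,
      ← mul_assoc, h2, one_mul, sub_self]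

end CharZero

/-- A series which satisfies a linear recursion without inhomogeneity vanishes. -/
theorem eq_zero_of_recursion {b ω : Ser K} (ε : ℤ) (h : b = X * (ε • dtS 1 b - b * ω)) : b = 0 := by
  refine ser_ext fun n => ?_
  rw [map_zero]
  induction n using Nat.strong_induction_on with
  | _ n ih =>
    rw [h]
    rcases n with _ | n
    · simp
    · rw [PowerSeries.coeff_succ_X_mul, map_sub, map_zsmul, coeff_dtS, ih n (by omega), dt_zero,
        smul_zero, zero_sub, neg_eq_zero, coeff_mul]
      refine Finset.sum_eq_zero fun ij hij => ?_
      have := mem_antidiagonal.mp hij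
      rw [ih ij.1 (by omega), zero_mul]

end

section

open PowerSeries (coeff mk coeff_mk coeff_mul X)
open Finset.HasAntidiagonal

/-! ### Symbols -/

/-- `λ^{-N}` times the symbol of an operator of order at most `N`, as a series in `z = λ⁻¹`. -/
def sym (N : ℤ) (A : PDO K) : Ser K := mk fun n => A.1 (N - n)

@[simp] theorem coeff_sym (N : ℤ) (A : PDO K) (n : ℕ) : coeff n (sym N A) = A.1 (N - n) :=
  coeff_mk _ _

theorem sym_add (N : ℤ) (A B : PDO K) : sym N (A + B) = sym N A + sym N B :=
  ser_ext fun n => by simp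

theorem sym_sub (N : ℤ) (A B : PDO K) : sym N (A - B) = sym N A - sym N B :=
  ser_ext fun n => by simp

theorem sym_neg (N : ℤ) (A : PDO K) : sym N (-A) = -sym N A := ser_ext fun n => by simp

theorem sym_sum {ι : Type*} (N : ℤ) (s : Finset ι) (A : ι → PDO K) :
    sym N (∑ i ∈ s, A i) = ∑ i ∈ s, sym N (A i) := ser_ext fun n => by simp

theorem sym_mono_mul (N : ℤ) (f : Fn K) (A : PDO K) :
    sym N (mono f 0 * A) = PowerSeries.C f * sym N A :=
  ser_ext fun n => by rw [coeff_sym, mono_zero_mul_coe, PowerSeries.coeff_C_mul, coeff_sym]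

theorem sym_mul_mono_one (N j : ℤ) (A : PDO K) : sym N (A * mono 1 j) = sym (N - j) A :=
  ser_ext fun n => by
    rw [coeff_sym, mul_mono_one_coe, coeff_sym]
    exact congrArg A.1 (by ring)

theorem sym_dtP (N n : ℤ) (A : PDO K) : sym N (dtP n A) = dtS n (sym N A) :=
  ser_ext fun k => by simp

theorem sym_add_nat {A : PDO K} {N : ℤ} (hA : OrdLE A N) (k : ℕ) :
    sym (N + k) A = X ^ k * sym N A := ser_ext fun n => by
  rw [coeff_sym, PowerSeries.coeff_X_pow_mul']
  split_ifs with h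
  · rw [coeff_sym, Nat.cast_sub h]
    exact congrArg A.1 (by ring)
  · exact hA _ (by omega)

theorem sym_Dop_mul {A : PDO K} {N : ℤ} (hA : OrdLE A N) :
    sym (N + 1) (Dop * A) = sym N A + X * dtS 1 (sym N A) := ser_ext fun n => by
  rw [coeff_sym, Dop_mul_coe, map_add, coeff_sym, add_comm]
  congr 1
  · exact congrArg A.1 (by ring)
  · rcases n with _ | n
    · rw [hA _ (by simp)]
      simp
    · rw [PowerSeries.coeff_succ_X_mul, coeff_dtS, coeff_sym, dt_one]
      exact congrArg (fun i => dx (A.1 i)) (by push_cast; ring)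

theorem sym_injective {A B : PDO K} {N : ℤ} (hA : OrdLE A N) (hB : OrdLE B N)
    (h : sym N A = sym N B) : A = B := by
  ext1 n
  rcases le_or_gt n N with hn | hn
  · have := congrArg (coeff (N - n).toNat) h
    rwa [coeff_sym, coeff_sym, show N - ((N - n).toNat : ℤ) = n by omega] at this
  · rw [hA n hn, hB n hn]

theorem ordLE_of_dvd {A : PDO K} {N : ℤ} {k : ℕ} (hA : OrdLE A N) (h : X ^ k ∣ sym N A) :
    OrdLE A (N - k) := fun n hn => by
  rcases le_or_gt n N with hn' | hn'
  · have := PowerSeries.X_pow_dvd_iff.mp h (N - n).toNat (by omega)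
    rwa [coeff_sym, show N - ((N - n).toNat : ℤ) = n by omega] at this
  · exact hA n hn'

theorem mul_leading {A B : PDO K} {M N : ℤ} (hA : OrdLE A M) (hB : OrdLE B N) :
    (A * B).1 (M + N) = A.1 M * B.1 N := by
  rw [mul_coe, finsum_eq_single _ (M, 0)]
  · simp
  · rintro ⟨p, l⟩ h
    by_cases h1 : M < p
    · simp [hA p h1]
    by_cases h2 : N < M + N - p + l
    · simp [hB _ h2]
    · exact (h (Prod.ext (by omega) (by dsimp only; omega))).elim

/-! ### The dressing operator -/

/-- A tau-function of the KP hierarchy; `V` is the inverse of the dressing operator. -/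
structure IsKP (τ : Fn K) (V : PDO K) : Prop where
  tau_ne_zero : MvPowerSeries.constantCoeff τ ≠ 0
  mul_inv : dressing τ * V = 1
  inv_mul : V * dressing τ = 1
  sato : ∀ (n : ℕ+) (j : ℤ), dt n ((dressing τ).1 j) =
    (-(negPart (laxPow (dressing τ) V n).1 * dressing τ)).1 j

theorem ordLE_dressing (τ : Fn K) : OrdLE (dressing τ) 0 := fun n hn => if_neg (by omega)

/-- The symbol of the dressing operator. -/
def wave (τ : Fn K) : Ser K := sym 0 (dressing τ)

theorem coeff_wave (τ : Fn K) (n : ℕ) : coeff n (wave τ) = schurShift n τ * τ⁻¹ := by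
  rw [wave, coeff_sym, dressing]
  simp

/-- `L^{n/r}`, where `n` is an integer. -/
def lax (τ : Fn K) (V : PDO K) (n : ℤ) : PDO K := dressing τ * mono 1 n * V

theorem laxPow_eq (τ : Fn K) (V : PDO K) (n : ℕ) : laxPow (dressing τ) V n = lax τ V n := rfl

/-- `∂_n log τ`. -/
def theta (τ : Fn K) (n : ℤ) : Fn K := dt n τ * τ⁻¹

/-- `∂_n log` of the symbol of the dressing operator. -/
def omega (τ : Fn K) (n : ℤ) : Ser K := shift (theta τ n) - PowerSeries.C (theta τ n)

@[simp] theorem theta_zero_index (τ : Fn K) : theta τ 0 = 0 := by simp [theta]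

theorem coeff_zero_omega (τ : Fn K) (n : ℤ) : coeff 0 (omega τ n) = 0 := by simp [omega]

theorem nabla_omega [CharZero K] (τ : Fn K) (n : ℤ) :
    nabla (omega τ n) = PowerSeries.C (theta τ n) - flow (theta τ n) := by
  rw [omega, nabla_sub, nabla_shift, nabla_C]
  ring

namespace IsKP

variable {τ : Fn K} {V : PDO K} (h : IsKP τ V)
include h

theorem tau_mul_inv : τ * τ⁻¹ = 1 := MvPowerSeries.mul_inv_cancel τ h.tau_ne_zero

theorem tau_ne_zero' : τ ≠ 0 := by
  rintro rfl
  exact h.tau_ne_zero (map_zero _)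

theorem dressing_coe_zero : (dressing τ).1 0 = 1 := by
  have := coeff_wave τ 0
  rw [wave, coeff_sym] at this
  simpa [schurShift, h.tau_mul_inv] using this

theorem coeff_zero_wave : coeff 0 (wave τ) = 1 := by
  rw [coeff_wave, schurShift, h.tau_mul_inv]

theorem wave_ne_zero : wave τ ≠ 0 := by
  intro h0
  have := h.coeff_zero_wave
  rw [h0, map_zero] at this
  exact zero_ne_one this

/-- W is monic of order 0, so a leading coefficient of V in positive order would reappear in W V =
1. -/
theorem ordLE_inv : OrdLE V 0 := by
  obtain ⟨N, hN⟩ := exists_ordLE V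
  have key : ∀ n : ℕ, OrdLE V n → OrdLE V 0 := by
    intro n
    induction n with
    | zero => exact fun h => h
    | succ n ih =>
      refine fun hn => ih fun m hm => ?_
      rcases eq_or_lt_of_le (show (n : ℤ) + 1 ≤ m by omega) with hm' | hm'
      · have h1 := mul_leading (ordLE_dressing τ) hn
        rw [h.mul_inv, coe_one', if_neg (by push_cast; omega), h.dressing_coe_zero, one_mul] at h1
        rw [← hm']
        exact_mod_cast h1.symm
      · exact hn m (by push_cast; omega)
  exact key N.toNat (hN.le (by omega))

theorem ordLE_lax (n : ℤ) : OrdLE (lax τ V n) n :=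
  ((ordLE_dressing τ).mul' (ordLE_mono 1 n) (zero_add n).le).mul' h.ordLE_inv (add_zero n).le

theorem lax_mul (m n : ℤ) : lax τ V m * lax τ V n = lax τ V (m + n) := by
  rw [lax, lax, lax, ← mono_mul_mono_one, mul_assoc, ← mul_assoc V, ← mul_assoc V, h.inv_mul,
    one_mul]
  simp only [mul_assoc]

theorem lax_zero : lax τ V 0 = 1 := by
  rw [lax, mono_one_zero, mul_one, h.mul_inv]

theorem lax_mul_dressing (n : ℤ) : lax τ V n * dressing τ = dressing τ * mono 1 n := by
  rw [lax, mul_assoc, h.inv_mul, mul_one]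

theorem npart_lax_zero : npart (lax τ V 0) = 0 := by
  rw [h.lax_zero]
  exact npart_of_isDiff (isDiff_mono 1 le_rfl)

theorem dtP_dressing (n : ℕ) : dtP n (dressing τ) = -(npart (lax τ V n) * dressing τ) := by
  rcases Nat.eq_zero_or_pos n with rfl | hn
  · rw [Nat.cast_zero, h.npart_lax_zero]
    simp
  · exact PDO.ext (h.sato ⟨n, hn⟩)

theorem dtP_dressing' (n : ℕ) :
    dtP n (dressing τ) = posPart (lax τ V n) * dressing τ - dressing τ * mono 1 n := by
  rw [h.dtP_dressing, ← h.lax_mul_dressing]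
  conv_rhs => rw [← posPart_add_npart (lax τ V n)]
  rw [posPart_add, posPart_of_isDiff (isDiff_posPart _), posPart_of_ordLE (ordLE_negPart _)]
  noncomm_ring

theorem dtP_inv (n : ℕ) : dtP n V = V * npart (lax τ V n) := by
  have h1 : dtP n (V * dressing τ) = 0 := by rw [h.inv_mul, dtP_one]
  rw [dtP_mul, h.dtP_dressing] at h1
  have h2 : dtP n V * dressing τ = V * npart (lax τ V n) * dressing τ := by
    rw [← sub_eq_zero, ← h1]
    noncomm_ring
  have h3 := congrArg (· * V) h2
  simpa only [mul_assoc, h.mul_inv, mul_one] using h3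

theorem dtP_lax (m : ℕ) (n : ℤ) : dtP m (lax τ V n) =
    lax τ V n * npart (lax τ V m) - npart (lax τ V m) * lax τ V n := by
  rw [lax, dtP_mul, dtP_mul, h.dtP_dressing, h.dtP_inv, dtP_mono_one]
  noncomm_ring

theorem wave_mul_tau : wave τ * PowerSeries.C τ = shift τ := by
  refine ser_ext fun n => ?_
  rw [PowerSeries.coeff_mul_C, coeff_wave, mul_assoc, mul_comm τ⁻¹, h.tau_mul_inv, mul_one,
    coeff_shift]

theorem theta_mul_tau (n : ℤ) : theta τ n * τ = dt n τ := by
  rw [theta, mul_assoc, mul_comm τ⁻¹, h.tau_mul_inv, mul_one]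

/-- The D⁻¹ coefficient of W is -∂_x log τ; compare D⁻¹ coefficients in the Sato equation. -/
theorem res_lax (n : ℕ) : res (lax τ V n) = dt n (theta τ 1) := by
  have h1 : (dressing τ).1 (-1) = -theta τ 1 := by
    have := coeff_wave τ 1
    rw [wave, coeff_sym] at this
    simpa [schurShift, theta] using this
  have h2 := congrArg (fun A : PDO K => A.1 (-1)) (h.dtP_dressing n)
  have h3 := mul_leading (ordLE_negPart (lax τ V n).1) (ordLE_dressing τ)
  rw [add_zero, h.dressing_coe_zero, mul_one] at h3
  simp only [dtP_coe, h1, dt_neg, coe_neg', h3] at h2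
  rw [negPart_coe, if_pos (by omega), neg_inj] at h2
  exact h2.symm

/-- The differential part of `A D^j W⁻¹`, when `A = ∑_m G_m W D^{N-m}`. -/
theorem posPart_mul_inv {A : PDO K} {N : ℤ} (hA : OrdLE A N) {G : Ser K}
    (hG : sym N A = G * wave τ) (j : ℤ) (M : ℕ) (hM : N + j < M) :
    posPart (A * mono 1 j * V) =
      ∑ m ∈ Finset.range M, mono (coeff m G) 0 * posPart (lax τ V (N + j - m)) := by
  set T : ℕ → PDO K := fun m => mono (coeff m G) 0 * (dressing τ * mono 1 (N - m)) with hT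
  set R := A - ∑ m ∈ Finset.range M, T m with hR
  have hTN : ∀ m, OrdLE (T m) N := fun m =>
    ((ordLE_dressing τ).mul' (ordLE_mono 1 _) (by omega)).mono_mul _
  have hTs : ∀ m : ℕ, sym N (T m) = PowerSeries.C (coeff m G) * X ^ m * wave τ := fun m => by
    have h1 := sym_add_nat (ordLE_dressing τ) m
    rw [hT]
    dsimp only
    rw [sym_mono_mul, sym_mul_mono_one, show N - (N - m) = 0 + (m : ℤ) by ring, h1, wave, mul_assoc]
  -- The M leading terms of A are removed, so the remainder times D^j W⁻¹ has negative order and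
  -- does not reach the differential part.
  have hRo : OrdLE R (N - M) := by
    refine ordLE_of_dvd (hA.sub (OrdLE.sum fun m _ => hTN m)) ?_
    rw [hR, sym_sub, sym_sum, hG, Finset.sum_congr rfl fun m _ => hTs m, ← Finset.sum_mul, ← sub_mul]
    refine Dvd.dvd.mul_right (PowerSeries.X_pow_dvd_iff.mpr fun k hk => ?_) _
    rw [map_sub, map_sum, Finset.sum_eq_single k]
    · simp
    · intro b _ hb
      rw [PowerSeries.coeff_C_mul, PowerSeries.coeff_X_pow, if_neg (Ne.symm hb), mul_zero]
    · simp [hk]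
  have h1 : A = ∑ m ∈ Finset.range M, T m + R := by rw [hR]; abel
  rw [h1, add_mul, add_mul, posPart_add, posPart_of_ordLE (A := R * _ * _)
    ((hRo.mul' (ordLE_mono 1 j) le_rfl).mul' h.ordLE_inv (by omega)), add_zero, Finset.sum_mul,
    Finset.sum_mul, posPart_sum]
  refine Finset.sum_congr rfl fun m _ => ?_
  rw [← posPart_mono_mul, lax]
  simp only [hT, mul_assoc]
  rw [← mul_assoc (mono 1 _) (mono 1 _) V, mono_mul_mono_one,
    show N - (m : ℤ) + j = N + j - m by ring]

section CharZero

variable [CharZero K]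

/-- Logarithmic differentiation of τ(t - [z])/τ; the shift commutes with ∂_n. -/
theorem dtS_wave (n : ℤ) : dtS n (wave τ) = omega τ n * wave τ := by
  have h1 := congrArg (dtS n) h.wave_mul_tau
  rw [dtS_mul, dtS_C, ← shift_dt, ← h.theta_mul_tau, shift_mul, ← h.wave_mul_tau] at h1
  have h2 : PowerSeries.C τ ≠ 0 := by
    rw [Ne, map_eq_zero_iff _ PowerSeries.C_injective]
    exact h.tau_ne_zero'
  refine mul_right_cancel₀ h2 ?_
  rw [omega]
  rw [map_mul] at h1
  linear_combination h1

theorem sym_posPart_mul_dressing (n : ℕ) :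
    sym n (posPart (lax τ V n) * dressing τ) = (1 + X ^ n * omega τ n) * wave τ := by
  have h1 : posPart (lax τ V n) * dressing τ = dtP n (dressing τ) + dressing τ * mono 1 n := by
    rw [h.dtP_dressing']; abel
  have h2 : sym (n : ℤ) (dtP n (dressing τ)) = X ^ n * dtS n (sym 0 (dressing τ)) := by
    have := sym_add_nat ((ordLE_dressing τ).dtP n) n
    rw [← sym_dtP]
    rwa [zero_add] at this
  rw [h1, sym_add, h2, sym_mul_mono_one, sub_self, ← wave, h.dtS_wave]
  ring

theorem sym_Dop_mul_dressing : sym 1 (Dop * dressing τ) = (1 + X * omega τ 1) * wave τ := by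
  have := sym_Dop_mul (ordLE_dressing τ)
  rw [zero_add, ← wave, h.dtS_wave] at this
  rw [this]
  ring

end CharZero

end IsKP

end

section

open PowerSeries (coeff mk coeff_mk coeff_mul X)
open Finset.HasAntidiagonal

/-! ### Eigenfunctions, adjoint eigenfunctions and squared eigenfunction potentials -/

theorem coeff_mul_range (G H : Ser K) (k : ℕ) :
    coeff k (G * H) = ∑ m ∈ Finset.range (k + 1), coeff m G * coeff (k - m) H := by
  rw [coeff_mul, Finset.Nat.sum_antidiagonal_eq_sum_range_succ fun i j => coeff i G * coeff j H]

theorem flow_dx (f : Fn K) : flow (dx f) = dtS 1 (flow f) := by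
  refine ser_ext fun n => ?_
  rcases n with _ | n
  · rw [coeff_dtS, coeff_flow_zero, coeff_flow_zero, dt_one]
  · rw [coeff_dtS, coeff_flow_succ, coeff_flow_succ, dt_one, dt_dx]

/-- The series `∑_n z^n (L^{n/r})₊(f)`. -/
def actSer (τ : Fn K) (V : PDO K) (f : Fn K) : Ser K := mk fun n => act (lax τ V n) f

theorem coeff_actSer (τ : Fn K) (V : PDO K) (f : Fn K) (n : ℕ) :
    coeff n (actSer τ V f) = act (lax τ V n) f := coeff_mk _ _

/-- `G` with `D⁻¹ g W = ∑_m G_m W D^{-m-1}`. -/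
def adjSer (τ g : Fn K) : Ser K := sym (-1) (Dinv * mono g 0 * dressing τ) * Ring.inverse (wave τ)

theorem ordLE_adj (τ g : Fn K) : OrdLE (Dinv * mono g 0 * dressing τ) (-1) :=
  ((ordLE_mono 1 (-1)).mul_mono g).mul' (ordLE_dressing τ) (by omega)

theorem adjSer_zero (τ : Fn K) : adjSer τ 0 = 0 := by
  have : sym (-1) (0 : PDO K) = 0 := ser_ext fun n => by simp
  rw [adjSer, mono_zero, mul_zero, zero_mul, this, zero_mul]

/-- Each of the k terms contributes G_k once. For fixed m, both families of ω-corrections are the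
full sum over j of the coefficients of z^j ω_j at order k - m, because these vanish for j = 0 and
for j ≥ k - m; hence they cancel. -/
theorem sum_telescope (G : Ser K) (ω : ℕ → Ser K) (h0 : ω 0 = 0) (hω : ∀ j, coeff 0 (ω j) = 0)
    (k : ℕ) :
    ∑ n ∈ Finset.range k, coeff k (G * (1 + X ^ (n + 1) * ω (n + 1)) -
      ∑ m ∈ Finset.range (n + 1), PowerSeries.C (coeff m G) * X ^ m *
        (1 + X ^ (n - m) * ω (n - m))) = (k : Fn K) * coeff k G := by
  set e : ℕ → ℕ → Fn K := fun j i => coeff i (X ^ j * ω j) with he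
  have he0 : ∀ i, e 0 i = 0 := fun i => by simp [he, h0]
  have hle : ∀ j i, i ≤ j → e j i = 0 := fun j i hij => by
    simp only [he]
    rw [PowerSeries.coeff_X_pow_mul']
    split_ifs with h
    · rw [show i - j = 0 by omega, hω]
    · rfl
  have hterm : ∀ n ∈ Finset.range k, coeff k (G * (1 + X ^ (n + 1) * ω (n + 1)) -
      ∑ m ∈ Finset.range (n + 1), PowerSeries.C (coeff m G) * X ^ m *
        (1 + X ^ (n - m) * ω (n - m))) = coeff k G +
        (∑ m ∈ Finset.range (k + 1), coeff m G * e (n + 1) (k - m)) -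
        ∑ m ∈ Finset.range (n + 1), coeff m G * e (n - m) (k - m) := by
    intro n hn
    rw [Finset.mem_range] at hn
    rw [map_sub, mul_add, mul_one, map_add, coeff_mul_range, map_sum]
    congr 1
    refine Finset.sum_congr rfl fun m hm => ?_
    rw [Finset.mem_range] at hm
    rw [mul_assoc, PowerSeries.coeff_C_mul, PowerSeries.coeff_X_pow_mul', if_pos (by omega),
      map_add, PowerSeries.coeff_one, if_neg (by omega), zero_add]
  have hswap : ∑ n ∈ Finset.range k, ∑ m ∈ Finset.range (n + 1), coeff m G * e (n - m) (k - m) =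
      ∑ m ∈ Finset.range k, ∑ n ∈ Finset.Ico m k, coeff m G * e (n - m) (k - m) :=
    Finset.sum_comm' fun n m => by simp only [Finset.mem_range, Finset.mem_Ico]; omega
  rw [Finset.sum_congr rfl hterm, Finset.sum_sub_distrib, Finset.sum_add_distrib, Finset.sum_const,
    Finset.card_range, nsmul_eq_mul, hswap, Finset.sum_comm, Finset.sum_range_succ, Nat.sub_self,
    Finset.sum_eq_zero (s := Finset.range k) (f := fun n => coeff k G * e (n + 1) 0), add_zero,
    add_sub_assoc, ← Finset.sum_sub_distrib, Finset.sum_eq_zero, add_zero]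
  · intro m hm
    rw [Finset.mem_range] at hm
    rw [← Finset.mul_sum, ← Finset.mul_sum, Finset.sum_Ico_eq_sum_range, ← mul_sub]
    have h1 := Finset.sum_range_succ' (fun j => e j (k - m)) k
    rw [he0, add_zero] at h1
    have h2 : ∑ j ∈ Finset.range (k - m), e j (k - m) = ∑ j ∈ Finset.range (k + 1), e j (k - m) := by
      refine Finset.sum_subset (Finset.range_mono (by omega)) fun j _ hj => hle _ _ ?_
      rw [Finset.mem_range] at hj
      omega
    rw [← h1, ← h2]
    simp
  · intro n _
    rw [hle _ _ (by omega), mul_zero]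

theorem omega_zero [CharZero K] (τ : Fn K) : omega τ 0 = 0 := by
  rw [omega, theta_zero_index, shift_zero, map_zero, sub_zero]

/-- The right-hand side is the defect of `flow f` in the recursion `actSer_recursion`. So the
proposed shift of f is annihilated exactly when `flow f` solves the recursion of `actSer`. -/
theorem nabla_eigen [CharZero K] (τ f : Fn K) :
    nabla (PowerSeries.C f * (1 + X * omega τ 1) - X * PowerSeries.C (dx f)) =
      (1 + X * omega τ 1) * flow f - X * dtS 1 (flow f) -
        PowerSeries.C f * (1 + X * (flow (theta τ 1) - PowerSeries.C (theta τ 1))) := by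
  rw [nabla_sub, nabla_mul, nabla_mul, nabla_C, nabla_C, nabla_add, nabla_one, nabla_mul, nabla_X,
    nabla_omega, flow_dx]
  ring

namespace IsKP

variable {τ : Fn K} {V : PDO K} (h : IsKP τ V)
include h

theorem isEigenfunction_iff_flow (f : Fn K) :
    IsEigenfunction (dressing τ) V f ↔ flow f = actSer τ V f := by
  constructor
  · intro hf
    refine ser_ext fun n => ?_
    rw [coeff_actSer]
    rcases n with _ | n
    · rw [Nat.cast_zero, h.lax_zero, act_one, coeff_flow_zero]
    · rw [coeff_flow_succ]
      exact_mod_cast hf ⟨n + 1, n.succ_pos⟩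
  · intro hf n
    obtain ⟨m, hm⟩ := Nat.exists_eq_succ_of_ne_zero n.ne_zero
    have := congrArg (coeff (n : ℕ)) hf
    rw [coeff_actSer, hm, Nat.succ_eq_add_one, coeff_flow_succ] at this
    rw [hm, laxPow_eq]
    exact_mod_cast this

theorem adjSer_mul_wave (g : Fn K) :
    adjSer τ g * wave τ = sym (-1) (Dinv * mono g 0 * dressing τ) := by
  rw [adjSer, mul_assoc, Ring.inverse_mul_cancel, mul_one]
  rw [PowerSeries.isUnit_iff_constantCoeff, ← PowerSeries.coeff_zero_eq_constantCoeff_apply,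
    h.coeff_zero_wave]
  exact isUnit_one

/-- Expanding D⁻¹ g W along W D^{-m-1} turns D⁻¹ g L^{n/r} into lower powers of L^{1/r}; those of
negative order do not act. -/
theorem act_Dinv_mul_lax (f g : Fn K) (n : ℕ) : act (Dinv * mono g 0 * lax τ V n) f =
    ∑ m ∈ Finset.range n, coeff m (adjSer τ g) * act (lax τ V ((n - 1 - m : ℕ) : ℤ)) f := by
  have h1 := h.posPart_mul_inv (ordLE_adj τ g) (h.adjSer_mul_wave g).symm n n (by omega)
  rw [← act_posPart, lax, ← mul_assoc, ← mul_assoc, h1, act_sum_left]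
  refine Finset.sum_congr rfl fun m hm => ?_
  rw [Finset.mem_range] at hm
  rw [act_mono_mul, act_posPart, show -1 + (n : ℤ) - m = ((n - 1 - m : ℕ) : ℤ) by omega]

omit h in
theorem act_Dinv_mul_posPart (A : PDO K) (f g : Fn K) :
    act (Dinv * mono g 0 * posPart A) f = act (Dinv * mono g 0 * A) f := by
  conv_rhs => rw [← posPart_add_npart A]
  rw [mul_add, act_add_left, act_of_ordLE (A := _ * npart A), add_zero]
  exact ((ordLE_mono 1 (-1)).mul_mono g).mul' (ordLE_negPart _) (by omega)

theorem dt_sep {f g s : Fn K} (hs : IsSEP (dressing τ) V f g s) (n : ℕ) :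
    dt n s = act (Dinv * mono g 0 * lax τ V n) f := by
  rcases Nat.eq_zero_or_pos n with rfl | hn
  · rw [Nat.cast_zero, h.lax_zero, mul_one, dt_zero_index, act_of_ordLE]
    exact (ordLE_mono 1 (-1)).mul_mono g
  · rw [← act_Dinv_mul_posPart, ← res_mul_Dinv]
    exact hs ⟨n, hn⟩

variable [CharZero K]

/-- Compute (D L^{n/r})₊ in two ways: as D (L^{n/r})₊ plus the residue ∂_n θ₁, and through D W = Σ
c_m W D^{1-m}, where the c_m are the coefficients of 1 + zω₁. -/
theorem actSer_recursion (f : Fn K) : (1 + X * omega τ 1) * actSer τ V f =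
    X * dtS 1 (actSer τ V f) +
      PowerSeries.C f * (1 + X * (flow (theta τ 1) - PowerSeries.C (theta τ 1))) := by
  refine ser_ext fun n => ?_
  rcases n with _ | n
  · have := coeff_actSer τ V f 0
    rw [Nat.cast_zero, h.lax_zero, act_one] at this
    rw [PowerSeries.coeff_zero_eq_constantCoeff_apply] at this
    simp [this]
  have hD : OrdLE (Dop * dressing τ) 1 := (ordLE_mono 1 1).mul' (ordLE_dressing τ) le_rfl
  have h1 := h.posPart_mul_inv hD h.sym_Dop_mul_dressing n (n + 2) (by push_cast; omega)
  have h2 : posPart (Dop * dressing τ * mono 1 n * V) =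
      Dop * posPart (lax τ V n) + mono (dt n (theta τ 1)) 0 := by
    have h3 : Dop * dressing τ * mono 1 (n : ℤ) * V =
        Dop * posPart (lax τ V n) + Dop * npart (lax τ V n) := by
      rw [← mul_add, posPart_add_npart, lax]
      simp only [mul_assoc]
    rw [h3, posPart_add, posPart_of_isDiff ((isDiff_mono 1 (by omega)).mul (isDiff_posPart _)),
      ← h.res_lax]
    congr 1
    ext1 k
    rw [posPart_coe, coe_mono, Dop_mul_coe]
    split_ifs with hk hk' hk'
    · subst hk'
      simp [negPart_coe, res]
    · simp [negPart_coe, show ¬ k < 0 by omega, show ¬ k - 1 < 0 by omega]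
    · omega
    · rfl
  rw [h2] at h1
  have h4 := congrArg (fun A => act A f) h1
  simp only [act_add_left, act_mono, act_sum_left, act_mono_mul, act_posPart] at h4
  rw [act_mul (isDiff_mono 1 (by omega)) (isDiff_posPart _), act_posPart, act_Dop] at h4
  rw [coeff_mul_range, map_add, PowerSeries.coeff_succ_X_mul, coeff_dtS, coeff_actSer, dt_one,
    PowerSeries.coeff_C_mul, map_add, PowerSeries.coeff_succ_X_mul]
  have h5 : coeff n (flow (theta τ 1) - PowerSeries.C (theta τ 1)) = dt n (theta τ 1) := by
    rw [map_sub]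
    rcases n with _ | n
    · simp [coeff_flow_zero]
    · rw [coeff_flow_succ, PowerSeries.coeff_C, if_neg (by omega), sub_zero]
      push_cast
      rfl
  rw [h5, PowerSeries.coeff_one, if_neg (by omega), zero_add, mul_comm f, h4]
  refine Finset.sum_congr rfl fun m hm => ?_
  rw [Finset.mem_range] at hm
  rw [coeff_actSer, show 1 + (n : ℤ) - m = ((n + 1 - m : ℕ) : ℤ) by omega]

/-- Eigenfunctions are characterized by their shift. -/
theorem isEigenfunction_iff (f : Fn K) : IsEigenfunction (dressing τ) V f ↔
    shift f = PowerSeries.C f * (1 + X * omega τ 1) - X * PowerSeries.C (dx f) := by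
  rw [h.isEigenfunction_iff_flow, eq_comm (a := shift f), eq_shift_iff (by simp), nabla_eigen]
  have h1 := h.actSer_recursion f
  constructor
  · intro hf
    rw [hf]
    linear_combination h1
  · intro hf
    have h2 : dtS 1 (flow f - actSer τ V f) = dtS 1 (flow f) - dtS 1 (actSer τ V f) := dtS_sub _ _ _
    refine sub_eq_zero.mp (eq_zero_of_recursion (ω := omega τ 1) 1 ?_)
    rw [one_zsmul, h2]
    linear_combination hf - h1

/-- Apply D to D⁻¹ g W = Σ G_m W D^{-m-1} and compare symbols. -/
theorem adjSer_eq (g : Fn K) : adjSer τ g * (1 + X * omega τ 1) + X * dtS 1 (adjSer τ g) =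
    PowerSeries.C g := by
  have h1 := sym_Dop_mul (ordLE_adj τ g)
  rw [← h.adjSer_mul_wave, ← mul_assoc, ← mul_assoc, Dop_mul_Dinv, one_mul, dtS_mul, h.dtS_wave,
    sym_mono_mul, neg_add_cancel, ← wave] at h1
  refine mul_right_cancel₀ h.wave_ne_zero ?_
  linear_combination -h1

theorem coeff_zero_adjSer (g : Fn K) : coeff 0 (adjSer τ g) = g := by
  simpa using congrArg (coeff 0) (h.adjSer_eq g)

theorem adjSer_unique {g : Fn K} {G : Ser K}
    (hG : G * (1 + X * omega τ 1) + X * dtS 1 G = PowerSeries.C g) : G = adjSer τ g := by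
  refine sub_eq_zero.mp (eq_zero_of_recursion (ω := omega τ 1) (-1) ?_)
  rw [neg_one_zsmul, dtS_sub]
  linear_combination hG - h.adjSer_eq g

/-- Differentiate D⁻¹ g W in t_n. The negative part of D⁻¹ g (L^{n/r})₊ is D⁻¹ times the adjoint
action on g, and its differential part is a combination of lower (L^{j/r})₊. This expresses the
defect of the adjoint equation through G and the ω's. -/
theorem adjSer_flow (g : Fn K) (n : ℕ) : X ^ n * adjSer τ (dt n g + adjAct (lax τ V n) g) =
    X ^ n * dtS n (adjSer τ g) + adjSer τ g * (1 + X ^ n * omega τ n) -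
      ∑ m ∈ Finset.range n, PowerSeries.C (coeff m (adjSer τ g)) * X ^ m *
        (1 + X ^ (n - 1 - m) * omega τ ((n - 1 - m : ℕ) : ℤ)) := by
  set G := adjSer τ g with hG
  set W := dressing τ with hW
  set U := Dinv * mono g 0 * W with hU
  have hUo : OrdLE U (-1) := ordLE_adj τ g
  have hQ : posPart (Dinv * mono g 0 * posPart (lax τ V n)) =
      ∑ m ∈ Finset.range n, mono (coeff m G) 0 * posPart (lax τ V (-1 + n - m)) := by
    rw [← h.posPart_mul_inv hUo (h.adjSer_mul_wave g).symm n n (by omega)]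
    have h1 : U * mono 1 (n : ℤ) * V = Dinv * mono g 0 * posPart (lax τ V n) +
        Dinv * mono g 0 * npart (lax τ V n) := by
      rw [← mul_add, posPart_add_npart, lax, hU]
      simp only [mul_assoc, hW]
    rw [h1, posPart_add, posPart_of_ordLE (A := _ * npart _), add_zero]
    exact ((ordLE_mono 1 (-1)).mul_mono g).mul' (ordLE_negPart _) (by omega)
  have h2 := posPart_add_npart (Dinv * mono g 0 * posPart (lax τ V n))
  rw [npart_Dinv_mul (isDiff_posPart _), adjAct_posPart, hQ] at h2
  have h3 : Dinv * mono (dt n g + adjAct (lax τ V n) g) 0 * W = dtP n U + U * mono 1 n -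
      ∑ m ∈ Finset.range n, mono (coeff m G) 0 * (posPart (lax τ V (-1 + n - m)) * W) := by
    have h4 := h.dtP_dressing' n
    rw [hU, dtP_mul, dtP_mul, dtP_mono_one, zero_mul, zero_add, dtP_mono, h4, mono_add, mul_add,
      add_mul, eq_sub_iff_add_eq'.mpr h2, sub_mul, Finset.sum_mul]
    simp only [mul_sub, mul_assoc, hW]
    abel
  have h5 := congrArg (sym (n - 1)) h3
  have hz : ((n : ℤ) - 1) = -1 + n := by ring
  rw [hz, sym_add_nat (ordLE_adj _ _), ← h.adjSer_mul_wave, sym_sub, sym_add,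
    sym_add_nat (hUo.dtP n), sym_dtP, sym_mul_mono_one, ← h.adjSer_mul_wave, add_sub_cancel_right,
    ← h.adjSer_mul_wave, dtS_mul, h.dtS_wave, sym_sum] at h5
  have h6 : ∀ m ∈ Finset.range n, sym (-1 + (n : ℤ))
      (mono (coeff m G) 0 * (posPart (lax τ V (-1 + n - m)) * W)) =
      PowerSeries.C (coeff m G) * X ^ m * (1 + X ^ (n - 1 - m) * omega τ ((n - 1 - m : ℕ) : ℤ)) *
        wave τ := fun m hm => by
    rw [Finset.mem_range] at hm
    have hk : -1 + (n : ℤ) - m = ((n - 1 - m : ℕ) : ℤ) := by omega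
    have ho : OrdLE (posPart (lax τ V ((n - 1 - m : ℕ) : ℤ)) * W) ((n - 1 - m : ℕ) : ℤ) := by
      refine OrdLE.mul' (fun j hj => ?_) (ordLE_dressing τ) (add_zero _).le
      rw [posPart_coe, h.ordLE_lax _ j hj, ite_self]
    rw [sym_mono_mul, hk, show -1 + (n : ℤ) = ((n - 1 - m : ℕ) : ℤ) + m by omega, sym_add_nat ho,
      h.sym_posPart_mul_dressing]
    ring
  rw [Finset.sum_congr rfl h6, ← Finset.sum_mul] at h5
  refine mul_right_cancel₀ h.wave_ne_zero ?_
  linear_combination h5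

/-- Summed over the flows, the ω-terms of `adjSer_flow` collapse by `sum_telescope` to k G_k, the
Euler part of `nabla`. -/
theorem nabla_adjSer (g : Fn K) (k : ℕ) : coeff k (nabla (adjSer τ g)) =
    ∑ n ∈ Finset.range k,
      coeff (k - 1 - n) (adjSer τ (dt (n + 1 : ℕ) g + adjAct (lax τ V (n + 1 : ℕ)) g)) := by
  have h1 := sum_telescope (adjSer τ g) (fun j => omega τ j) (omega_zero τ)
    (fun j => coeff_zero_omega τ j) k
  rw [coeff_nabla, ← h1, ← Finset.sum_add_distrib]
  refine Finset.sum_congr rfl fun n hn => ?_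
  rw [Finset.mem_range] at hn
  have h2 := congrArg (coeff k) (h.adjSer_flow g (n + 1))
  rw [PowerSeries.coeff_X_pow_mul', if_pos (by omega), add_sub_assoc, map_add,
    PowerSeries.coeff_X_pow_mul', if_pos (by omega), coeff_dtS] at h2
  rw [show k - 1 - n = k - (n + 1) by omega, h2, add_comm]
  simp

/-- Adjoint eigenfunctions are characterized by their shift. -/
theorem isAdjointEigenfunction_iff (g : Fn K) : IsAdjointEigenfunction (dressing τ) V g ↔
    shift g = adjSer τ g := by
  rw [eq_comm, eq_shift_iff (h.coeff_zero_adjSer g)]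
  have h1 : IsAdjointEigenfunction (dressing τ) V g ↔
      ∀ n : ℕ, dt (n + 1 : ℕ) g + adjAct (lax τ V (n + 1 : ℕ)) g = 0 :=
    ⟨fun hg n => by rw [← eq_neg_iff_add_eq_zero]; exact hg ⟨n + 1, n.succ_pos⟩, fun hg n => by
      obtain ⟨m, hm⟩ := Nat.exists_eq_succ_of_ne_zero n.ne_zero
      rw [hm, laxPow_eq]
      exact eq_neg_iff_add_eq_zero.mpr (hg m)⟩
  rw [h1]
  constructor
  · intro hg
    refine ser_ext fun k => ?_
    rw [h.nabla_adjSer, map_zero]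
    exact Finset.sum_eq_zero fun n _ => by rw [hg, adjSer_zero, map_zero]
  -- The coefficient of order n + 1 involves the defects of the flows 1, …, n + 1. The lower ones
  -- vanish by induction, and the last enters through the constant term of its `adjSer`, which is
  -- the defect itself.
  · intro hg n
    induction n using Nat.strong_induction_on with
    | _ n ih =>
      have h2 := h.nabla_adjSer g (n + 1)
      rw [hg, map_zero, Finset.sum_range_succ, Finset.sum_eq_zero, zero_add, Nat.add_sub_cancel,
        Nat.sub_self, h.coeff_zero_adjSer] at h2
      · exact h2.symm
      · intro m hm
        rw [Finset.mem_range] at hm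
        rw [ih m hm, adjSer_zero, map_zero]

theorem isAdjointEigenfunction_iff' (g : Fn K) : IsAdjointEigenfunction (dressing τ) V g ↔
    shift g * (1 + X * omega τ 1) + X * shift (dx g) = PowerSeries.C g := by
  rw [h.isAdjointEigenfunction_iff, ← dt_one, shift_dt]
  exact ⟨fun hg => hg ▸ h.adjSer_eq g, fun hg => h.adjSer_unique hg⟩

/-- The shift of a squared eigenfunction potential. -/
theorem shift_sep {f g s : Fn K} (hf : IsEigenfunction (dressing τ) V f)
    (hg : IsAdjointEigenfunction (dressing τ) V g) (hs : IsSEP (dressing τ) V f g s) :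
    shift s = PowerSeries.C s - X * PowerSeries.C f * shift g := by
  -- All equations of the potential in one series: the coefficients of D⁻¹ g W are those of g(t -
  -- [z]), and the powers of L^{1/r} act on f as the flows.
  have h1 : flow s = PowerSeries.C s + X * (shift g * flow f) := by
    refine ser_ext fun n => ?_
    rcases n with _ | n
    · simp [coeff_flow_zero]
    · rw [coeff_flow_succ, map_add, PowerSeries.coeff_C, if_neg (by omega), zero_add,
        PowerSeries.coeff_succ_X_mul, coeff_mul_range, (h.isEigenfunction_iff_flow f).mp hf,
        (h.isAdjointEigenfunction_iff g).mp hg]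
      have := h.dt_sep hs (n + 1)
      rw [h.act_Dinv_mul_lax] at this
      push_cast at this
      rw [this]
      refine Finset.sum_congr rfl fun m hm => ?_
      rw [coeff_actSer]
  symm
  rw [eq_shift_iff (by simp), nabla_sub, nabla_mul, nabla_mul, nabla_C, nabla_C, nabla_X,
    nabla_shift, h1]
  ring

end IsKP

end

section

open PowerSeries (coeff mk coeff_mk coeff_mul X)
open Finset.HasAntidiagonal

/-! ### Constrained hierarchies -/

namespace IsKP

variable {τ : Fn K} {V : PDO K} (h : IsKP τ V)
include h

theorem dx_sep [CharZero K] {f g s : Fn K} (hs : IsSEP (dressing τ) V f g s) : dx s = g * f := by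
  have := h.dt_sep hs 1
  rwa [h.act_Dinv_mul_lax, Finset.sum_range_one, h.coeff_zero_adjSer, Nat.cast_one, dt_one,
    Nat.sub_self, Nat.cast_zero, h.lax_zero, act_one] at this

end IsKP

section Constrained

variable {r : ℕ+} {τ : Fn K} {V : PDO K} {Φ Ψ : Fn K}

theorem IsCKP.isKP (hL : IsCKP r τ V Φ Ψ) : IsKP τ V :=
  ⟨hL.tau_ne_zero, hL.mul_inv, hL.inv_mul, hL.sato⟩

theorem IsCKP.npart_lax (hL : IsCKP r τ V Φ Ψ) :
    npart (lax τ V (r : ℕ)) = mono Φ 0 * Dinv * mono Ψ 0 := hL.constrained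

/-- The residue of L is ∂_r ∂_x log τ by the Sato equation and ΦΨ by the constraint. -/
theorem IsCKP.dt_theta (hL : IsCKP r τ V Φ Ψ) : dt (r : ℕ) (theta τ 1) = Φ * Ψ := by
  rw [← hL.isKP.res_lax]
  have h1 : res (lax τ V (r : ℕ)) = res (npart (lax τ V (r : ℕ))) := by
    rw [res, res, negPart_coe, if_pos (by omega)]
  have h2 := mul_leading ((ordLE_mono 1 (-1)).mono_mul Φ) (ordLE_mono Ψ 0)
  rw [h1, hL.npart_lax, res]
  rw [add_zero, mono_zero_mul_coe, coe_mono, if_pos rfl, mul_one, coe_mono, if_pos rfl] at h2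
  exact h2

section CharZero

variable [CharZero K]

theorem IsCKP.dtS_omega (hL : IsCKP r τ V Φ Ψ) : dtS (r : ℕ) (omega τ 1) =
    shift Φ * shift Ψ - PowerSeries.C Φ * PowerSeries.C Ψ := by
  rw [omega, dtS_sub, dtS_C, ← shift_dt, hL.dt_theta, shift_mul, map_mul]

/-- Differentiate the shift formula of f in t_r. As ∂_r ω₁ = Φ(t - [z])Ψ(t - [z]) - ΦΨ, the term z f
Φ(t - [z])Ψ(t - [z]) cancels against the one in the shift of Φs, and ∂_x s = Ψf accounts for the
rest. -/
theorem IsCKP.eigen_step (hL : IsCKP r τ V Φ Ψ) {f s : Fn K}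
    (hf : IsEigenfunction (dressing τ) V f) (hs : IsSEP (dressing τ) V f Ψ s) :
    IsEigenfunction (dressing τ) V (act (laxPow (dressing τ) V r) f + Φ * s) := by
  have h := hL.isKP
  have h1 := (h.isEigenfunction_iff f).mp hf
  have h2 := (h.isEigenfunction_iff Φ).mp hL.eigen
  have h3 := h.shift_sep hf hL.adjoint_eigen hs
  have h4 := h.dx_sep hs
  have h5 := hL.dtS_omega
  rw [← hf r, h.isEigenfunction_iff, shift_add, shift_dt, shift_mul, h1, h3, dtS_sub, dtS_mul,
    dtS_mul, dtS_add, dtS_one, dtS_mul, dtS_X, dtS_C, dtS_C, h5, dx_add, dx_mul, h4, dt_dx]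
  simp only [map_add, map_mul]
  rw [h2]
  ring

theorem IsCKP.adjoint_step (hL : IsCKP r τ V Φ Ψ) {g s : Fn K}
    (hg : IsAdjointEigenfunction (dressing τ) V g) (hs : IsSEP (dressing τ) V Φ g s) :
    IsAdjointEigenfunction (dressing τ) V (adjAct (laxPow (dressing τ) V r) g - s * Ψ) := by
  have h := hL.isKP
  have h1 := (h.isAdjointEigenfunction_iff' g).mp hg
  have h2 := (h.isAdjointEigenfunction_iff' Ψ).mp hL.adjoint_eigen
  have h3 := h.shift_sep hL.eigen hg hs
  have h4 := h.dx_sep hs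
  have h5 := hL.dtS_omega
  have h6 := congrArg (dtS (r : ℕ)) h1
  rw [dtS_add, dtS_mul, dtS_mul, dtS_add, dtS_one, dtS_mul, dtS_X, dtS_C, h5, ← shift_dt,
    ← shift_dt, dt_dx] at h6
  rw [← neg_eq_iff_eq_neg.mpr (hg r), h.isAdjointEigenfunction_iff', shift_sub, shift_neg,
    shift_mul, dx_sub, dx_neg, dx_mul, h4, shift_sub, shift_neg, shift_add, shift_mul, shift_mul,
    shift_mul]
  simp only [map_sub, map_neg, map_mul]
  linear_combination -h6 - shift s * h2 - PowerSeries.C Ψ * h3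

end CharZero

/-! ### Potentials of the iterated eigenfunctions -/

variable {ι κ : Type*} {a₀ : ι} {b₀ : κ} {f : ι → ℕ → Fn K} {g : κ → ℕ → Fn K}
  {S : ι → ℕ → κ → ℕ → Fn K}

namespace IsSEPSystem

variable (hS : IsSEPSystem r (dressing τ) V Φ Ψ a₀ b₀ f g S) (hL : IsCKP r τ V Φ Ψ)
include hS

theorem isSEP_left (a : ι) (i : ℕ) : IsSEP (dressing τ) V (f a i) Ψ (S a i b₀ 0) := by
  rw [← hS.adjoint_base]
  exact hS.isSEP a i b₀ 0

theorem isSEP_right (b : κ) (j : ℕ) : IsSEP (dressing τ) V Φ (g b j) (S a₀ 0 b j) := by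
  rw [← hS.base]
  exact hS.isSEP a₀ 0 b j

include hL

variable [CharZero K]

theorem isEigenfunction (a : ι) (i : ℕ) : IsEigenfunction (dressing τ) V (f a i) := by
  induction i with
  | zero => exact hS.eigen a
  | succ i ih =>
    rw [hS.step]
    exact hL.eigen_step ih (hS.isSEP_left a i)

theorem isAdjointEigenfunction (b : κ) (j : ℕ) :
    IsAdjointEigenfunction (dressing τ) V (g b j) := by
  induction j with
  | zero => exact hS.adjoint_eigen b
  | succ j ih =>
    rw [hS.adjoint_step]
    exact hL.adjoint_step ih (hS.isSEP_right b j)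

theorem shift_S (a : ι) (i : ℕ) (b : κ) (j : ℕ) : shift (S a i b j) =
    PowerSeries.C (S a i b j) - X * PowerSeries.C (f a i) * shift (g b j) :=
  hL.isKP.shift_sep (hS.isEigenfunction hL a i) (hS.isAdjointEigenfunction hL b j)
    (hS.isSEP a i b j)

theorem step' (a : ι) (i : ℕ) : f a (i + 1) = dt (r : ℕ) (f a i) + Φ * S a i b₀ 0 := by
  rw [hS.step, ← hS.isEigenfunction hL a i r]

theorem adjoint_step' (b : κ) (j : ℕ) : g b (j + 1) = -dt (r : ℕ) (g b j) - S a₀ 0 b j * Ψ := by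
  rw [hS.adjoint_step, hS.isAdjointEigenfunction hL b j r, neg_neg]

/-- The potentials are fitted to each other at all times. -/
theorem compatible' (a : ι) (i : ℕ) (b : κ) (j : ℕ) : S a (i + 1) b j =
    S a i b (j + 1) + dt (r : ℕ) (S a i b j) + S a₀ 0 b j * S a i b₀ 0 := by
  set E := S a (i + 1) b j - S a i b (j + 1) - (dt (r : ℕ) (S a i b j) + S a₀ 0 b j * S a i b₀ 0)
    with hE
  have h0 : MvPowerSeries.constantCoeff E = 0 := by
    rw [hE, map_sub, hS.compatible a i b j]
    exact sub_self _
  -- The shift changes each potential by -z f g(t - [z]). These changes cancel in E, so E is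
  -- constant and its value at the base point decides.
  have h1 : shift E = PowerSeries.C E := by
    have e1 := hS.shift_S hL a i b j
    have e2 := hS.shift_S hL a₀ 0 b j
    have e3 := hS.shift_S hL a i b₀ 0
    rw [hS.base] at e2
    rw [hS.adjoint_base] at e3
    rw [hE, shift_sub, shift_sub, shift_add, shift_dt, shift_mul, e1, hS.shift_S hL,
      hS.shift_S hL, hS.step' hL, hS.adjoint_step' hL, shift_sub, shift_neg, shift_dt, shift_mul,
      dtS_sub, dtS_mul, dtS_mul, dtS_X, dtS_C, dtS_C]
    simp only [map_sub, map_add, map_mul]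
    linear_combination -PowerSeries.C (S a i b₀ 0) * e2 - shift (S a₀ 0 b j) * e3
  have h2 := eq_C_of_shift_eq h1
  rw [h0, map_zero, hE] at h2
  linear_combination h2

/-- The integral part of L contributes D⁻¹ gΦ D⁻¹ Ψ with gΦ = ∂_x S(Φ, g). By parts this is S D⁻¹ Ψ
- D⁻¹ SΨ, and the last term completes L₊*(g) to L*(g). -/
theorem npart_Dinv_mul_lax (b : κ) (j : ℕ) :
    npart (Dinv * mono (g b j) 0 * lax τ V (r : ℕ)) =
      Dinv * mono (g b (j + 1)) 0 + mono (S a₀ 0 b j) 0 * (Dinv * mono Ψ 0) := by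
  have h1 : Dinv * mono (g b j) 0 * (mono Φ 0 * Dinv * mono Ψ 0) =
      mono (S a₀ 0 b j) 0 * (Dinv * mono Ψ 0) - Dinv * mono (S a₀ 0 b j * Ψ) 0 := by
    have h2 := Dinv_mul_mono_dx_mul_Dinv (S a₀ 0 b j)
    rw [hL.isKP.dx_sep (hS.isSEP_right b j)] at h2
    have h3 : Dinv * mono (g b j) 0 * (mono Φ 0 * Dinv * mono Ψ 0) =
        Dinv * mono (g b j * Φ) 0 * Dinv * mono Ψ 0 := by
      rw [← mono_zero_mul_mono]
      simp only [mul_assoc]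
    rw [h3, h2, sub_mul, mul_assoc, mul_assoc, mono_zero_mul_mono]
  have hd : OrdLE (Dinv : PDO K) (-1) := ordLE_mono 1 (-1)
  rw [← posPart_add_npart (lax τ V (r : ℕ)), mul_add, npart_add, npart_Dinv_mul (isDiff_posPart _),
    adjAct_posPart, hL.npart_lax, h1, npart_of_ordLE, hS.adjoint_step, mono_sub, mul_sub]
  · rw [laxPow_eq]; abel
  · exact ((hd.mul_mono _).mono_mul _).sub (hd.mul_mono _)

/-- The negative part of `D⁻¹ g L^n`, and the derivative of a potential with respect to
`t_{nr}`. -/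
theorem npart_and_dt (n : ℕ) :
    (∀ b j, npart (Dinv * mono (g b j) 0 * lax τ V ((n * r : ℕ) : ℤ)) =
      Dinv * mono (g b (j + n)) 0 +
        ∑ m ∈ Finset.range n, mono (S a₀ (n - 1 - m) b j) 0 * (Dinv * mono (g b₀ m) 0)) ∧
    ∀ a i b j, dt ((n * r : ℕ) : ℤ) (S a i b j) = S a (i + n) b j - S a i b (j + n) -
      ∑ m ∈ Finset.range n, S a₀ (n - 1 - m) b j * S a i b₀ m := by
  have h := hL.isKP
  induction n with
  | zero =>
    refine ⟨fun b j => ?_, fun a i b j => by simp⟩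
    rw [zero_mul, Nat.cast_zero, h.lax_zero, mul_one, Finset.sum_range_zero, add_zero, add_zero,
      npart_of_ordLE ((ordLE_mono 1 (-1)).mul_mono _)]
  | succ n ih =>
    obtain ⟨ih1, ih2⟩ := ih
    have hidx : ∀ b j m, S a₀ (n - (m + 1)) b j = S a₀ (n - 1 - m) b j := fun b j m => by
      rw [Nat.sub_sub, add_comm 1]
    have hlax : lax τ V (((n + 1) * r : ℕ) : ℤ) = lax τ V ((n * r : ℕ) : ℤ) * lax τ V (r : ℕ) := by
      rw [h.lax_mul]
      congr 1
      push_cast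
      ring
    -- Factor L^{n+1} = L^n L and split D⁻¹ g L^n into its differential part and its negative part,
    -- the latter known by induction; the differential part then meets L₊ and Φ D⁻¹ Ψ separately.
    have hQ : ∀ b j, Dinv * mono (g b j) 0 * lax τ V (((n + 1) * r : ℕ) : ℤ) =
        posPart (Dinv * mono (g b j) 0 * lax τ V ((n * r : ℕ) : ℤ)) * posPart (lax τ V (r : ℕ)) +
        posPart (Dinv * mono (g b j) 0 * lax τ V ((n * r : ℕ) : ℤ)) *
          (mono Φ 0 * Dinv * mono Ψ 0) +
        Dinv * mono (g b (j + n)) 0 * lax τ V (r : ℕ) +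
        ∑ m ∈ Finset.range n, mono (S a₀ (n - 1 - m) b j) 0 *
          (Dinv * mono (g b₀ m) 0 * lax τ V (r : ℕ)) := by
      intro b j
      rw [hlax, ← mul_assoc, ← hL.npart_lax, ← mul_add, posPart_add_npart, add_assoc]
      conv_lhs => rw [← posPart_add_npart (Dinv * mono (g b j) 0 * lax τ V ((n * r : ℕ) : ℤ)), ih1]
      rw [add_mul, add_mul, Finset.sum_mul]
      simp only [mul_assoc]
    have hact : ∀ a i b j,
        act (posPart (Dinv * mono (g b j) 0 * lax τ V ((n * r : ℕ) : ℤ))) (f a i) =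
          dt ((n * r : ℕ) : ℤ) (S a i b j) := fun a i b j => by
      rw [act_posPart, h.dt_sep (hS.isSEP a i b j)]
    refine ⟨fun b j => ?_, fun a i b j => ?_⟩
    · have h1 := hact a₀ 0 b j
      rw [hS.base, ih2] at h1
      rw [hQ, npart_add, npart_add, npart_add, npart_of_isDiff ((isDiff_posPart _).mul
        (isDiff_posPart _)), zero_add, npart_mul_integral (isDiff_posPart _), h1,
        hS.npart_Dinv_mul_lax hL, npart_sum, Finset.sum_range_succ', hS.adjoint_base,
        zero_add, Nat.add_sub_cancel, Nat.sub_zero, mono_sub, mono_sub, mono_sum]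
      simp only [npart_mono_mul, hS.npart_Dinv_mul_lax hL]
      simp only [hidx, mul_add, Finset.sum_add_distrib,
        sub_mul, Finset.sum_mul, ← mul_assoc, mono_zero_mul_mono]
      rw [add_assoc j]
      abel
    · have h1 := hact a₀ 0 b j
      rw [hS.base] at h1
      have hdx : dx (S a i b₀ 0) = Ψ * f a i := h.dx_sep (hS.isSEP_left a i)
      have hD : ∀ b j, act (Dinv * mono (g b j) 0 * lax τ V (r : ℕ)) (f a i) =
          dt (r : ℕ) (S a i b j) := fun b j => (h.dt_sep (hS.isSEP a i b j) r).symm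
      have h2 := hact a (i + 1) b j
      rw [hS.step, act_add_right, laxPow_eq] at h2
      rw [h.dt_sep (hS.isSEP a i b j), hQ, act_add_left, act_add_left, act_add_left,
        act_mul (isDiff_posPart _) (isDiff_posPart _), act_posPart (lax τ V (r : ℕ)),
        act_mul_integral (isDiff_posPart _) _ _ hdx, h1, hD, act_sum_left]
      simp only [act_mono_mul, hD]
      -- The fitted relation removes the t_r-derivatives. The middle terms, reindexed by m + 1,
      -- belong to the sum for n + 1; the others are absorbed by the inductive formulas for L(f) and
      -- for Φ.
      have h3 : ∀ m ∈ Finset.range n, S a₀ (n - 1 - m) b j * dt (r : ℕ) (S a i b₀ m) =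
          S a₀ (n - 1 - m) b j * S a (i + 1) b₀ m - S a₀ (n - 1 - m) b j * S a i b₀ (m + 1) -
            S a₀ (n - 1 - m) b j * S a₀ 0 b₀ m * S a i b₀ 0 := fun m _ => by
        rw [hS.compatible' hL a i b₀ m]; ring
      rw [Finset.sum_congr rfl h3, Finset.sum_sub_distrib, Finset.sum_sub_distrib,
        Finset.sum_range_succ', ← Finset.sum_mul]
      have h4 := ih2 a (i + 1) b j
      have h5 := ih2 a₀ 0 b j
      have h6 := hS.compatible' hL a i b (j + n)
      rw [zero_add] at h5
      simp only [Nat.add_sub_cancel, Nat.sub_zero, hidx]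
      rw [show i + (n + 1) = i + 1 + n by ring, ← add_assoc j]
      linear_combination h2 + h4 - S a i b₀ 0 * h5 - h6

end IsSEPSystem

end Constrained

end

section

open PowerSeries (coeff mk coeff_mk coeff_mul X)
open Finset.HasAntidiagonal

/-! ### Formal sums over the times -/

/-- Every monomial occurs in only finitely many members of the family. -/
def FSummable (c : ℕ+ → Fn K) : Prop :=
  ∀ m : ℕ+ →₀ ℕ, Function.HasFiniteSupport fun l => MvPowerSeries.coeff m (c l)

theorem fn_ext {f g : Fn K} (h : ∀ m, MvPowerSeries.coeff m f = MvPowerSeries.coeff m g) : f = g :=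
  MvPowerSeries.ext h

theorem coeff_formalSum (c : ℕ+ → Fn K) (m : ℕ+ →₀ ℕ) :
    MvPowerSeries.coeff m (formalSum c) = ∑ᶠ l, MvPowerSeries.coeff m (c l) := rfl

theorem fsummable_time_mul (a : ℕ+ →₀ K) (c : ℕ+ → Fn K) : FSummable fun l => time a l * c l :=
  time_mul_summable a c

theorem fsummable_of_support {c : ℕ+ → Fn K} {s : Finset ℕ+} (h : ∀ l, c l ≠ 0 → l ∈ s) :
    FSummable c := fun m => (Finset.finite_toSet s).subset fun l hl => h l fun h0 => hl (by simp [h0])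

namespace FSummable

variable {c d : ℕ+ → Fn K}

theorem add (hc : FSummable c) (hd : FSummable d) : FSummable fun l => c l + d l := fun m =>
  ((hc m).union (hd m)).subset fun l hl => by
    by_contra h
    simp only [Set.mem_union, Function.mem_support, not_or, not_not] at h
    exact hl (by simp [h.1, h.2])

theorem smul (hc : FSummable c) (k : ℕ+ → K) : FSummable fun l => k l • c l := fun m =>
  (hc m).subset fun l hl h => hl (by
    show MvPowerSeries.coeff m (k l • c l) = 0
    rw [MvPowerSeries.coeff_smul, show MvPowerSeries.coeff m (c l) = 0 from h, mul_zero])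

theorem mul_right (hc : FSummable c) (f : Fn K) : FSummable fun l => c l * f := fun m => by
  classical
  refine ((Finset.HasAntidiagonal.antidiagonal m).finite_toSet.biUnion fun p _ => hc p.1).subset fun l hl => ?_
  by_contra h
  simp only [Set.mem_iUnion, Function.mem_support, not_exists, not_not] at h
  refine hl ?_
  simp only [MvPowerSeries.coeff_mul]
  exact Finset.sum_eq_zero fun p hp => by rw [h p hp, zero_mul]

theorem dt (hc : FSummable c) (n : ℤ) : FSummable fun l => KP.dt n (c l) := fun m => by
  rcases le_or_gt n 0 with hn | hn
  · exact Set.finite_empty.subset fun l hl => hl (by simp [dt_nonpos hn])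
  · obtain ⟨n, rfl⟩ := exists_pnat_of_pos hn
    refine (hc (m + Finsupp.single n 1)).subset fun l hl h => hl ?_
    simp only [dt_pos, MvPowerSeries.coeff_pderiv]
    rw [show MvPowerSeries.coeff (m + Finsupp.single n 1) (c l) = 0 from h, zero_mul]

theorem sum {ι : Type*} {s : Finset ι} {c : ι → ℕ+ → Fn K} (hc : ∀ i ∈ s, FSummable (c i)) :
    FSummable fun l => ∑ i ∈ s, c i l := by
  classical
  induction s using Finset.induction_on with
  | empty => exact fun m => Set.finite_empty.subset fun l hl => hl (by simp)
  | insert i s hi ih =>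
    simp only [Finset.sum_insert hi]
    exact (hc i (Finset.mem_insert_self i s)).add
      (ih fun j hj => hc j (Finset.mem_insert_of_mem hj))

theorem schurShift (hc : FSummable c) (n : ℕ) : FSummable fun l => KP.schurShift n (c l) := by
  induction n using Nat.strong_induction_on with
  | _ n ih =>
    rcases n with _ | n
    · simpa only [KP.schurShift] using hc
    · simp only [KP.schurShift, ← neg_smul]
      exact FSummable.smul (sum fun i _ => (ih _ (by omega)).dt _) fun _ => _

end FSummable

section FormalSum

variable {c d : ℕ+ → Fn K}

theorem formalSum_add (hc : FSummable c) (hd : FSummable d) :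
    formalSum (fun l => c l + d l) = formalSum c + formalSum d := fn_ext fun m => by
  rw [map_add]
  simp only [coeff_formalSum, map_add]
  exact finsum_add_distrib (hc m) (hd m)

theorem formalSum_smul (k : K) : formalSum (fun l => k • c l) = k • formalSum c :=
  fn_ext fun m => by
    simp only [coeff_formalSum, MvPowerSeries.coeff_smul, mul_finsum]

theorem formalSum_sum {ι : Type*} {s : Finset ι} {c : ι → ℕ+ → Fn K}
    (hc : ∀ i ∈ s, FSummable (c i)) :
    formalSum (fun l => ∑ i ∈ s, c i l) = ∑ i ∈ s, formalSum (c i) := fn_ext fun m => by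
  rw [map_sum]
  simp only [coeff_formalSum, map_sum]
  exact finsum_sum_comm s _ fun i hi => hc i hi m

theorem formalSum_mul (hc : FSummable c) (f : Fn K) :
    formalSum (fun l => c l * f) = formalSum c * f := fn_ext fun m => by
  classical
  rw [MvPowerSeries.coeff_mul]
  simp only [coeff_formalSum, MvPowerSeries.coeff_mul, finsum_mul]
  refine finsum_sum_comm _ _ fun p _ => (hc p.1).subset fun l hl h => hl ?_
  show MvPowerSeries.coeff p.1 (c l) * MvPowerSeries.coeff p.2 f = 0
  rw [show MvPowerSeries.coeff p.1 (c l) = 0 from h, zero_mul]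

theorem dt_formalSum (n : ℤ) : dt n (formalSum c) = formalSum fun l => dt n (c l) := by
  rcases le_or_gt n 0 with hn | hn
  · refine fn_ext fun m => ?_
    simp [dt_nonpos hn, coeff_formalSum]
  · obtain ⟨n, rfl⟩ := exists_pnat_of_pos hn
    refine fn_ext fun m => ?_
    rw [dt_pos, MvPowerSeries.coeff_pderiv, coeff_formalSum, coeff_formalSum, finsum_mul]
    simp only [dt_pos, MvPowerSeries.coeff_pderiv]

theorem schurShift_formalSum (hc : FSummable c) (n : ℕ) :
    schurShift n (formalSum c) = formalSum fun l => schurShift n (c l) := by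
  induction n using Nat.strong_induction_on with
  | _ n ih =>
    rcases n with _ | n
    · simp only [schurShift]
    · simp only [schurShift, ← neg_smul]
      rw [formalSum_smul, formalSum_sum fun i _ => (hc.schurShift _).dt _]
      congr 1
      refine Finset.sum_congr rfl fun i _ => ?_
      rw [ih _ (by omega), dt_formalSum]

theorem formalSum_eq_sum {s : Finset ℕ+} (h : ∀ l, c l ≠ 0 → l ∈ s) :
    formalSum c = ∑ l ∈ s, c l := fn_ext fun m => by
  rw [coeff_formalSum, map_sum]
  exact finsum_eq_sum_of_support_subset _ fun l hl => h l fun h0 => hl (by simp [h0])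

/-- A formal sum over `l ≤ n`. -/
theorem formalSum_le (F : ℕ → Fn K) (n : ℕ) :
    formalSum (fun l : ℕ+ => if (l : ℕ) ≤ n then F l else 0) =
      ∑ j ∈ Finset.range n, F (j + 1) := by
  rw [formalSum_eq_sum (s := (Finset.range n).map ⟨Nat.succPNat, Nat.succPNat_injective⟩),
    Finset.sum_map]
  · refine Finset.sum_congr rfl fun j hj => ?_
    rw [Finset.mem_range] at hj
    rw [Function.Embedding.coeFn_mk, Nat.succPNat_coe, if_pos (by omega)]
  · intro l hl
    have h1 : (l : ℕ) ≤ n := by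
      by_contra h
      exact hl (if_neg h)
    refine Finset.mem_map.mpr ⟨l.natPred, Finset.mem_range.mpr ?_, PNat.succPNat_natPred l⟩
    have := PNat.natPred_add_one l
    omega

/-- The orders are bounded uniformly in l, so each coefficient of the products is a sum over one
finite index set, which may be exchanged with the formal sum. -/
theorem formalSum_mul_coe {A : ℕ+ → PDO K} {F B : PDO K} {M N : ℤ} (hA : ∀ l, OrdLE (A l) M)
    (hB : OrdLE B N) (hs : ∀ j, FSummable fun l => (A l).1 j)
    (hF : ∀ j, F.1 j = formalSum fun l => (A l).1 j) (n : ℤ) :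
    (F * B).1 n = formalSum fun l => (A l * B).1 n := by
  have hFo : OrdLE F M := fun j hj => by
    rw [hF]
    refine fn_ext fun m => ?_
    simp [coeff_formalSum, hA _ j hj]
  have h1 : ∀ l, (A l * B).1 n = _ := fun l =>
    (mul_coe (A l) B n).trans (finsum_eq_sum_of_support_subset _ (mul_support (hA l) hB n))
  have h2 : ∀ (z : ℤ) (f : Fn K), z • f = ((z : ℤ) : K) • f := fun z f => by
    rw [Int.cast_smul_eq_zsmul]
  simp only [h1]
  rw [mul_coe, finsum_eq_sum_of_support_subset _ (mul_support hFo hB n), formalSum_sum]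
  · refine Finset.sum_congr rfl fun p _ => ?_
    simp only [h2]
    rw [formalSum_smul, formalSum_mul (hs _), hF]
  · intro p _
    simp only [h2]
    exact ((hs _).mul_right _).smul fun _ => _

end FormalSum

end

section

open PowerSeries (coeff mk coeff_mk coeff_mul X)
open Finset.HasAntidiagonal

/-! ### The Virasoro flows of the KP hierarchy -/

theorem mul_mono_zero_coe {t : Fn K} (ht : dx (dx t) = 0) (A : PDO K) (n : ℤ) :
    (A * mono t 0).1 n = t * A.1 n + (n + 1) • (A.1 (n + 1) * dx t) := by
  rw [mul_coe, finsum_eq_sum_of_support_subset (s := {(n, 0), (n + 1, 1)})]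
  · rw [Finset.sum_pair (by simp)]
    simp [coe_mono, mul_comm t]
  · rintro ⟨p, l⟩ h
    rcases l with _ | _ | l
    · have : n = p := by
        by_contra hp
        refine h ?_
        simp [coe_mono, sub_eq_zero, hp]
      simp [this]
    · have : p = n + 1 := by
        by_contra hp
        refine h ?_
        simp [coe_mono, show n - p + 1 ≠ 0 by omega]
      simp [this]
    · refine absurd ?_ h
      have h0 : ∀ l : ℕ, dx^[l] (0 : Fn K) = 0 := fun l => by
        induction l with
        | zero => rfl
        | succ l ih => rw [Function.iterate_succ_apply', ih]; simp [dx]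
      simp only [coe_mono]
      split_ifs <;> simp [ht, h0]

theorem dx_time (a : ℕ+ →₀ K) (l : ℕ+) : dx (time a l) = if l = 1 then 1 else 0 := by
  have := dt_time a 1 l
  rw [PNat.one_coe, Nat.cast_one, dt_one] at this
  rw [this]
  exact if_congr eq_comm rfl rfl

/-- The commutator of an operator with `x = t₁`. -/
def timeComm (a : ℕ+ →₀ K) (A : PDO K) : PDO K :=
  A * mono (time a 1) 0 - mono (time a 1) 0 * A

/-- Only t₁ depends on x, so every other time passes through an operator unchanged. -/
theorem mul_mono_time (a : ℕ+ →₀ K) (A : PDO K) (l : ℕ+) : A * mono (time a l) 0 =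
    mono (time a l) 0 * A + if l = 1 then timeComm a A else 0 := by
  split_ifs with h
  · rw [h, timeComm]; abel
  · ext1 n
    rw [mul_mono_zero_coe (by rw [dx_time, if_neg h]; simp [dx]), dx_time, if_neg h, mul_zero,
      smul_zero, add_zero, add_zero, mono_zero_mul_coe]

theorem timeComm_coe (a : ℕ+ →₀ K) (A : PDO K) (n : ℤ) :
    (timeComm a A).1 n = (n + 1) • A.1 (n + 1) := by
  rw [timeComm, coe_sub', mul_mono_zero_coe (by rw [dx_time, if_pos rfl, ← dt_one, dt_one_fn]),
    dx_time, if_pos rfl, mul_one, mono_zero_mul_coe, add_sub_cancel_left]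

/-- The variation of `τ(t - [z])` minus the one that keeps the dressing operator fixed. -/
def variation (τ δ : Fn K) : Ser K := shift δ - wave τ * PowerSeries.C δ

section CharZero

variable [CharZero K]

theorem variation_add (τ δ ε : Fn K) : variation τ (δ + ε) = variation τ δ + variation τ ε := by
  simp only [variation, shift_add, map_add]; ring

theorem variation_sub (τ δ ε : Fn K) : variation τ (δ - ε) = variation τ δ - variation τ ε := by
  simp only [variation, shift_sub, map_sub]; ring

theorem variation_smul (τ : Fn K) (c : K) (δ : Fn K) :
    variation τ (c • δ) = PowerSeries.C (MvPowerSeries.C c) * variation τ δ := by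
  rw [variation, shift_smul, MvPowerSeries.smul_eq_C_mul, map_mul, variation]; ring

theorem variation_sum {ι : Type*} (τ : Fn K) (s : Finset ι) (δ : ι → Fn K) :
    variation τ (∑ i ∈ s, δ i) = ∑ i ∈ s, variation τ (δ i) := by
  simp only [variation, shift_sum, map_sum, Finset.mul_sum, Finset.sum_sub_distrib]

omit [CharZero K] in
theorem ordLE_dressingVariation (τ δ : Fn K) : OrdLE (dressingVariation τ δ) 0 :=
  fun n hn => if_neg (by omega)

/-- A series `∑_j c_j D^j`, `c_j = ∑_l l t_l A_l,j`, where the `A_l` have negative order. -/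
def timeSeries (a : ℕ+ →₀ K) (A : ℕ+ → PDO K) : PDO K :=
  negPart fun j => formalSum fun l => ((l : ℕ) : K) • (time a l * (A l).1 j)

/-- `∑_j z^n ∂_{j+1+s} τ_{n-1-j}`, where `τ(t - [z]) = ∑ z^n τ_n`. -/
def nablaTail (s : ℤ) (τ : Fn K) : Ser K := mk fun n =>
  ∑ j ∈ Finset.range n, dt ((j : ℤ) + 1 + s) (schurShift (n - 1 - j) τ)

namespace IsKP

variable {τ : Fn K} {V : PDO K} (h : IsKP τ V)
include h

omit [CharZero K] in
theorem sym_dressingVariation (δ : Fn K) :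
    sym 0 (dressingVariation τ δ) * PowerSeries.C τ = variation τ δ := by
  refine ser_ext fun n => ?_
  rw [PowerSeries.coeff_mul_C, coeff_sym, variation, map_sub, PowerSeries.coeff_mul_C, coeff_shift,
    coeff_wave]
  have : (dressingVariation τ δ).1 (0 - (n : ℤ)) =
      schurShift n δ * τ⁻¹ - schurShift n τ * δ * (τ⁻¹) ^ 2 := by
    simp [dressingVariation]
  rw [this]
  linear_combination (schurShift n δ - schurShift n τ * δ * τ⁻¹) * h.tau_mul_inv

/-- Vanishing means that δ/τ is fixed by the shift, hence constant. -/
theorem variation_eq_zero_iff (δ : Fn K) : variation τ δ = 0 ↔ ∃ c : K, δ = c • τ := by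
  constructor
  · intro h0
    have h1 : δ = (δ * τ⁻¹) * τ := by rw [mul_assoc, mul_comm τ⁻¹, h.tau_mul_inv, mul_one]
    refine ⟨MvPowerSeries.constantCoeff (δ * τ⁻¹), (h1.trans ?_).trans (MvPowerSeries.smul_eq_C_mul _ _).symm⟩
    congr 1
    refine eq_C_of_shift_eq ?_
    have h2 : shift (δ * τ⁻¹) * shift τ = PowerSeries.C (δ * τ⁻¹) * shift τ := by
      rw [← shift_mul, ← h1, ← h.wave_mul_tau, mul_left_comm, ← map_mul, ← h1]
      exact sub_eq_zero.mp h0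
    refine mul_right_cancel₀ (fun h3 => h.tau_ne_zero' ?_) h2
    rw [← coeff_zero_shift τ, h3, map_zero]
  · rintro ⟨c, rfl⟩
    rw [variation, shift_smul, ← h.wave_mul_tau, MvPowerSeries.smul_eq_C_mul, map_mul]
    ring

omit [CharZero K] in
theorem C_tau_ne_zero : PowerSeries.C τ ≠ 0 := by
  rw [Ne, map_eq_zero_iff _ PowerSeries.C_injective]
  exact h.tau_ne_zero'

/-- One solution η gives all: comparing symbols reduces the claim to the kernel of `variation τ`,
the multiples of τ. -/
theorem eq_dressingVariation_iff {A : PDO K} (hA : OrdLE A 0) {η : Fn K}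
    (hη : sym 0 A * PowerSeries.C τ = variation τ η) (δ : Fn K) :
    A = dressingVariation τ δ ↔ ∃ c : K, δ = η + c • τ := by
  have h1 : A = dressingVariation τ δ ↔ variation τ (δ - η) = 0 := by
    rw [variation_sub, sub_eq_zero, ← hη, ← h.sym_dressingVariation]
    exact ⟨fun e => by rw [e], fun e => sym_injective hA (ordLE_dressingVariation τ δ)
      (mul_right_cancel₀ h.C_tau_ne_zero e).symm⟩
  rw [h1, h.variation_eq_zero_iff]
  simp only [sub_eq_iff_eq_add']

theorem variation_dt (n : ℤ) : variation τ (dt n τ) = dtS n (wave τ) * PowerSeries.C τ := by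
  rw [variation, shift_dt, ← h.wave_mul_tau, dtS_mul, dtS_C]
  ring

theorem variation_dt_dt (m n : ℤ) : variation τ (dt m (dt n τ)) =
    (dtS m (dtS n (wave τ)) + PowerSeries.C (theta τ m) * dtS n (wave τ) +
      PowerSeries.C (theta τ n) * dtS m (wave τ)) * PowerSeries.C τ := by
  rw [variation, shift_dt, shift_dt, ← h.wave_mul_tau, dtS_mul, dtS_add, dtS_mul, dtS_mul,
    dtS_C, dtS_C, dtS_C, ← h.theta_mul_tau m, ← h.theta_mul_tau n, map_mul, map_mul]
  ring

omit [CharZero K] in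
/-- The negative part of `(a+b+1) L^{a+b}` from the parts of the factors. -/
theorem sum_npart_lax (s : ℕ) : ((s : K) + 1) • npart (lax τ V s) =
    ∑ p ∈ antidiagonal s, (npart (npart (lax τ V (p.1 : ℕ)) * lax τ V (p.2 : ℕ)) +
      npart (lax τ V (p.1 : ℕ) * npart (lax τ V (p.2 : ℕ))) -
        npart (lax τ V (p.1 : ℕ)) * npart (lax τ V (p.2 : ℕ))) := by
  -- Every decomposition i + j = s gives the same operator, the negative part of L^{s/r}, and there
  -- are s + 1 of them.
  have h1 : ∀ p ∈ antidiagonal s, npart (npart (lax τ V (p.1 : ℕ)) * lax τ V (p.2 : ℕ)) +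
      npart (lax τ V (p.1 : ℕ) * npart (lax τ V (p.2 : ℕ))) -
        npart (lax τ V (p.1 : ℕ)) * npart (lax τ V (p.2 : ℕ)) = npart (lax τ V s) := by
    rintro ⟨i, j⟩ hp
    rw [mem_antidiagonal] at hp
    dsimp only at hp ⊢
    have e : ∀ n : ℕ, lax τ V n = posPart (lax τ V n) + npart (lax τ V n) := fun n =>
      (posPart_add_npart _).symm
    have hd := npart_of_isDiff ((isDiff_posPart (lax τ V (i : ℤ))).mul
      (isDiff_posPart (lax τ V (j : ℤ))))
    have hn := npart_of_ordLE ((ordLE_negPart (lax τ V (i : ℤ)).1).mul'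
      (ordLE_negPart (lax τ V (j : ℤ)).1) (by omega : (-1 : ℤ) + -1 ≤ -1))
    rw [← hp, Nat.cast_add, ← h.lax_mul]
    generalize hLi : lax τ V (i : ℤ) = Li at *
    generalize hLj : lax τ V (j : ℤ) = Lj at *
    have e1 : npart (npart Li * Lj) = npart (npart Li * posPart Lj) + npart (npart Li * npart Lj) := by
      rw [← npart_add, ← mul_add, posPart_add_npart]
    have e2 : npart (Li * npart Lj) = npart (posPart Li * npart Lj) + npart (npart Li * npart Lj) := by
      rw [← npart_add, ← add_mul, posPart_add_npart]
    have e3 : npart (Li * Lj) = npart (posPart Li * npart Lj) + npart (npart Li * Lj) := by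
      rw [← npart_add, ← zero_add (npart (_ + _)), ← hd, ← npart_add, ← add_assoc, ← mul_add,
        posPart_add_npart, ← add_mul, posPart_add_npart]
    rw [e2, e3, hn]
    abel
  rw [Finset.sum_congr rfl h1, Finset.sum_const, Finset.Nat.card_antidiagonal, ← Nat.cast_smul_eq_nsmul K]
  push_cast
  rfl

omit [CharZero K] in
theorem dtP_npart_lax (a b : ℕ) : dtP a (npart (lax τ V b)) =
    npart (lax τ V b * npart (lax τ V a)) - npart (npart (lax τ V a) * lax τ V b) := by
  rw [dtP_npart, h.dtP_lax, npart_sub]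

/-- Write L_i for L^{i/r}, and let Y, Z, U be the sums over i + j = s of ((L_i)₋ L_j)₋, (L_i
(L_j)₋)₋ and (L_i)₋ (L_j)₋. The Sato equations give Σ ∂_i ∂_j W = (Y - Z + U) W, and `sum_npart_lax`
gives (s + 1)(L_s)₋ = Y + Z - U; adding them isolates 2Y. -/
theorem sum_npart_npart_lax (s : ℕ) :
    (∑ p ∈ antidiagonal s, npart (npart (lax τ V (p.1 : ℕ)) * lax τ V (p.2 : ℕ))) * dressing τ =
      (2 : K)⁻¹ • ∑ p ∈ antidiagonal s, dtP (p.1 : ℕ) (dtP (p.2 : ℕ) (dressing τ)) -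
        (((s : K) + 1) / 2) • dtP s (dressing τ) := by
  have h1 : ∀ a b : ℕ, dtP a (dtP b (dressing τ)) =
      (npart (npart (lax τ V a) * lax τ V b) - npart (lax τ V b * npart (lax τ V a)) +
        npart (lax τ V b) * npart (lax τ V a)) * dressing τ := fun a b => by
    rw [h.dtP_dressing b, dtP_neg, dtP_mul, h.dtP_npart_lax, h.dtP_dressing a]
    noncomm_ring
  have h2 : ∀ F : ℕ → ℕ → PDO K, ∑ p ∈ antidiagonal s, F p.2 p.1 =
      ∑ p ∈ antidiagonal s, F p.1 p.2 := fun F => by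
    exact Finset.Nat.sum_antidiagonal_swap (f := fun p : ℕ × ℕ => F p.1 p.2)
  have h3 := h.sum_npart_lax s
  simp only [h1, ← Finset.sum_mul]
  rw [h.dtP_dressing s, Finset.sum_add_distrib, Finset.sum_sub_distrib,
    h2 fun a b => npart (lax τ V (a : ℕ) * npart (lax τ V (b : ℕ))),
    h2 fun a b => npart (lax τ V (a : ℕ)) * npart (lax τ V (b : ℕ)), smul_neg, sub_neg_eq_add,
    div_eq_inv_mul, mul_smul, ← pdo_smul_mul ((s : K) + 1), h3, ← smul_add, ← add_mul,
    Finset.sum_sub_distrib, Finset.sum_add_distrib]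
  generalize (∑ p ∈ antidiagonal s, npart (npart (lax τ V (p.1 : ℕ)) * lax τ V (p.2 : ℕ))) = Y
  rw [show ∀ Z U : PDO K, Y - Z + U + (Y + Z - U) = (2 : K) • Y from fun Z U => by
    rw [two_smul]; abel, pdo_smul_mul, smul_smul, inv_mul_cancel₀ two_ne_zero, one_smul]

end IsKP

end CharZero

end

/-! ### The commutator term [W, x] D^{1+s} W⁻¹ and the assembled KP Virasoro flow -/

section

open PowerSeries (coeff mk coeff_mk coeff_mul X)
open Finset.HasAntidiagonal

/-- The antidiagonal also contains the endpoints, where F vanishes; in the applications this is ∂₀ =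
0. -/
theorem sum_Icc_eq_sum_antidiagonal {M : Type*} [AddCommMonoid M] (s : ℕ) (F : ℤ → ℤ → M)
    (h1 : ∀ m, F 0 m = 0) (h2 : ∀ m, F m 0 = 0) :
    ∑ l ∈ Finset.Icc 1 ((s : ℤ) - 1), F l (s - l) =
      ∑ p ∈ antidiagonal s, F (p.1 : ℕ) (p.2 : ℕ) := by
  refine Finset.sum_of_injOn (fun l => (l.toNat, ((s : ℤ) - l).toNat)) ?_ ?_ ?_ ?_
  · intro x hx y hy hxy
    simp only [Finset.coe_Icc, Set.mem_Icc, Prod.mk.injEq] at hx hy hxy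
    omega
  · intro x hx
    simp only [Finset.coe_Icc, Set.mem_Icc] at hx
    simp only [SetLike.mem_coe, mem_antidiagonal]
    omega
  · rintro ⟨i, j⟩ hp hn
    rw [mem_antidiagonal] at hp
    dsimp only at hp ⊢
    rcases Nat.eq_zero_or_pos i with rfl | hi
    · exact h1 _
    rcases Nat.eq_zero_or_pos j with rfl | hj
    · exact h2 _
    refine absurd ⟨(i : ℤ), ?_, ?_⟩ hn
    · simp only [Finset.coe_Icc, Set.mem_Icc]
      omega
    · simp only [Prod.mk.injEq]
      omega
  · intro l hl
    rw [Finset.mem_Icc] at hl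
    dsimp only
    rw [Int.toNat_of_nonneg (by omega), Int.toNat_of_nonneg (by omega)]

theorem sym_smul (N : ℤ) (c : K) (A : PDO K) :
    sym N (c • A) = PowerSeries.C (MvPowerSeries.C c) * sym N A := by
  rw [smul_eq_mono_mul, sym_mono_mul]

theorem sym_dressing (τ : Fn K) : sym 0 (dressing τ) = wave τ := rfl

theorem sum_antidiagonal_comm {M : Type*} [AddCommMonoid M] (s : ℕ) (F : ℕ → ℕ → M) :
    ∑ p ∈ antidiagonal s, F p.2 p.1 = ∑ p ∈ antidiagonal s, F p.1 p.2 :=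
  Finset.Nat.sum_antidiagonal_swap (f := fun p : ℕ × ℕ => F p.1 p.2)

section CharZero

variable [CharZero K] {τ : Fn K} {V : PDO K} (a : ℕ+ →₀ K)

omit [CharZero K] in
theorem ordLE_timeComm (τ : Fn K) : OrdLE (timeComm a (dressing τ)) (-1) := fun n hn => by
  rw [timeComm_coe, ordLE_dressing τ _ (by omega), smul_zero]

/-- `nabla` annihilates τ(t - [z]), so stopping after the first s times leaves minus the omitted
terms. -/
theorem neg_coeff_nablaTrunc_shift (s n : ℕ) (τ : Fn K) :
    -coeff (n + s) (nablaTrunc s (shift τ)) = coeff n (nablaTail s τ) := by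
  have h1 := coeff_nablaTrunc (le_refl (n + s)) (shift τ)
  have h2 : nablaTrunc (n + s) (shift τ) = nablaTrunc s (shift τ) +
      ∑ j ∈ Finset.range n, X ^ (s + j + 1) * dtS (((s + j : ℕ) : ℤ) + 1) (shift τ) := by
    rw [nablaTrunc, add_comm n, Finset.sum_range_add, ← add_assoc, ← nablaTrunc]
  rw [nabla_shift, map_zero, h2, map_add] at h1
  rw [neg_eq_of_add_eq_zero_right h1, map_sum, nablaTail, coeff_mk]
  refine Finset.sum_congr rfl fun j hj => ?_
  rw [Finset.mem_range] at hj
  rw [PowerSeries.coeff_X_pow_mul', if_pos (by omega), coeff_dtS, coeff_shift,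
    show n + s - (s + j + 1) = n - 1 - j by omega]
  congr 1
  push_cast
  ring

omit [CharZero K] in
-- Bracketing with x differentiates the symbol in λ = z⁻¹, and λ∂_λ = -z∂_z.
theorem sym_timeComm : sym (-1) (timeComm a (dressing τ)) = -euler (wave τ) := by
  refine ser_ext fun n => ?_
  rw [coeff_sym, timeComm_coe, map_neg, coeff_euler, wave, coeff_sym,
    show (-1 - (n : ℤ) + 1) = -n by ring, zero_sub]
  simp

omit [CharZero K] in
theorem euler_mul_C (G : Ser K) (f : Fn K) :
    euler (G * PowerSeries.C f) = euler G * PowerSeries.C f := by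
  refine ser_ext fun n => ?_
  rw [coeff_euler, PowerSeries.coeff_mul_C, PowerSeries.coeff_mul_C, coeff_euler, mul_assoc]

/-- `∑_{i+j=s} (∂_i W + θ_i W) D^j`. -/
def flowSum (τ : Fn K) (s : ℕ) : PDO K := ∑ p ∈ antidiagonal s,
  (dtP (p.1 : ℕ) (dressing τ) + mono (theta τ (p.1 : ℕ)) 0 * dressing τ) * mono 1 (p.2 : ℕ)

namespace IsKP

variable (h : IsKP τ V)
include h

omit [CharZero K] in
theorem dtS_shift_tau (n : ℤ) : dtS n (shift τ) =
    (dtS n (wave τ) + PowerSeries.C (theta τ n) * wave τ) * PowerSeries.C τ := by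
  rw [← h.wave_mul_tau, dtS_mul, dtS_C, ← h.theta_mul_tau, map_mul]
  ring

omit [CharZero K] h in
theorem ordLE_flowSum_term (i j : ℕ) :
    OrdLE ((dtP i (dressing τ) + mono (theta τ i) 0 * dressing τ) * mono 1 (j : ℤ)) j :=
  (((ordLE_dressing τ).dtP _).add ((ordLE_dressing τ).mono_mul _)).mul' (ordLE_mono _ _) (by omega)

omit [CharZero K] in
-- The summand θ_i W completes the derivative: (∂_i w + θ_i w)τ = ∂_i τ(t - [z]).
theorem sym_flowSum (s : ℕ) : sym s (flowSum τ s) * PowerSeries.C τ =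
    ∑ l ∈ Finset.range s, X ^ (l + 1) * dtS ((l : ℤ) + 1) (shift τ) := by
  have h1 : ∀ p ∈ antidiagonal s,
      sym s ((dtP (p.1 : ℕ) (dressing τ) + mono (theta τ (p.1 : ℕ)) 0 * dressing τ) *
        mono 1 (p.2 : ℕ)) * PowerSeries.C τ = X ^ p.1 * dtS (p.1 : ℕ) (shift τ) := by
    rintro ⟨i, j⟩ hp
    rw [mem_antidiagonal] at hp
    dsimp only at hp ⊢
    have h2 := sym_add_nat (((ordLE_dressing τ).dtP i).add
      ((ordLE_dressing τ).mono_mul (theta τ i))) i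
    rw [zero_add] at h2
    rw [sym_mul_mono_one, ← hp, Nat.cast_add, add_sub_cancel_right, h2, h.dtS_shift_tau, sym_add,
      sym_dtP, sym_mono_mul, sym_dressing]
    ring
  rw [flowSum, sym_sum, Finset.sum_mul, Finset.sum_congr rfl h1,
    Finset.Nat.sum_antidiagonal_eq_sum_range_succ_mk, Finset.sum_range_succ']
  simp

omit [CharZero K] in
theorem sym_timeComm_sub_flowSum (s : ℕ) :
    sym s (timeComm a (dressing τ) * mono 1 (1 + s) - flowSum τ s) * PowerSeries.C τ =
      -nablaTrunc s (shift τ) := by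
  rw [sym_sub, sub_mul, h.sym_flowSum, sym_mul_mono_one, show (s : ℤ) - (1 + s) = -1 by ring,
    sym_timeComm, neg_mul, ← euler_mul_C, h.wave_mul_tau, nablaTrunc]
  ring

/-- Up to z^s the symbol, times τ, is -`nabla` of τ(t - [z]), which is zero; so `flowSum` cancels
all nonnegative orders of [W, x] D^{1+s}. -/
theorem ordLE_timeComm_sub_flowSum (s : ℕ) :
    OrdLE (timeComm a (dressing τ) * mono 1 (1 + s) - flowSum τ s) (-1) := by
  have h1 : OrdLE (timeComm a (dressing τ) * mono 1 (1 + s) - flowSum τ s) s := by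
    refine ((ordLE_timeComm a τ).mul' (ordLE_mono _ _) (by omega)).sub (OrdLE.sum fun p hp => ?_)
    rw [mem_antidiagonal] at hp
    exact (ordLE_flowSum_term p.1 p.2).le (by omega)
  refine (ordLE_of_dvd (k := s + 1) h1 ?_).le (by omega)
  rw [PowerSeries.X_pow_dvd_iff]
  intro m hm
  have h2 := congrArg (coeff m) (h.sym_timeComm_sub_flowSum a s)
  rw [PowerSeries.coeff_mul_C, map_neg, coeff_nablaTrunc (by omega), nabla_shift, map_zero,
    neg_zero] at h2
  exact (mul_eq_zero.mp h2).resolve_right h.tau_ne_zero'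

theorem sym_zero_timeComm_sub_flowSum (s : ℕ) :
    sym 0 (timeComm a (dressing τ) * mono 1 (1 + s) - flowSum τ s) * PowerSeries.C τ =
      nablaTail s τ := by
  refine ser_ext fun n => ?_
  have h2 := congrArg (coeff (n + s)) (h.sym_timeComm_sub_flowSum a s)
  rw [map_neg, neg_coeff_nablaTrunc_shift, PowerSeries.coeff_mul_C, coeff_sym] at h2
  rw [← h2, PowerSeries.coeff_mul_C, coeff_sym]
  rw [show (s : ℤ) - ((n + s : ℕ) : ℤ) = 0 - n by push_cast; ring]

/-- The difference with `flowSum` is already negative and survives multiplication by W⁻¹. In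
`flowSum` itself ∂_i W = -(L^{i/r})₋ W, which leads to the sum evaluated in `sum_npart_npart_lax`;
the θ-terms follow from Sato. -/
theorem npart_timeComm (s : ℕ) :
    npart (timeComm a (dressing τ) * mono 1 (1 + s) * V) * dressing τ =
      timeComm a (dressing τ) * mono 1 (1 + s) - flowSum τ s -
        ∑ p ∈ antidiagonal s, mono (theta τ (p.1 : ℕ)) 0 * dtP (p.2 : ℕ) (dressing τ) -
        ((2 : K)⁻¹ • ∑ p ∈ antidiagonal s, dtP (p.1 : ℕ) (dtP (p.2 : ℕ) (dressing τ)) -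
          (((s : K) + 1) / 2) • dtP s (dressing τ)) := by
  set E := timeComm a (dressing τ) * mono 1 (1 + s) - flowSum τ s with hE
  have h1 : timeComm a (dressing τ) * mono 1 (1 + (s : ℤ)) * V = E * V + flowSum τ s * V := by
    rw [hE, sub_mul _ _ V, sub_add_cancel]
  have h2 : flowSum τ s * V = ∑ p ∈ antidiagonal s,
      (mono (theta τ (p.1 : ℕ)) 0 * lax τ V (p.2 : ℕ) -
        npart (lax τ V (p.1 : ℕ)) * lax τ V (p.2 : ℕ)) := by
    rw [flowSum, Finset.sum_mul]
    refine Finset.sum_congr rfl fun p _ => ?_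
    rw [h.dtP_dressing, lax, lax, neg_add_eq_sub, sub_mul, sub_mul]
    simp only [mul_assoc]
  have h3 := h.ordLE_timeComm_sub_flowSum a s
  rw [← hE] at h3
  rw [h1, npart_add, npart_of_ordLE (h3.mul' h.ordLE_inv (by omega)), h2, npart_sum, add_mul,
    mul_assoc, h.inv_mul, mul_one, ← h.sum_npart_npart_lax, sub_sub, sub_eq_add_neg]
  congr 1
  simp only [npart_sub, npart_mono_mul, Finset.sum_sub_distrib, sub_mul, Finset.sum_mul,
    h.dtP_dressing, mul_neg, Finset.sum_neg_distrib, mul_assoc]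
  abel

/-- The θ-terms occur once in the operator. In the variation they occur twice with weight 1/2, the
two sums being equal by the symmetry of i + j = s. -/
theorem sym_npart_timeComm_nat (s : ℕ) :
    sym 0 (npart (timeComm a (dressing τ) * mono 1 (1 + s) * V) * dressing τ) * PowerSeries.C τ =
      nablaTail s τ + variation τ ((((s : K) + 1) / 2) • dt s τ -
        (2 : K)⁻¹ • ∑ p ∈ antidiagonal s, dt (p.1 : ℕ) (dt (p.2 : ℕ) τ)) := by
  have h1 : (2 : K)⁻¹ + (2 : K)⁻¹ = 1 := by norm_num
  have h2 := congrArg (fun c : K => (PowerSeries.C (MvPowerSeries.C c : Fn K))) h1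
  simp only [map_add, map_one] at h2
  rw [h.npart_timeComm, sym_sub, sym_sub, sub_mul, sub_mul, h.sym_zero_timeComm_sub_flowSum,
    sym_sub, sym_smul, sym_smul, sym_sum, sym_sum, sym_dtP, variation_sub, variation_smul,
    variation_smul, variation_sum, h.variation_dt]
  simp only [h.variation_dt_dt, sym_dtP, sym_mono_mul, sym_dressing]
  rw [← Finset.sum_mul, Finset.sum_add_distrib, Finset.sum_add_distrib, sum_antidiagonal_comm s
    fun i j => PowerSeries.C (theta τ (i : ℕ)) * dtS (j : ℕ) (wave τ)]
  generalize (∑ p ∈ antidiagonal s, PowerSeries.C (theta τ (p.1 : ℕ)) * dtS (p.2 : ℕ) (wave τ)) = T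
  linear_combination (T * PowerSeries.C τ) * h2

/-- The negative part of `[W, x] D^{1+s} W⁻¹` as a variation of the tau-function. -/
theorem sym_npart_timeComm {s : ℤ} (hs : -1 ≤ s) :
    sym 0 (npart (timeComm a (dressing τ) * mono 1 (1 + s) * V) * dressing τ) * PowerSeries.C τ =
      nablaTail s τ + variation τ ((((s : K) + 1) / 2) • dt s τ -
        (2 : K)⁻¹ • ∑ l ∈ Finset.Icc 1 (s - 1), dt l (dt (s - l) τ)) := by
  -- For s = -1, the case k = 0 and r = 1, the operator [W, x] W⁻¹ is negative as it stands and the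
  -- second-order operator is empty.
  rcases eq_or_lt_of_le hs with rfl | hs
  · have h1 : OrdLE (timeComm a (dressing τ)) (-2) := by
      intro n hn
      rcases eq_or_lt_of_le (show -1 ≤ n by omega) with rfl | hn
      · simp [timeComm_coe]
      · exact ordLE_timeComm a τ n hn
    have h2 : variation τ 0 = 0 := by simp [variation, shift_zero]
    rw [add_neg_cancel, mono_one_zero, mul_one, npart_of_ordLE ((h1.mul' h.ordLE_inv (by omega))),
      mul_assoc, h.inv_mul, mul_one, dt_nonpos (by omega : (-1 : ℤ) ≤ 0), smul_zero,
      Finset.Icc_eq_empty (by omega), Finset.sum_empty, smul_zero, sub_zero, h2, add_zero]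
    refine ser_ext fun n => ?_
    rw [PowerSeries.coeff_mul_C, coeff_sym, nablaTail, coeff_mk]
    rcases n with _ | n
    · rw [h1 _ (by simp), zero_mul, Finset.sum_range_zero]
    · have h3 := congrArg (coeff n) (nabla_shift τ)
      rw [coeff_nabla, map_zero, ← h.wave_mul_tau, PowerSeries.coeff_mul_C, h.wave_mul_tau] at h3
      rw [Finset.sum_range_succ', timeComm_coe, wave, coeff_sym] at *
      simp only [Nat.cast_zero, zero_add, add_neg_cancel, dt_zero_index, add_zero, coeff_shift] at h3 ⊢
      rw [show (0 : ℤ) - (n + 1 : ℕ) + 1 = 0 - n by push_cast; ring, sub_smul, zero_smul, zero_sub,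
        natCast_zsmul, nsmul_eq_mul, neg_mul, mul_assoc, neg_eq_of_add_eq_zero_right h3]
      refine Finset.sum_congr rfl fun j _ => ?_
      rw [show n + 1 - 1 - (j + 1) = n - 1 - j by omega,
        show ((j + 1 : ℕ) : ℤ) + 1 + -1 = j + 1 by push_cast; ring]
  · lift s to ℕ using by omega
    rw [sum_Icc_eq_sum_antidiagonal s (fun l m => dt l (dt m τ)) (by simp) (by simp)]
    rw [Int.cast_natCast]
    exact h.sym_npart_timeComm_nat a s

end IsKP

/-- The second-order operator `∑_l l t_l ∂_{l+s} - (s+1)/2 ∂_s + 1/2 ∑_l ∂_l ∂_{s-l}`. -/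
def kpVirasoro (s : ℤ) (τ : Fn K) : Fn K :=
  formalSum (fun l : ℕ+ => ((l : ℕ) : K) • (time a l * dt ((l : ℤ) + s) τ)) -
    ((((s : K) + 1) / 2) • dt s τ -
      (2 : K)⁻¹ • ∑ l ∈ Finset.Icc 1 (s - 1), dt l (dt (s - l) τ))

/-- The shift replaces t_l by t_l - z^l / l. The weight l cancels 1/l, and the displaced terms,
finitely many in each order, make up the tail. -/
theorem coeff_shift_formalSum (s : ℤ) (τ : Fn K) (n : ℕ) :
    coeff n (shift (formalSum fun l : ℕ+ => ((l : ℕ) : K) • (time a l * dt ((l : ℤ) + s) τ))) =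
      formalSum (fun l : ℕ+ => ((l : ℕ) : K) • (time a l * dt ((l : ℤ) + s) (schurShift n τ))) -
        coeff n (nablaTail s τ) := by
  have h1 : ∀ l : ℕ+, schurShift n (((l : ℕ) : K) • (time a l * dt ((l : ℤ) + s) τ)) =
      ((l : ℕ) : K) • (time a l * dt ((l : ℤ) + s) (schurShift n τ)) +
        if (l : ℕ) ≤ n then -dt (((l : ℕ) : ℤ) + s) (schurShift (n - l) τ) else 0 := by
    intro l
    have h2 : PowerSeries.C (MvPowerSeries.C ((l : ℕ) : K) : Fn K) *
        PowerSeries.C (MvPowerSeries.C ((l : ℕ) : K)⁻¹) = 1 := by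
      rw [← map_mul, ← map_mul, mul_inv_cancel₀ (by simp), map_one, map_one]
    have h3 : shift (((l : ℕ) : K) • (time a l * dt ((l : ℤ) + s) τ)) =
        PowerSeries.C (((l : ℕ) : K) • time a l) * dtS ((l : ℤ) + s) (shift τ) -
          X ^ (l : ℕ) * dtS ((l : ℤ) + s) (shift τ) := by
      rw [shift_smul, shift_mul, shift_time, shift_dt, MvPowerSeries.smul_eq_C_mul, map_mul]
      linear_combination (-X ^ (l : ℕ) * dtS ((l : ℤ) + s) (shift τ)) * h2
    rw [← coeff_shift, h3, map_sub, PowerSeries.coeff_C_mul, coeff_dtS, coeff_shift, smul_mul_assoc,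
      PowerSeries.coeff_X_pow_mul', sub_eq_add_neg]
    congr 1
    split_ifs with hl
    · rw [coeff_dtS, coeff_shift]
    · rw [neg_zero]
  have h4 : FSummable fun l : ℕ+ =>
      if (l : ℕ) ≤ n then -dt (((l : ℕ) : ℤ) + s) (schurShift (n - l) τ) else 0 := by
    refine fsummable_of_support (s := Finset.Icc 1 n.succPNat) fun l hl => ?_
    rw [Finset.mem_Icc, ← PNat.coe_le_coe, ← PNat.coe_le_coe, Nat.succPNat_coe]
    refine ⟨l.2, ?_⟩
    by_contra h5
    exact hl (if_neg (by omega))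
  rw [coeff_shift, schurShift_formalSum ((fsummable_time_mul a _).smul _)]
  simp only [h1]
  rw [formalSum_add ((fsummable_time_mul a _).smul _) h4,
    formalSum_le (fun l => -dt ((l : ℤ) + s) (schurShift (n - l) τ)), Finset.sum_neg_distrib,
    nablaTail, coeff_mk, sub_eq_add_neg]
  congr 2
  refine Finset.sum_congr rfl fun j _ => ?_
  rw [show n - (j + 1) = n - 1 - j by omega]
  push_cast
  rfl

namespace IsKP

variable (h : IsKP τ V)
include h

/-- Apply the product rule to τ(t - [z]) = wτ: where the derivative hits τ, the result is the term
that `variation` subtracts. -/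
theorem coeff_variation_formalSum (s : ℤ) (n : ℕ) :
    coeff n (variation τ (formalSum fun l : ℕ+ =>
      ((l : ℕ) : K) • (time a l * dt ((l : ℤ) + s) τ))) =
      formalSum (fun l : ℕ+ => ((l : ℕ) : K) • (time a l * dt ((l : ℤ) + s) (coeff n (wave τ)))) *
        τ - coeff n (nablaTail s τ) := by
  have hs : ∀ F : ℕ+ → Fn K, FSummable fun l : ℕ+ => ((l : ℕ) : K) • (time a l * F l) := fun F =>
    (fsummable_time_mul a F).smul _
  have h1 : schurShift n τ = coeff n (wave τ) * τ := by
    rw [← PowerSeries.coeff_mul_C, h.wave_mul_tau, coeff_shift]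
  have h2 : ∀ l : ℕ+, ((l : ℕ) : K) • (time a l * dt ((l : ℤ) + s) (schurShift n τ)) =
      ((l : ℕ) : K) • (time a l * dt ((l : ℤ) + s) (coeff n (wave τ))) * τ +
        ((l : ℕ) : K) • (time a l * dt ((l : ℤ) + s) τ) * coeff n (wave τ) := fun l => by
    rw [h1, dt_mul]
    simp only [MvPowerSeries.smul_eq_C_mul]
    ring
  rw [variation, map_sub, coeff_shift_formalSum, PowerSeries.coeff_mul_C]
  simp only [h2]
  rw [formalSum_add ((hs _).mul_right _) ((hs _).mul_right _), formalSum_mul (hs _),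
    formalSum_mul (hs _)]
  ring

omit [CharZero K] in
-- These are the Sato equations for the times l + s. The bound on s gives l + s ≥ 0, and for l + s =
-- 0 the term is zero on both sides.
theorem timeSeries_mul_dressing {s : ℤ} (hs : -1 ≤ s) (n : ℕ) :
    (timeSeries a (fun l => lax τ V ((l : ℤ) + s)) * dressing τ).1 (0 - n) =
      -formalSum fun l : ℕ+ => ((l : ℕ) : K) • (time a l * dt ((l : ℤ) + s) (coeff n (wave τ))) := by
  have h0 : ∀ (l : ℕ+) (f : Fn K), (((l : ℕ) : K) • time a l) * f =
    ((l : ℕ) : K) • (time a l * f) := fun l f => smul_mul_assoc _ _ _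
  rw [formalSum_mul_coe (A := fun l : ℕ+ => mono (((l : ℕ) : K) • time a l) 0 *
    npart (lax τ V ((l : ℤ) + s))) (M := -1) (N := 0) (fun l => (ordLE_negPart _).mono_mul _)
    (ordLE_dressing τ)]
  · rw [← neg_one_smul K, ← formalSum_smul]
    congr 1
    funext l
    have hl : (0 : ℤ) ≤ l + s := by have := l.pos; omega
    obtain ⟨m, hm⟩ := Int.eq_ofNat_of_zero_le hl
    have h1 := h.dtP_dressing m
    rw [hm, mul_assoc, ← neg_eq_iff_eq_neg.mpr h1, mono_zero_mul_coe, h0, coe_neg', dtP_coe, wave,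
      coeff_sym, mul_neg, smul_neg, neg_one_smul]
  · intro j
    simp only [mono_zero_mul_coe, h0]
    exact (fsummable_time_mul a _).smul _
  · intro j
    simp only [mono_zero_mul_coe, h0, timeSeries, negPart_coe]
    split_ifs
    · rfl
    · refine fn_ext fun m => ?_
      simp [coeff_formalSum]

omit [CharZero K] in
-- Moving t_l to the left of W costs nothing except for l = 1, where the commutator with x remains.
theorem orlovSchulman_coe (r : ℕ+) (k : ℕ) {s : ℤ} (hs : (r : ℤ) * ((k : ℤ) - 1) = s) (j : ℤ) :
    orlovSchulman a r (dressing τ) V k j = ((r : ℕ) : K)⁻¹ •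
      (formalSum (fun l : ℕ+ => ((l : ℕ) : K) • (time a l * (lax τ V ((l : ℤ) + s)).1 j)) +
        (timeComm a (dressing τ) * mono 1 (1 + s) * V).1 j) := by
  have h1 : ∀ l : ℕ+, dressing τ * mono (time a l) ((l : ℤ) - r) * V *
      laxPow (dressing τ) V (r * k) = mono (time a l) 0 * lax τ V ((l : ℤ) + s) +
        if l = 1 then timeComm a (dressing τ) * mono 1 (1 + s) * V else 0 := by
    intro l
    have h2 : dressing τ * mono (time a l) ((l : ℤ) - r) * V * laxPow (dressing τ) V (r * k) =
        dressing τ * mono (time a l) 0 * mono 1 ((l : ℤ) + s) * V := by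
      rw [laxPow, mono_eq]
      rw [show (l : ℤ) + s = (l - r) + ((r * k : ℕ) : ℤ) by rw [← hs]; push_cast; ring,
        ← mono_mul_mono_one]
      simp only [mul_assoc]
      rw [← mul_assoc V, h.inv_mul, one_mul]
    rw [h2, mul_mono_time, lax]
    split_ifs with hl
    · rw [hl]
      simp only [add_mul, mul_assoc, PNat.one_coe, Nat.cast_one]
    · simp only [add_zero, mul_assoc]
  have h3 : ∀ l : ℕ+, (((l : ℕ) / (r : ℕ) : K) • (dressing τ * mono (time a l) ((l : ℤ) - r) * V *
      laxPow (dressing τ) V (r * k)).1 j : Fn K) = ((r : ℕ) : K)⁻¹ •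
        (((l : ℕ) : K) • (time a l * (lax τ V ((l : ℤ) + s)).1 j) +
          if l = 1 then (timeComm a (dressing τ) * mono 1 (1 + s) * V).1 j else 0) := by
    intro l
    rw [h1, coe_add', mono_zero_mul_coe, div_eq_inv_mul, mul_smul, smul_add ((l : ℕ) : K)]
    split_ifs with hl
    · rw [hl, PNat.one_coe, Nat.cast_one, one_smul, one_smul]
    · rw [coe_zero', smul_zero]
  have h4 : ∀ l : ℕ+, (if l = 1 then (timeComm a (dressing τ) * mono 1 (1 + s) * V).1 j else 0) ≠ 0 →
      l ∈ ({1} : Finset ℕ+) := fun l hl => by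
    rw [Finset.mem_singleton]
    by_contra h5
    exact hl (if_neg h5)
  rw [orlovSchulman]
  simp only [h3]
  rw [formalSum_smul, formalSum_add ((fsummable_time_mul a _).smul _) (fsummable_of_support h4),
    formalSum_eq_sum h4, Finset.sum_singleton, if_pos rfl]

omit [CharZero K] in
theorem negPart_orlovSchulman (r : ℕ+) (k : ℕ) {s : ℤ} (hs : (r : ℤ) * ((k : ℤ) - 1) = s) :
    negPart (orlovSchulman a r (dressing τ) V k) = ((r : ℕ) : K)⁻¹ •
      (timeSeries a (fun l => lax τ V ((l : ℤ) + s)) +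
        npart (timeComm a (dressing τ) * mono 1 (1 + s) * V)) := by
  ext1 j
  rw [coe_smul', coe_add', timeSeries, negPart_coe, negPart_coe, negPart_coe]
  split_ifs
  · rw [h.orlovSchulman_coe a r k hs]
  · rw [add_zero, smul_zero]

/-- The flow `∂W = -(M L^k)₋ W` as a variation of the tau-function. -/
theorem sym_orlovSchulman (r : ℕ+) (k : ℕ) {s : ℤ} (hs : (r : ℤ) * ((k : ℤ) - 1) = s)
    (hs1 : -1 ≤ s) : sym 0 (-negPart (orlovSchulman a r (dressing τ) V k) * dressing τ) *
      PowerSeries.C τ = variation τ (((r : ℕ) : K)⁻¹ • kpVirasoro a s τ) := by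
  have h1 : sym 0 (timeSeries a (fun l => lax τ V ((l : ℤ) + s)) * dressing τ) *
      PowerSeries.C τ = -variation τ (formalSum fun l : ℕ+ =>
        ((l : ℕ) : K) • (time a l * dt ((l : ℤ) + s) τ)) - nablaTail s τ := by
    refine ser_ext fun n => ?_
    rw [PowerSeries.coeff_mul_C, coeff_sym, h.timeSeries_mul_dressing a hs1, map_sub, map_neg,
      h.coeff_variation_formalSum]
    ring
  rw [h.negPart_orlovSchulman a r k hs, neg_mul, sym_neg, pdo_smul_mul, sym_smul, add_mul, sym_add,
    variation_smul, kpVirasoro, variation_sub]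
  -- The tail from shifting the coefficients t_l and the tail from the commutator with x cancel.
  linear_combination (-PowerSeries.C (MvPowerSeries.C (((r : ℕ) : K)⁻¹))) *
    (h1 + h.sym_npart_timeComm a hs1)

end IsKP

end CharZero

end

section

open PowerSeries (coeff mk coeff_mk coeff_mul X)
open Finset.HasAntidiagonal

/-! ### The ghost flow -/

/-- Count multiplicities: c_i occurs with a plus sign for the N - i values p < N - i and with a
minus sign for the i + 1 values p ≤ i. -/
theorem sum_range_sub_sum (c : ℕ → Fn K) (N : ℕ) :
    ∑ p ∈ Finset.range (N + 1), ∑ i ∈ Finset.range (N - p), (c i - c (i + p)) =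
      ∑ i ∈ Finset.range N, ((N : K) - 1 - 2 * i) • c i := by
  have h1 : ∑ p ∈ Finset.range (N + 1), ∑ i ∈ Finset.range (N - p), c i =
      ∑ i ∈ Finset.range N, ((N : K) - i) • c i := by
    induction N with
    | zero => simp
    | succ N ih =>
      rw [Finset.sum_range_succ']
      simp only [Nat.add_sub_add_right, Nat.sub_zero]
      rw [ih, Finset.sum_range_succ, Finset.sum_range_succ, ← add_assoc, ← Finset.sum_add_distrib]
      congr 1
      · refine Finset.sum_congr rfl fun i _ => ?_
        push_cast
        module
      · push_cast
        module
  have h2 : ∑ p ∈ Finset.range (N + 1), ∑ i ∈ Finset.range (N - p), c (i + p) =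
      ∑ i ∈ Finset.range N, ((i : K) + 1) • c i := by
    clear h1
    induction N with
    | zero => simp
    | succ N ih =>
      have h3 : ∀ p ∈ Finset.range (N + 1), ∑ i ∈ Finset.range (N + 1 - p), c (i + p) =
          ∑ i ∈ Finset.range (N - p), c (i + p) + c N := fun p hp => by
        rw [Finset.mem_range] at hp
        rw [show N + 1 - p = N - p + 1 by omega, Finset.sum_range_succ,
          show N - p + p = N by omega]
      rw [Finset.sum_range_succ, Finset.sum_congr rfl h3, Finset.sum_add_distrib, ih,
        Finset.sum_const, Finset.card_range, Nat.sub_self, Finset.sum_range_zero, add_zero,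
        ← Nat.cast_smul_eq_nsmul K, Finset.sum_range_succ fun i : ℕ => ((i : K) + 1) • c i]
      push_cast
      rfl
  simp only [Finset.sum_sub_distrib]
  rw [h1, h2, ← Finset.sum_sub_distrib]
  refine Finset.sum_congr rfl fun i _ => ?_
  module

/-- The involution that swaps j and v and replaces (p, q) by (p - v + j, q - j + v) keeps p + q and
both first indices, and uncrosses the second ones. -/
theorem sum_exchange (s : ℕ → ℕ → Fn K) (N : ℕ) :
    ∑ p ∈ antidiagonal N, ∑ j ∈ Finset.range p.2, ∑ v ∈ Finset.range p.1,
        s (p.1 - 1 - v) j * s (p.2 - 1 - j) v =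
      ∑ p ∈ antidiagonal N, ∑ j ∈ Finset.range p.2, ∑ v ∈ Finset.range p.1,
        s (p.1 - 1 - v) v * s (p.2 - 1 - j) j := by
  simp only [← Finset.sum_product', Finset.sum_sigma']
  refine Finset.sum_nbij' (fun x => ⟨(x.1.1 - x.2.2 + x.2.1, x.1.2 - x.2.1 + x.2.2), (x.2.2, x.2.1)⟩)
    (fun x => ⟨(x.1.1 - x.2.2 + x.2.1, x.1.2 - x.2.1 + x.2.2), (x.2.2, x.2.1)⟩) ?_ ?_ ?_ ?_ ?_
  all_goals
    rintro ⟨⟨p, q⟩, j, v⟩ hx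
    simp only [Finset.mem_sigma, mem_antidiagonal, Finset.mem_product, Finset.mem_range] at hx ⊢
  · omega
  · omega
  · rw [show p - v + j - j + v = p by omega, show q - j + v - v + j = q by omega]
  · rw [show p - v + j - j + v = p by omega, show q - j + v - v + j = q by omega]
  · rw [show p - v + j - 1 - j = p - 1 - v by omega, show q - j + v - 1 - v = q - 1 - j by omega]

theorem isDiff_of_npart {A : PDO K} (h : npart A = 0) : IsDiff A := by
  have := posPart_add_npart A
  rw [h, add_zero] at this
  rw [← this]
  exact isDiff_posPart A

/-- For an adjoint eigenfunction, the coefficients of D⁻¹ g W along W D^{-m-1} are those of g(t -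
[z]). -/
theorem IsKP.sym_integral [CharZero K] {τ : Fn K} {V : PDO K} (h : IsKP τ V) (f : Fn K) {g : Fn K}
    (hg : IsAdjointEigenfunction (dressing τ) V g) :
    sym 0 (mono f 0 * Dinv * mono g 0 * dressing τ) = X * PowerSeries.C f * shift g * wave τ := by
  have h1 := sym_add_nat (ordLE_adj τ g) 1
  rw [← h.adjSer_mul_wave, ← (h.isAdjointEigenfunction_iff g).mp hg] at h1
  rw [show (0 : ℤ) = -1 + (1 : ℕ) by norm_num, mul_assoc (mono f _), mul_assoc (mono f _)]
  simp only [Nat.cast_one, neg_add_cancel] at h1 ⊢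
  rw [sym_mono_mul, h1]
  ring

section Constrained

variable {r : ℕ+} {τ : Fn K} {V : PDO K} {Φ Ψ : Fn K} {ι κ : Type*} {a₀ : ι} {b₀ : κ}
  {f : ι → ℕ → Fn K} {g : κ → ℕ → Fn K} {S : ι → ℕ → κ → ℕ → Fn K} [CharZero K]

namespace IsSEPSystem

variable (hS : IsSEPSystem r (dressing τ) V Φ Ψ a₀ b₀ f g S) (hL : IsCKP r τ V Φ Ψ)
include hS hL

/-- The negative part of `L^n`. -/
theorem npart_lax (n : ℕ) : npart (lax τ V ((n * r : ℕ) : ℤ)) =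
    ∑ i ∈ Finset.range n, mono (f a₀ (n - 1 - i)) 0 * Dinv * mono (g b₀ i) 0 := by
  have h := hL.isKP
  -- The main argument cancels a factor Ψ. If Ψ = 0, all (L*)^j(Ψ) vanish, and L is differential,
  -- hence so is L^n.
  by_cases hΨ : Ψ = 0
  · have h1 : ∀ j, g b₀ j = 0 := fun j => by
      induction j with
      | zero => rw [hS.adjoint_base, hΨ]
      | succ j ih => rw [hS.adjoint_step' hL, ih, hΨ]; simp
    have h2 : IsDiff (lax τ V (r : ℕ)) := isDiff_of_npart (by
      rw [hL.npart_lax, hΨ, mono_zero, mul_zero])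
    have h3 : IsDiff (lax τ V ((n * r : ℕ) : ℤ)) := by
      induction n with
      | zero => rw [zero_mul, Nat.cast_zero, h.lax_zero]; exact isDiff_mono 1 le_rfl
      | succ n ih =>
        rw [show (((n + 1) * r : ℕ) : ℤ) = (n * r : ℕ) + (r : ℕ) by push_cast; ring, ← h.lax_mul]
        exact ih.mul h2
    rw [npart_of_isDiff h3, Finset.sum_eq_zero]
    intro i _
    rw [h1, mono_zero, mul_zero]
  -- Take g = Ψ in the formula for (D⁻¹ g L^n)₋ and apply D: the left becomes ΨL^n, and ∂_x S(h, Ψ)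
  -- = Ψh produces the factor Ψ on the right.
  · have h1 := (hS.npart_and_dt hL n).1 b₀ 0
    set A := Dinv * mono (g b₀ 0) 0 * lax τ V ((n * r : ℕ) : ℤ) with hA
    have h2 : Dop * A = mono Ψ 0 * lax τ V ((n * r : ℕ) : ℤ) := by
      rw [hA, ← mul_assoc, ← mul_assoc, Dop_mul_Dinv, one_mul, hS.adjoint_base]
    have h3 : npart (Dop * A) = npart (Dop * npart A) := by
      conv_lhs => rw [← posPart_add_npart A]
      rw [mul_add, npart_add, npart_of_isDiff ((isDiff_mono 1 (by omega)).mul (isDiff_posPart A)),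
        zero_add]
    have h4 : ∀ m, Dop * (mono (S a₀ (n - 1 - m) b₀ 0) 0 * (Dinv * mono (g b₀ m) 0)) =
        mono (S a₀ (n - 1 - m) b₀ 0) 0 * mono (g b₀ m) 0 +
          mono Ψ 0 * (mono (f a₀ (n - 1 - m)) 0 * Dinv * mono (g b₀ m) 0) := fun m => by
      rw [← mul_assoc, Dop_mul_mono_zero, h.dx_sep (hS.isSEP_left a₀ (n - 1 - m)), add_mul,
        mul_assoc (mono _ 0) Dop, ← mul_assoc Dop, Dop_mul_Dinv, one_mul, ← mono_zero_mul_mono]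
      simp only [mul_assoc]
    rw [h2, npart_mono_mul, h1, mul_add, ← mul_assoc Dop, Dop_mul_Dinv, one_mul, Finset.mul_sum]
      at h3
    simp only [h4] at h3
    rw [npart_add, npart_of_isDiff (isDiff_mono _ le_rfl), zero_add, npart_sum] at h3
    simp only [npart_add, npart_of_isDiff ((isDiff_mono (_ : Fn K) le_rfl).mul
      (isDiff_mono (_ : Fn K) le_rfl)), zero_add, npart_mono_mul] at h3
    simp only [npart_of_ordLE (ordLE_integral _ _)] at h3
    rw [← Finset.mul_sum] at h3
    ext1 j
    have h5 := congrArg (fun B : PDO K => B.1 j) h3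
    simp only [mono_zero_mul_coe] at h5
    exact mul_left_cancel₀ hΨ h5

/-- Insert (L^n)₋ into the Sato equation: a summand f D⁻¹ g W has symbol z f g(t - [z]) w, which is
-w times the shift increment of its potential. -/
theorem omega_mul (n : ℕ) : omega τ ((n * r : ℕ) : ℤ) =
    ∑ i ∈ Finset.range n, (shift (S a₀ (n - 1 - i) b₀ i) - PowerSeries.C (S a₀ (n - 1 - i) b₀ i)) := by
  have h := hL.isKP
  refine mul_right_cancel₀ h.wave_ne_zero ?_
  rw [← h.dtS_wave, wave, ← sym_dtP, h.dtP_dressing, hS.npart_lax hL, sym_neg, Finset.sum_mul,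
    sym_sum, Finset.sum_mul, ← Finset.sum_neg_distrib]
  refine Finset.sum_congr rfl fun i _ => ?_
  rw [h.sym_integral _ (hS.isAdjointEigenfunction hL b₀ i), hS.shift_S hL, sym_dressing]
  ring

/-- The derivatives of the tau-function with respect to the times `t_{nr}`. -/
theorem dt_tau (h0 : ∀ n : ℕ+, MvPowerSeries.constantCoeff (dt ((r : ℤ) * (n : ℤ)) τ) =
      MvPowerSeries.constantCoeff ((∑ i ∈ Finset.range n, S a₀ (n - 1 - i) b₀ i) * τ)) (n : ℕ) :
    dt ((n * r : ℕ) : ℤ) τ = (∑ i ∈ Finset.range n, S a₀ (n - 1 - i) b₀ i) * τ := by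
  have h := hL.isKP
  rcases Nat.eq_zero_or_pos n with rfl | hn
  · simp
  have h1 := hS.omega_mul hL n
  rw [omega, Finset.sum_sub_distrib, ← shift_sum, ← map_sum] at h1
  set T := ∑ i ∈ Finset.range n, S a₀ (n - 1 - i) b₀ i with hT
  -- ∂_{nr} log τ and the sum of potentials have equal shift increments, so they differ by a
  -- constant; the normalization at the base point makes it 0.
  have h2 := eq_C_of_shift_eq (f := theta τ ((n * r : ℕ) : ℤ) - T) (by
    rw [shift_sub, map_sub]
    linear_combination h1)
  have h3 := h0 ⟨n, hn⟩
  rw [PNat.mk_coe, ← hT, show (r : ℤ) * (n : ℤ) = ((n * r : ℕ) : ℤ) by push_cast; ring,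
    ← h.theta_mul_tau, map_mul, map_mul] at h3
  have h4 := mul_right_cancel₀ h.tau_ne_zero h3
  rw [map_sub, h4, sub_self, map_zero, sub_eq_zero] at h2
  rw [← h.theta_mul_tau, h2]

/-- Let T_q be the sum of potentials with ∂_{qr} τ = T_q τ. Differentiating in t_{pr} gives linear
terms and two quadratic ones, from ∂_{pr} T_q and from T_p T_q. Summed over p + q = N the quadratic
ones cancel by `sum_exchange`, and `sum_range_sub_sum` counts the linear ones. -/
theorem sum_dt_dt_tau (hτ : ∀ n : ℕ, dt ((n * r : ℕ) : ℤ) τ =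
      (∑ i ∈ Finset.range n, S a₀ (n - 1 - i) b₀ i) * τ) (N : ℕ) :
    ∑ p ∈ antidiagonal N, dt ((p.1 * r : ℕ) : ℤ) (dt ((p.2 * r : ℕ) : ℤ) τ) =
      (∑ i ∈ Finset.range N, ((N : K) - 1 - 2 * i) • S a₀ (N - 1 - i) b₀ i) * τ := by
  have h1 : ∀ p ∈ antidiagonal N, dt ((p.1 * r : ℕ) : ℤ) (dt ((p.2 * r : ℕ) : ℤ) τ) =
      (∑ i ∈ Finset.range p.2, (S a₀ (N - 1 - i) b₀ i - S a₀ (N - 1 - (i + p.1)) b₀ (i + p.1)) -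
        (∑ j ∈ Finset.range p.2, ∑ v ∈ Finset.range p.1,
          S a₀ (p.1 - 1 - v) b₀ j * S a₀ (p.2 - 1 - j) b₀ v) +
        ∑ j ∈ Finset.range p.2, ∑ v ∈ Finset.range p.1,
          S a₀ (p.1 - 1 - v) b₀ v * S a₀ (p.2 - 1 - j) b₀ j) * τ := by
    rintro ⟨p, q⟩ hpq
    rw [mem_antidiagonal] at hpq
    dsimp only at hpq ⊢
    rw [hτ q, dt_mul, hτ p, dt_sum, Finset.sum_congr rfl fun i _ => (hS.npart_and_dt hL p).2 a₀ _ b₀ i,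
      Finset.sum_sub_distrib]
    have h2 : ∀ i ∈ Finset.range q, S a₀ (q - 1 - i + p) b₀ i - S a₀ (q - 1 - i) b₀ (i + p) =
        S a₀ (N - 1 - i) b₀ i - S a₀ (N - 1 - (i + p)) b₀ (i + p) := fun i hi => by
      rw [Finset.mem_range] at hi
      rw [show q - 1 - i + p = N - 1 - i by omega, show q - 1 - i = N - 1 - (i + p) by omega]
    rw [Finset.sum_congr rfl h2]
    simp only [← Finset.sum_mul, ← Finset.mul_sum]
    ring
  rw [Finset.sum_congr rfl h1, ← Finset.sum_mul, Finset.sum_add_distrib, Finset.sum_sub_distrib,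
    sum_exchange fun i j => S a₀ i b₀ j, sub_add_cancel,
    Finset.Nat.sum_antidiagonal_eq_sum_range_succ_mk,
    sum_range_sub_sum fun i => S a₀ (N - 1 - i) b₀ i]

/-- The ghost flow as a variation of the tau-function. -/
theorem sym_ghost (hτ : ∀ n : ℕ, dt ((n * r : ℕ) : ℤ) τ =
      (∑ i ∈ Finset.range n, S a₀ (n - 1 - i) b₀ i) * τ) (k : ℕ) :
    sym 0 (ghost (f a₀) (g b₀) k * dressing τ) * PowerSeries.C τ =
      variation τ ((2 : K)⁻¹ • ∑ l ∈ Finset.Icc (1 : ℤ) ((k : ℤ) - 2),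
        dt ((r : ℤ) * l) (dt ((r : ℤ) * ((k : ℤ) - 1 - l)) τ)) := by
  have h := hL.isKP
  rcases k with _ | N
  · rw [Finset.Icc_eq_empty (by norm_num), Finset.sum_empty, smul_zero]
    rw [ghost, Nat.zero_sub, Finset.sum_range_zero, zero_mul, variation, shift_zero, map_zero,
      mul_zero, sub_zero]
    refine ser_ext fun n => ?_
    simp
  have h1 : ∑ l ∈ Finset.Icc (1 : ℤ) (((N + 1 : ℕ) : ℤ) - 2),
        dt ((r : ℤ) * l) (dt ((r : ℤ) * (((N + 1 : ℕ) : ℤ) - 1 - l)) τ) =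
      (∑ i ∈ Finset.range N, ((N : K) - 1 - 2 * i) • S a₀ (N - 1 - i) b₀ i) * τ := by
    rw [← hS.sum_dt_dt_tau hL hτ, show ((N + 1 : ℕ) : ℤ) - 2 = N - 1 by push_cast; ring,
      show ((N + 1 : ℕ) : ℤ) - 1 = N by push_cast; ring,
      sum_Icc_eq_sum_antidiagonal N (fun l m => dt ((r : ℤ) * l) (dt ((r : ℤ) * m) τ)) (by simp)
        (by simp)]
    refine Finset.sum_congr rfl fun p _ => ?_
    push_cast
    rw [mul_comm (r : ℤ), mul_comm (r : ℤ)]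
  have h2 : ∀ j ∈ Finset.range N,
      sym 0 ((((j : K) - (((N + 1 : ℕ) : K) - 2) / 2) •
        (mono (f a₀ (N + 1 - 2 - j)) 0 * mono 1 (-1) * mono (g b₀ j) 0)) * dressing τ) *
        PowerSeries.C τ =
      variation τ ((2 : K)⁻¹ • (((N : K) - 1 - 2 * j) • S a₀ (N - 1 - j) b₀ j * τ)) := by
    intro j _
    -- With k = N + 1 the ghost coefficient j - (k - 2)/2 is -(N - 1 - 2j)/2; the sign matches
    -- because the variation of Sτ is -z f g(t - [z]) wτ.
    have h3 : (2 : K)⁻¹ • (((N : K) - 1 - 2 * j) • S a₀ (N - 1 - j) b₀ j * τ) =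
        ((j : K) - (((N + 1 : ℕ) : K) - 2) / 2) • (-(S a₀ (N - 1 - j) b₀ j * τ)) := by
      rw [smul_mul_assoc, smul_smul, smul_neg, ← neg_smul]
      congr 1
      push_cast
      field_simp
      ring
    rw [h3, variation_smul, pdo_smul_mul, sym_smul,
      h.sym_integral _ (hS.isAdjointEigenfunction hL b₀ j), variation, shift_neg, shift_mul,
      hS.shift_S hL, ← h.wave_mul_tau, map_neg, map_mul, show N + 1 - 2 - j = N - 1 - j by omega]
    ring
  rw [h1, ghost, Finset.sum_mul, sym_sum, Finset.sum_mul, Nat.add_sub_cancel,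
    Finset.sum_congr rfl h2, ← variation_sum, Finset.sum_mul, Finset.smul_sum]

end IsSEPSystem

end Constrained

theorem virasoroOp_eq [CharZero K] (a : ℕ+ →₀ K) (r : ℕ+) (k : ℕ) (τ : Fn K) :
    virasoroOp a r k τ = ((r : ℕ) : K)⁻¹ • kpVirasoro a ((r : ℤ) * ((k : ℤ) - 1)) τ +
      (2 : K)⁻¹ • ∑ l ∈ Finset.Icc (1 : ℤ) ((k : ℤ) - 2),
        dt ((r : ℤ) * l) (dt ((r : ℤ) * ((k : ℤ) - 1 - l)) τ) := by
  rw [virasoroOp, kpVirasoro, smul_sub, smul_sub, smul_smul, smul_smul]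
  rw [mul_inv, mul_comm (2 : K)⁻¹, div_mul_eq_div_div, div_eq_inv_mul _ ((r : ℕ) : K)]
  abel

theorem ordLE_virasoroFlow (a : ℕ+ →₀ K) (r : ℕ+) (τ : Fn K) (V : PDO K) (φ ψ : ℕ → Fn K) (k : ℕ) :
    OrdLE (virasoroFlow a r (dressing τ) V φ ψ k) 0 := by
  refine ((ordLE_negPart _).neg.mul' (ordLE_dressing τ) (by omega)).add
    (OrdLE.mul' (M := -1) (OrdLE.sum fun j _ => ?_) (ordLE_dressing τ) (by omega))
  rw [smul_eq_mono_mul]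
  exact (ordLE_integral _ _).mono_mul _

end

end KP

end

/-! ### The two assertions -/

theorem mainTheorem8 {K : Type*} [Field K] [CharZero K]
    (r : ℕ+) (a : ℕ+ →₀ K) (τ : KP.Fn K) (V : KP.PDO K) (Φ Ψ : KP.Fn K)
    (hL : KP.IsCKP r τ V Φ Ψ)
    {ι κ : Type*} (a₀ : ι) (b₀ : κ) (f : ι → ℕ → KP.Fn K) (g : κ → ℕ → KP.Fn K)
    (S : ι → ℕ → κ → ℕ → KP.Fn K)
    (hS : KP.IsSEPSystem r (KP.dressing τ) V Φ Ψ a₀ b₀ f g S) :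
    (∀ (α : ι) (β : κ) (n : ℕ+),
      KP.dt ((n : ℤ) * (r : ℤ)) (S α 0 β 0) =
        S α n β 0 - S α 0 β n
          - ∑ i ∈ Finset.range n, S a₀ (n - 1 - i) β 0 * S α 0 b₀ i) ∧
    ((∀ n : ℕ+, MvPowerSeries.constantCoeff (KP.dt ((r : ℤ) * (n : ℤ)) τ) =
        MvPowerSeries.constantCoeff
          ((∑ i ∈ Finset.range n, S a₀ (n - 1 - i) b₀ i) * τ)) →
      ∀ k : ℕ, -1 ≤ (r : ℤ) * ((k : ℤ) - 1) →
        ∀ δ : KP.Fn K,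
          KP.virasoroFlow a r (KP.dressing τ) V (f a₀) (g b₀) k = KP.dressingVariation τ δ ↔
            ∃ c : K, δ = KP.virasoroOp a r k τ + c • τ) := by
  have h := hL.isKP
  refine ⟨fun α β n => ?_, fun h0 k hk δ => ?_⟩
  · have h1 := (hS.npart_and_dt hL n).2 α 0 β 0
    rw [zero_add, Nat.cast_mul] at h1
    exact h1
  · refine h.eq_dressingVariation_iff (KP.ordLE_virasoroFlow a r τ V (f a₀) (g b₀) k) ?_ δ
    rw [KP.virasoroFlow, KP.sym_add, add_mul, h.sym_orlovSchulman a r k rfl hk,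
      hS.sym_ghost hL (hS.dt_tau hL h0), KP.virasoroOp_eq, KP.variation_add]
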